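/- Let $n\ge 1$ and let $\mathscr F=\bigoplus_{k\ge 0}\mathscr H_k^+$ be the bosonic Fock space, where $\mathscr H_0^+=\mathbb C$ and $\mathscr H_k^+$ is the space of permutation-symmetric functions in $L^2((\mathbb R^n)^k,d^n\mathbf p_1\cdots d^n\mathbf p_k)$. Let $\mathscr S(\mathbb R^n)_\otimes\subset\mathscr F$ be the subspace of vectors $\Psi=(\Psi_0,\Psi_1,\dots)$ with $\Psi_k=0$ for $k$ large enough and each $\Psi_k$ in the algebraic tensor product $\mathscr S(\mathbb R^n)^{\otimes k}$. Use the Minkowski product $xy=x^0y^0-\sum_{j=1}^n x^jy^j$ on $\mathbb R^{n+1}$ and let a massless particle have four-momentum $p^\mu=(|\mathbf p|,\mathbf p)$. Define the following operators on $\mathscr F$ through their action on $k$-particle functions: \begin{itemize} \item the number operator $N$ is multiplication by $k$; the momentum $P^\mu$ is multiplication by $\sum_{i=1}^k p_i^\mu$; the velocity $V^j$ is multiplication by $\sum_{i=1}^k p_i^j/|\mathbf p_i|$; $U(y)=e^{iy^\mu P_\mu}$ for $y\in\mathbb R^{n+1}$; \item the coordinate operator $X_j=-i\sum_{i=1}^k\partial/\partial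 p_i^j$ on $\mathscr S(\mathbb R^n)_\otimes$, and $X^j=-X_j$ (index raised with the metric), $1\le j\le n$. \end{itemize} Let $\theta=(\theta^{\mu\nu})$ be a real skew-symmetric $(n+1)\times(n+1)$ matrix, $(\theta x)^\mu=\theta^{\mu\nu}x_\nu$, and $(\theta P)^\mu=\theta^{\mu\nu}P_\nu$ (the corresponding multiplication operator on its maximal domain). Write $\overline{X^j}$ for the closure of $X^j$ and $\alpha_z(A)=U(z)AU(z)^{-1}$. The deformed coordinate operator $X^j_\theta$ is the warped convolution \[ X^j_\theta\Phi=\lim_{\varepsilon\to0^+}(2\pi)^{-(n+1)}\iint dx\,dy\,\chi(\varepsilon x,\varepsilon y)\,e^{-ixy}\,U(y)\,\alpha_{\theta x}(\overline{X^j})\,\Phi , \] for $\Phi\in\mathscr S(\mathbb R^n)_\otimes$ and $\chi\in\mathscr S(\mathbb R^{n+1}\times\mathbb R^{n+1})$ with $\chi(0,0)=1$. Then, for every $j$: \begin{enumerate} \item $\mathscr S(\mathbb R^n)_\otimes$ is dense in $\mathscr F$, and for every $\Phi\in\mathscr S(\mathbb R^n)_\otimes$ the warped convolution is well defined: $\Phi$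 lies in the domain of $\alpha_z(\overline{X^j})$ for all $z$, the regularised integrals exist as Bochner integrals for all $\chi$ and $\varepsilon>0$, and their limit exists in norm and does not depend on $\chi$; \item on $\mathscr S(\mathbb R^n)_\otimes$ one has $X^j_\theta=X^j+(\theta P)^0V^j-(\theta P)^jN$; \item $X^j_\theta$ is essentially self-adjoint on $\mathscr S(\mathbb R^n)_\otimes$, i.e. it is densely defined and closable and its closure is self-adjoint. \end{enumerate} -/

import Mathlib

open scoped SchwartzMap InnerProductSpace
open MeasureTheory Filter Topology

noncomputable section

/-! ### Bosonic Fock space (noncovariant representation, units with speed of light one) -/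

/-- The space `ℝⁿ` of spatial momenta. -/
abbrev Momentum (n : ℕ) : Type := EuclideanSpace ℝ (Fin n)

/-- The group `ℝ^{n+1}`; the index `0` is the time component, `j.succ` the `j`-th spatial one. -/
abbrev Spacetime (n : ℕ) : Type := EuclideanSpace ℝ (Fin (n + 1))

/-- `L²((ℝⁿ)ᵏ, dⁿp₁ ⋯ dⁿp_k)`. -/
abbrev NParticleL2 (n k : ℕ) : Type := Lp ℂ 2 (volume : Measure (Fin k → Momentum n))

theorem measurePreserving_perm {n k : ℕ} (σ : Equiv.Perm (Fin k)) :
    MeasurePreserving (fun p : Fin k → Momentum n => p ∘ σ) volume volume := by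
  have h := volume_measurePreserving_piCongrLeft (fun _ : Fin k => Momentum n) σ.symm
  have e : (fun p : Fin k → Momentum n => p ∘ σ) =
      (MeasurableEquiv.piCongrLeft (fun _ : Fin k => Momentum n) σ.symm) := by
    funext p
    funext i
    have := MeasurableEquiv.piCongrLeft_apply_apply (β := fun _ : Fin k => Momentum n)
      σ.symm p (σ i)
    simpa using this.symm
  rw [e]
  exact h

theorem ae_comp_perm {n k : ℕ} (σ : Equiv.Perm (Fin k)) {f g : (Fin k → Momentum n) → ℂ}
    (h : f =ᵐ[volume] g) : (fun p => f (p ∘ σ)) =ᵐ[volume] fun p => g (p ∘ σ) :=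
  (measurePreserving_perm σ).quasiMeasurePreserving.ae_eq_comp h

/-- The symmetric `k`-particle subspace `ℋ_k⁺`: permutation invariant square integrable
functions of `k` momenta.  For `k = 0` the base is a one-point space and this is `ℂ`. -/
def symmetricL2 (n k : ℕ) : Submodule ℂ (NParticleL2 n k) where
  carrier := {ψ | ∀ σ : Equiv.Perm (Fin k), (fun p => ψ (p ∘ σ)) =ᵐ[volume] ψ}
  zero_mem' := fun σ =>
    (ae_comp_perm σ (Lp.coeFn_zero ℂ 2 volume)).trans (Lp.coeFn_zero ℂ 2 volume).symm
  add_mem' := by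
    intro a b ha hb σ
    refine (ae_comp_perm σ (Lp.coeFn_add a b)).trans (EventuallyEq.trans ?_
      (Lp.coeFn_add a b).symm)
    filter_upwards [ha σ, hb σ] with p h1 h2
    simp [h1, h2]
  smul_mem' := by
    intro c a ha σ
    refine (ae_comp_perm σ (Lp.coeFn_smul c a)).trans (EventuallyEq.trans ?_
      (Lp.coeFn_smul c a).symm)
    filter_upwards [ha σ] with p h1
    simp [h1]

theorem isClosed_symmetricL2 (n k : ℕ) :
    IsClosed (symmetricL2 n k : Set (NParticleL2 n k)) := by
  have e : (symmetricL2 n k : Set (NParticleL2 n k)) =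
      ⋂ σ : Equiv.Perm (Fin k),
        {ψ | Lp.compMeasurePreservingₗᵢ ℂ _ (measurePreserving_perm (n := n) σ) ψ = ψ} := by
    ext ψ
    simp only [Set.mem_iInter, Set.mem_ofPred_eq, SetLike.mem_coe]
    refine forall_congr' fun σ => ?_
    have h := Lp.coeFn_compMeasurePreserving ψ (measurePreserving_perm (n := n) σ)
    constructor
    · intro h1
      exact Lp.ext (h.trans h1)
    · intro h1
      have h2 : (Lp.compMeasurePreserving _ (measurePreserving_perm (n := n) σ) ψ) = ψ := h1
      rw [h2] at h
      exact h.symm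
  rw [e]
  exact isClosed_iInter fun σ => isClosed_eq (LinearIsometry.continuous _) continuous_id

instance (n k : ℕ) : CompleteSpace (symmetricL2 n k) :=
  (isClosed_symmetricL2 n k).completeSpace_coe

/-- The bosonic Fock space `⨁ₖ ℋ_k⁺` (Hilbert space direct sum). -/
abbrev Fock (n : ℕ) : Type := lp (fun k : ℕ => symmetricL2 n k) 2

/-- The `k`-particle wave function of a Fock space vector. -/
def Fock.wave {n : ℕ} (Ψ : Fock n) (k : ℕ) : (Fin k → Momentum n) → ℂ :=
  ((Ψ k : symmetricL2 n k) : NParticleL2 n k)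

theorem Fock.wave_zero {n : ℕ} (k : ℕ) : (0 : Fock n).wave k =ᵐ[volume] 0 :=
  Lp.coeFn_zero ℂ 2 volume

theorem Fock.wave_add {n : ℕ} (Ψ Φ : Fock n) (k : ℕ) :
    (Ψ + Φ).wave k =ᵐ[volume] fun p => Ψ.wave k p + Φ.wave k p :=
  Lp.coeFn_add ((Ψ k : symmetricL2 n k) : NParticleL2 n k) (Φ k : symmetricL2 n k)

theorem Fock.wave_smul {n : ℕ} (c : ℂ) (Ψ : Fock n) (k : ℕ) :
    (c • Ψ).wave k =ᵐ[volume] fun p => c * Ψ.wave k p :=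
  Lp.coeFn_smul c ((Ψ k : symmetricL2 n k) : NParticleL2 n k)

theorem Fock.ext_wave {n : ℕ} {Ψ Φ : Fock n} (h : ∀ k, Ψ.wave k =ᵐ[volume] Φ.wave k) :
    Ψ = Φ :=
  lp.ext (funext fun k => Subtype.ext (Lp.ext (h k)))

/-! ### Unbounded operators -/

section Operators

variable {H : Type*} [NormedAddCommGroup H] [InnerProductSpace ℂ H]

/-- The product `A B` on its natural domain `{Φ ∈ D(B) | B Φ ∈ D(A)}`. -/
def opMul (A B : H →ₗ.[ℂ] H) : H →ₗ.[ℂ] H where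
  domain := (A.domain.comap B.toFun).map B.domain.subtype
  toFun :=
    { toFun := fun Φ => A ⟨B ⟨Φ, by obtain ⟨x, -, hx⟩ := Φ.2; rw [← hx]; exact x.2⟩, by
        obtain ⟨Φ, x, hx, rfl⟩ := Φ; exact hx⟩
      map_add' := by
        intro x y
        rw [← LinearPMap.map_add]
        congr 1
        apply Subtype.ext
        exact LinearPMap.map_add B ⟨x, _⟩ ⟨y, _⟩
      map_smul' := by
        intro c x
        rw [RingHom.id_apply, ← LinearPMap.map_smul]
        congr 1
        apply Subtype.ext
        exact LinearPMap.map_smul B c ⟨x, _⟩ }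

/-- A densely defined operator is essentially self-adjoint (on its domain) if it is closable
and its closure is self-adjoint. -/
def IsEssentiallySelfAdjoint [CompleteSpace H] (A : H →ₗ.[ℂ] H) : Prop :=
  Dense (A.domain : Set H) ∧ A.IsClosable ∧ IsSelfAdjoint A.closure

/-- `V A V⁻¹` for a unitary `V`, on the domain `V D(A)`. -/
def conjugateOp (V : H ≃ₗᵢ[ℂ] H) (A : H →ₗ.[ℂ] H) : H →ₗ.[ℂ] H where
  domain := A.domain.comap (V.symm.toLinearEquiv : H →ₗ[ℂ] H)
  toFun :=
    { toFun := fun Φ => V (A ⟨V.symm Φ, Φ.2⟩)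
      map_add' := by
        intro x y
        rw [← map_add, ← LinearPMap.map_add]
        congr 2
        apply Subtype.ext
        exact map_add V.symm (x : H) y
      map_smul' := by
        intro c x
        rw [RingHom.id_apply, ← map_smul, ← LinearPMap.map_smul]
        congr 2
        apply Subtype.ext
        exact map_smul V.symm c (x : H) }

end Operators

/-! ### Warped convolutions -/

/-- Diagonal of the Minkowski metric of signature `(+,-,…,-)`. -/
def minkowskiSign {n : ℕ} : Fin (n + 1) → ℝ := Fin.cons 1 fun _ => -1

/-- The Minkowski product `x y = x⁰y⁰ - x¹y¹ - ⋯ - xⁿyⁿ`. -/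
def minkowski {n : ℕ} (x y : Spacetime n) : ℝ := ∑ μ, minkowskiSign μ * x μ * y μ

/-- `(θx)^μ = θ^{μν} x_ν`, where `x_ν` is obtained from `x^ν` by lowering the index. -/
def deform {n : ℕ} (θ : Matrix (Fin (n + 1)) (Fin (n + 1)) ℝ) (x : Spacetime n) : Spacetime n :=
  WithLp.toLp 2 fun μ => ∑ ν, θ μ ν * (minkowskiSign ν * x ν)

section Warped

variable {n : ℕ} {H : Type*} [NormedAddCommGroup H] [InnerProductSpace ℂ H]

/-- The regularised integrand `χ(εx, εy) e^{-ixy} U(y) α_{θx}(A) Φ` of the warped convolution,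
where `α_{z}(A) = U(z) A U(z)⁻¹`. -/
def warpedIntegrand (U : Spacetime n → H ≃ₗᵢ[ℂ] H)
    (θ : Matrix (Fin (n + 1)) (Fin (n + 1)) ℝ) (A : H →ₗ.[ℂ] H) (Φ : H)
    (hΦ : ∀ z, Φ ∈ (conjugateOp (U z) A).domain)
    (χ : 𝓢(Spacetime n × Spacetime n, ℂ)) (ε : ℝ) (z : Spacetime n × Spacetime n) : H :=
  (χ (ε • z) * Complex.exp (-(Complex.I * (minkowski z.1 z.2 : ℂ)))) •
    U z.2 (conjugateOp (U (deform θ z.1)) A ⟨Φ, hΦ (deform θ z.1)⟩)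

/-- `Ψ = A_θ Φ`: the vector `Φ` lies in the domain of all `α_z(A)`, and for every cutoff `χ` the
regularised integrals exist and
`(2π)^{-(n+1)} ∬ dx dy χ(εx, εy) e^{-ixy} U(y) α_{θx}(A) Φ` tends to `Ψ` in norm as `ε → 0`. -/
def IsWarpedConvolution (U : Spacetime n → H ≃ₗᵢ[ℂ] H)
    (θ : Matrix (Fin (n + 1)) (Fin (n + 1)) ℝ) (A : H →ₗ.[ℂ] H) (Φ Ψ : H) : Prop :=
  ∃ hΦ : ∀ z, Φ ∈ (conjugateOp (U z) A).domain,
    ∀ χ : 𝓢(Spacetime n × Spacetime n, ℂ), χ 0 = 1 →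
      (∀ ε : ℝ, 0 < ε → Integrable (warpedIntegrand U θ A Φ hΦ χ ε) volume) ∧
      Tendsto (fun ε : ℝ => (((2 * Real.pi) ^ (n + 1))⁻¹ : ℝ) •
        ∫ z, warpedIntegrand U θ A Φ hΦ χ ε z) (𝓝[>] 0) (𝓝 Ψ)

theorem exists_cutoff (n : ℕ) : ∃ χ : 𝓢(Spacetime n × Spacetime n, ℂ), χ 0 = 1 := by
  let b : ContDiffBump (0 : Spacetime n × Spacetime n) := ⟨1, 2, one_pos, one_lt_two⟩
  have h1 : HasCompactSupport (fun x => ((b x : ℝ) : ℂ)) :=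
    b.hasCompactSupport.comp_left (g := fun t : ℝ => (t : ℂ)) Complex.ofReal_zero
  have h2 : ContDiff ℝ (⊤ : ℕ∞) (fun x => ((b x : ℝ) : ℂ)) :=
    Complex.ofRealCLM.contDiff.comp b.contDiff
  refine ⟨h1.toSchwartzMap h2, ?_⟩
  change ((b 0 : ℝ) : ℂ) = 1
  rw [b.one_of_mem_closedBall (by simp [b])]
  simp

/-- The graph of the warped convolution. -/
def warpedGraph (U : Spacetime n → H ≃ₗᵢ[ℂ] H)
    (θ : Matrix (Fin (n + 1)) (Fin (n + 1)) ℝ) (A : H →ₗ.[ℂ] H) : Submodule ℂ (H × H) where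
  carrier := {q | IsWarpedConvolution U θ A q.1 q.2}
  zero_mem' := by
    refine ⟨fun z => Submodule.zero_mem _, fun χ _ => ?_⟩
    have e : ∀ ε, warpedIntegrand U θ A 0 (fun z => Submodule.zero_mem _) χ ε = 0 := by
      intro ε
      funext z
      have : conjugateOp (U (deform θ z.1)) A ⟨0, Submodule.zero_mem _⟩ = 0 :=
        LinearPMap.map_zero _
      simp [warpedIntegrand, this]
    constructor
    · intro ε _
      change Integrable (warpedIntegrand U θ A 0 _ χ ε) volume
      rw [e]
      exact integrable_zero _ _ _
    · change Tendsto (fun ε : ℝ => _ • ∫ z, warpedIntegrand U θ A 0 _ χ ε z) _ (𝓝 0)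
      simp [e]
  add_mem' := by
    rintro ⟨a, a'⟩ ⟨b, b'⟩ ⟨ha, ha'⟩ ⟨hb, hb'⟩
    refine ⟨fun z => Submodule.add_mem _ (ha z) (hb z), fun χ hχ => ?_⟩
    obtain ⟨ia, ta⟩ := ha' χ hχ
    obtain ⟨ib, tb⟩ := hb' χ hχ
    have e : ∀ ε, warpedIntegrand U θ A (a + b) (fun z => Submodule.add_mem _ (ha z) (hb z)) χ ε =
        warpedIntegrand U θ A a ha χ ε + warpedIntegrand U θ A b hb χ ε := by
      intro ε
      funext z
      have : conjugateOp (U (deform θ z.1)) A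
          ⟨a + b, Submodule.add_mem _ (ha (deform θ z.1)) (hb (deform θ z.1))⟩ =
          conjugateOp (U (deform θ z.1)) A ⟨a, ha (deform θ z.1)⟩ +
          conjugateOp (U (deform θ z.1)) A ⟨b, hb (deform θ z.1)⟩ :=
        LinearPMap.map_add _ ⟨a, _⟩ ⟨b, _⟩
      simp only [warpedIntegrand, this, map_add, smul_add, Pi.add_apply]
    constructor
    · intro ε hε
      change Integrable (warpedIntegrand U θ A (a + b) _ χ ε) volume
      rw [e]
      exact (ia ε hε).add (ib ε hε)
    · change Tendsto (fun ε : ℝ => _ • ∫ z, warpedIntegrand U θ A (a + b) _ χ ε z) _ (𝓝 (a' + b'))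
      refine (ta.add tb).congr' ?_
      filter_upwards [self_mem_nhdsWithin] with ε hε
      rw [e]
      simp only [Pi.add_apply]
      rw [integral_add (ia ε hε) (ib ε hε), smul_add]
  smul_mem' := by
    rintro c ⟨a, a'⟩ ⟨ha, ha'⟩
    refine ⟨fun z => Submodule.smul_mem _ c (ha z), fun χ hχ => ?_⟩
    obtain ⟨ia, ta⟩ := ha' χ hχ
    have e : ∀ ε, warpedIntegrand U θ A (c • a) (fun z => Submodule.smul_mem _ c (ha z)) χ ε =
        c • warpedIntegrand U θ A a ha χ ε := by
      intro ε
      funext z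
      have : conjugateOp (U (deform θ z.1)) A
          ⟨c • a, Submodule.smul_mem _ c (ha (deform θ z.1))⟩ =
          c • conjugateOp (U (deform θ z.1)) A ⟨a, ha (deform θ z.1)⟩ :=
        LinearPMap.map_smul _ c ⟨a, _⟩
      simp only [warpedIntegrand, this, map_smul, Pi.smul_apply]
      rw [smul_comm]
    constructor
    · intro ε hε
      change Integrable (warpedIntegrand U θ A (c • a) _ χ ε) volume
      rw [e]
      exact (ia ε hε).smul c
    · change Tendsto (fun ε : ℝ => _ • ∫ z, warpedIntegrand U θ A (c • a) _ χ ε z) _ (𝓝 (c • a'))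
      refine (ta.const_smul c).congr fun ε => ?_
      rw [e]
      simp only [Pi.smul_apply]
      rw [integral_smul, smul_comm]

theorem warpedGraph_single_valued (U : Spacetime n → H ≃ₗᵢ[ℂ] H)
    (θ : Matrix (Fin (n + 1)) (Fin (n + 1)) ℝ) (A : H →ₗ.[ℂ] H) :
    ∀ q ∈ warpedGraph U θ A, q.1 = 0 → q.2 = 0 := by
  rintro ⟨a, a'⟩ ⟨ha, ha'⟩ h0
  obtain rfl : a = 0 := h0
  obtain ⟨hz, hz'⟩ := (warpedGraph U θ A).zero_mem
  obtain ⟨χ, hχ⟩ := exists_cutoff n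
  exact tendsto_nhds_unique (ha' χ hχ).2 (hz' χ hχ).2

/-- The warped convolution `A_θ` of a (possibly unbounded) operator `A` with respect to `U`, on
the domain of all vectors for which the oscillatory integral converges. -/
def warpedConvolution (U : Spacetime n → H ≃ₗᵢ[ℂ] H)
    (θ : Matrix (Fin (n + 1)) (Fin (n + 1)) ℝ) (A : H →ₗ.[ℂ] H) : H →ₗ.[ℂ] H :=
  (warpedGraph U θ A).toLinearPMap

theorem warpedConvolution_graph (U : Spacetime n → H ≃ₗᵢ[ℂ] H)
    (θ : Matrix (Fin (n + 1)) (Fin (n + 1)) ℝ) (A : H →ₗ.[ℂ] H) (Φ Ψ : H) :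
    (Φ, Ψ) ∈ (warpedConvolution U θ A).graph ↔ IsWarpedConvolution U θ A Φ Ψ := by
  rw [warpedConvolution, Submodule.toLinearPMap_graph_eq _ (warpedGraph_single_valued U θ A)]
  rfl

end Warped

/-! ### Second quantised functions of the momentum -/

/-- The graph of multiplication by the functions `m k` in the `k`-particle spaces. -/
def mulGraph {n : ℕ} (m : (k : ℕ) → (Fin k → Momentum n) → ℂ) :
    Submodule ℂ (Fock n × Fock n) where
  carrier := {q | ∀ k, q.2.wave k =ᵐ[volume] fun p => m k p * q.1.wave k p}
  zero_mem' := by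
    intro k
    filter_upwards [Fock.wave_zero (n := n) k] with p hp
    simp [hp]
  add_mem' := by
    rintro ⟨a, a'⟩ ⟨b, b'⟩ ha hb k
    filter_upwards [ha k, hb k, Fock.wave_add a b k, Fock.wave_add a' b' k] with p h1 h2 h3 h4
    simp only [Prod.mk_add_mk] at *
    rw [h3, h4, h1, h2, mul_add]
  smul_mem' := by
    rintro c ⟨a, a'⟩ ha k
    filter_upwards [ha k, Fock.wave_smul c a k, Fock.wave_smul c a' k] with p h1 h3 h4
    simp only [Prod.smul_mk] at *
    rw [h3, h4, h1]
    ring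

theorem mulGraph_single_valued {n : ℕ} (m : (k : ℕ) → (Fin k → Momentum n) → ℂ) :
    ∀ q ∈ mulGraph m, q.1 = 0 → q.2 = 0 := by
  rintro ⟨a, a'⟩ ha h0
  obtain rfl : a = 0 := h0
  refine Fock.ext_wave fun k => ?_
  filter_upwards [ha k, Fock.wave_zero (n := n) k] with p h1 h2
  refine h1.trans ?_
  rw [h2]
  simp

/-- `∫ dⁿp f(p) a*(p) a(p)` for a real function `f`: on `k`-particle functions it is
multiplication by `f(p₁) + ⋯ + f(p_k)`.  Its domain consists of all `Ψ` for which the resulting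
sequence lies in Fock space. -/
def secondQuantize {n : ℕ} (f : Momentum n → ℝ) : Fock n →ₗ.[ℂ] Fock n :=
  (mulGraph fun _ p => ((∑ i, f (p i) : ℝ) : ℂ)).toLinearPMap

theorem secondQuantize_graph {n : ℕ} (f : Momentum n → ℝ) (Ψ Φ : Fock n) :
    (Ψ, Φ) ∈ (secondQuantize f).graph ↔
      ∀ k, Φ.wave k =ᵐ[volume] fun p => ((∑ i, f (p i) : ℝ) : ℂ) * Ψ.wave k p := by
  rw [secondQuantize, Submodule.toLinearPMap_graph_eq _ (mulGraph_single_valued _)]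
  rfl

/-- The particle number operator `N`. -/
def numberOp (n : ℕ) : Fock n →ₗ.[ℂ] Fock n := secondQuantize fun _ => 1

/-- The momentum `p^μ = (ω_p, p)` of a massless particle, `ω_p = |p|`. -/
def fourMomentum {n : ℕ} (p : Momentum n) : Spacetime n :=
  WithLp.toLp 2 (Fin.cons ‖p‖ fun j => p j)

/-- The momentum operator `P^μ`. -/
def momentumOp (n : ℕ) (μ : Fin (n + 1)) : Fock n →ₗ.[ℂ] Fock n :=
  secondQuantize fun p => fourMomentum p μ

/-- The (self-adjoint) operator `(θP)^μ = θ^{μν} P_ν`. -/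
def deformedMomentumOp {n : ℕ} (θ : Matrix (Fin (n + 1)) (Fin (n + 1)) ℝ) (μ : Fin (n + 1)) :
    Fock n →ₗ.[ℂ] Fock n :=
  secondQuantize fun p => deform θ (fourMomentum p) μ

/-- The velocity operator `V^j`, the second quantisation of `p^j / ω_p`. -/
def velocityOp {n : ℕ} (j : Fin n) : Fock n →ₗ.[ℂ] Fock n :=
  secondQuantize fun p => p j / ‖p‖

/-! The unitary operators `U(y) = e^{i y^μ P_μ}`. -/

/-- `e^{i (g(p₁) + ⋯ + g(p_k))}`. -/
def phase {n : ℕ} (g : Momentum n → ℝ) (k : ℕ) (p : Fin k → Momentum n) : ℂ :=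
  Complex.exp (Complex.I * ((∑ i, g (p i) : ℝ) : ℂ))

theorem norm_phase {n : ℕ} (g : Momentum n → ℝ) (k : ℕ) (p : Fin k → Momentum n) :
    ‖phase g k p‖ = 1 := by
  rw [phase, mul_comm, Complex.norm_exp_ofReal_mul_I]

theorem measurable_phase {n : ℕ} {g : Momentum n → ℝ} (hg : Measurable g) (k : ℕ) :
    Measurable (phase g k) := by
  unfold phase
  fun_prop

theorem phase_perm {n : ℕ} (g : Momentum n → ℝ) (k : ℕ) (p : Fin k → Momentum n)
    (σ : Equiv.Perm (Fin k)) : phase g k (p ∘ σ) = phase g k p := by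
  unfold phase
  congr 3
  exact Equiv.sum_comp σ fun i => g (p i)

theorem memLp_phase {n : ℕ} {g : Momentum n → ℝ} (hg : Measurable g) {k : ℕ}
    (ψ : NParticleL2 n k) : MemLp (fun p => phase g k p * ψ p) 2 volume :=
  (Lp.memLp ψ).of_le ((measurable_phase hg k).aestronglyMeasurable.mul
    (Lp.aestronglyMeasurable ψ)) (Eventually.of_forall fun p => by simp [norm_phase])

/-- Multiplication by `e^{i (g(p₁) + ⋯ + g(p_k))}` on `ℋ_k⁺`. -/
def phaseSector {n : ℕ} {g : Momentum n → ℝ} (hg : Measurable g) {k : ℕ}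
    (ψ : symmetricL2 n k) : symmetricL2 n k :=
  ⟨(memLp_phase hg (ψ : NParticleL2 n k)).toLp _, by
    intro σ
    have h := (memLp_phase hg (ψ : NParticleL2 n k)).coeFn_toLp
    refine (ae_comp_perm σ h).trans (EventuallyEq.trans ?_ h.symm)
    filter_upwards [ψ.2 σ] with p hp
    rw [phase_perm, hp]⟩

theorem coeFn_phaseSector {n : ℕ} {g : Momentum n → ℝ} (hg : Measurable g) {k : ℕ}
    (ψ : symmetricL2 n k) :
    ((phaseSector hg ψ : symmetricL2 n k) : NParticleL2 n k) =ᵐ[volume]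
      fun p => phase g k p * (ψ : NParticleL2 n k) p :=
  (memLp_phase hg (ψ : NParticleL2 n k)).coeFn_toLp

theorem norm_phaseSector {n : ℕ} {g : Momentum n → ℝ} (hg : Measurable g) {k : ℕ}
    (ψ : symmetricL2 n k) : ‖phaseSector hg ψ‖ = ‖ψ‖ := by
  change ‖((phaseSector hg ψ : symmetricL2 n k) : NParticleL2 n k)‖ = ‖(ψ : NParticleL2 n k)‖
  rw [Lp.norm_def, Lp.norm_def]
  congr 1
  apply eLpNorm_congr_norm_ae
  filter_upwards [coeFn_phaseSector hg ψ] with p hp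
  rw [hp, norm_mul, norm_phase, one_mul]

/-- Multiplication by `e^{i (g(p₁) + ⋯ + g(p_k))}` on Fock space. -/
def phaseMap {n : ℕ} {g : Momentum n → ℝ} (hg : Measurable g) (Ψ : Fock n) : Fock n :=
  ⟨fun k => phaseSector hg (Ψ k), by
    have h := (lp.memℓp Ψ).summable (by norm_num)
    refine memℓp_gen ?_
    simpa only [norm_phaseSector] using h⟩

theorem wave_phaseMap {n : ℕ} {g : Momentum n → ℝ} (hg : Measurable g) (Ψ : Fock n) (k : ℕ) :
    (phaseMap hg Ψ).wave k =ᵐ[volume] fun p => phase g k p * Ψ.wave k p :=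
  coeFn_phaseSector hg (Ψ k)

theorem phaseMap_phaseMap_neg {n : ℕ} {g h : Momentum n → ℝ} (hg : Measurable g)
    (hh : Measurable h) (hgh : ∀ p, g p + h p = 0) (Ψ : Fock n) :
    phaseMap hg (phaseMap hh Ψ) = Ψ := by
  refine Fock.ext_wave fun k => ?_
  filter_upwards [wave_phaseMap hg (phaseMap hh Ψ) k, wave_phaseMap hh Ψ k] with p h1 h2
  rw [h1, h2, ← mul_assoc, phase, phase, ← Complex.exp_add, ← mul_add, ← Complex.ofReal_add,
    ← Finset.sum_add_distrib]
  simp [hgh]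

/-- The unitary second quantisation of multiplication by `e^{i g(p)}`. -/
def phaseUnitary {n : ℕ} {g : Momentum n → ℝ} (hg : Measurable g) : Fock n ≃ₗᵢ[ℂ] Fock n where
  toFun := phaseMap hg
  invFun := phaseMap hg.neg
  map_add' := by
    intro a b
    refine Fock.ext_wave fun k => ?_
    filter_upwards [wave_phaseMap hg (a + b) k, wave_phaseMap hg a k, wave_phaseMap hg b k,
      Fock.wave_add a b k, Fock.wave_add (phaseMap hg a) (phaseMap hg b) k] with p h1 h2 h3 h4 h5
    rw [h1, h4, h5, h2, h3, mul_add]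
  map_smul' := by
    intro c a
    refine Fock.ext_wave fun k => ?_
    filter_upwards [wave_phaseMap hg (c • a) k, wave_phaseMap hg a k,
      Fock.wave_smul c a k, Fock.wave_smul c (phaseMap hg a) k] with p h1 h2 h4 h5
    rw [RingHom.id_apply, h1, h4, h5, h2]
    ring
  left_inv := phaseMap_phaseMap_neg hg.neg hg fun p => by simp
  right_inv := phaseMap_phaseMap_neg hg hg.neg fun p => by simp
  norm_map' := by
    intro Ψ
    change ‖phaseMap hg Ψ‖ = ‖Ψ‖
    rw [lp.norm_eq_tsum_rpow (by norm_num), lp.norm_eq_tsum_rpow (by norm_num)]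
    congr 1
    exact tsum_congr fun k => congrArg (· ^ _) (norm_phaseSector hg (Ψ k))

theorem measurable_translation {n : ℕ} (y : Spacetime n) :
    Measurable fun p : Momentum n => minkowski y (fourMomentum p) := by
  unfold minkowski
  refine Finset.measurable_sum _ fun μ _ => Measurable.const_mul ?_ _
  refine Fin.cases ?_ (fun j => ?_) μ
  · change Measurable fun p : Momentum n => ‖p‖
    fun_prop
  · change Measurable fun p : Momentum n => p j
    fun_prop

/-- The translations `U(y) = e^{i y^μ P_μ}` on Fock space. -/
def translationOp {n : ℕ} (y : Spacetime n) : Fock n ≃ₗᵢ[ℂ] Fock n :=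
  phaseUnitary (measurable_translation y)

/-! ### The coordinate operator -/

/-- The algebraic tensor product `𝓢(ℝⁿ)^{⊗k}`, as a space of functions of `k` momenta: the linear
span of the products `φ₁(p₁) ⋯ φ_k(p_k)`. -/
def schwartzTensor (n k : ℕ) : Submodule ℂ ((Fin k → Momentum n) → ℂ) :=
  Submodule.span ℂ
    {f | ∃ φ : Fin k → 𝓢(Momentum n, ℂ), f = fun p => ∏ i, φ i (p i)}

/-- The domain `𝓢(ℝⁿ)_⊗`: vectors with finitely many nonzero components, all of which are
(represented by) elements of `𝓢(ℝⁿ)^{⊗k}`. -/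
def schwartzFock (n : ℕ) : Submodule ℂ (Fock n) where
  carrier := {Ψ | (∃ K, ∀ k, K ≤ k → Ψ k = 0) ∧
    ∀ k, ∃ f ∈ schwartzTensor n k, Ψ.wave k =ᵐ[volume] f}
  zero_mem' := ⟨⟨0, fun _ _ => rfl⟩, fun k => ⟨0, Submodule.zero_mem _, Fock.wave_zero k⟩⟩
  add_mem' := by
    rintro a b ⟨⟨K, hK⟩, ha⟩ ⟨⟨L, hL⟩, hb⟩
    refine ⟨⟨max K L, fun k hk => ?_⟩, fun k => ?_⟩
    · rw [lp.coeFn_add, Pi.add_apply, hK k (le_trans (le_max_left _ _) hk),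
        hL k (le_trans (le_max_right _ _) hk), add_zero]
    · obtain ⟨f, hf, hf'⟩ := ha k
      obtain ⟨g, hg, hg'⟩ := hb k
      refine ⟨f + g, Submodule.add_mem _ hf hg, (Fock.wave_add a b k).trans ?_⟩
      filter_upwards [hf', hg'] with p h1 h2
      simp [h1, h2]
  smul_mem' := by
    rintro c a ⟨⟨K, hK⟩, ha⟩
    refine ⟨⟨K, fun k hk => ?_⟩, fun k => ?_⟩
    · rw [lp.coeFn_smul, Pi.smul_apply, hK k hk, smul_zero]
    · obtain ⟨f, hf, hf'⟩ := ha k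
      refine ⟨c • f, Submodule.smul_mem _ c hf, (Fock.wave_smul c a k).trans ?_⟩
      filter_upwards [hf'] with p h1
      simp [h1]

/-- `-i (∂/∂p₁^j + ⋯ + ∂/∂p_k^j) f`. -/
def sectorDeriv {n k : ℕ} (j : Fin n) (f : (Fin k → Momentum n) → ℂ)
    (p : Fin k → Momentum n) : ℂ :=
  -Complex.I * ∑ i, fderiv ℝ f p (Pi.single i (EuclideanSpace.single j 1))

theorem sectorDeriv_eq {n k : ℕ} (j : Fin n) (f : (Fin k → Momentum n) → ℂ)
    (p : Fin k → Momentum n) :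
    sectorDeriv j f p = -Complex.I * fderiv ℝ f p fun _ => EuclideanSpace.single j 1 := by
  rw [sectorDeriv, ← map_sum]
  congr 2
  funext i
  simp [Finset.sum_apply, Pi.single_apply]

theorem sectorDeriv_add {n k : ℕ} (j : Fin n) {f g : (Fin k → Momentum n) → ℂ}
    (hf : Differentiable ℝ f) (hg : Differentiable ℝ g) :
    sectorDeriv j (f + g) = sectorDeriv j f + sectorDeriv j g := by
  funext p
  simp only [sectorDeriv_eq, Pi.add_apply]
  rw [fderiv_add (hf p) (hg p)]
  simp [mul_add]

theorem sectorDeriv_smul {n k : ℕ} (j : Fin n) {f : (Fin k → Momentum n) → ℂ}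
    (hf : Differentiable ℝ f) (c : ℂ) :
    sectorDeriv j (c • f) = c • sectorDeriv j f := by
  funext p
  simp only [sectorDeriv_eq, Pi.smul_apply]
  rw [fderiv_const_smul (hf p)]
  simp
  ring

theorem sectorDeriv_zero {n k : ℕ} (j : Fin n) :
    sectorDeriv j (0 : (Fin k → Momentum n) → ℂ) = 0 := by
  funext p
  simp [sectorDeriv]

theorem sectorDeriv_perm {n k : ℕ} (j : Fin n) {f : (Fin k → Momentum n) → ℂ}
    (hf : Differentiable ℝ f) (σ : Equiv.Perm (Fin k)) (h : ∀ p, f (p ∘ σ) = f p)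
    (p : Fin k → Momentum n) : sectorDeriv j f (p ∘ σ) = sectorDeriv j f p := by
  let L : (Fin k → Momentum n) →L[ℝ] (Fin k → Momentum n) :=
    ContinuousLinearMap.pi fun i => ContinuousLinearMap.proj (σ i)
  have e : f ∘ L = f := funext h
  have h1 : HasFDerivAt (f ∘ L) ((fderiv ℝ f (L p)).comp L) p :=
    (hf (L p)).hasFDerivAt.comp p L.hasFDerivAt
  rw [e] at h1
  rw [sectorDeriv_eq, sectorDeriv_eq, h1.fderiv]
  rfl

theorem hasFDerivAt_tensor {n k : ℕ} (φ : Fin k → 𝓢(Momentum n, ℂ)) (p : Fin k → Momentum n) :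
    HasFDerivAt (fun p : Fin k → Momentum n => ∏ i, φ i (p i))
      (∑ i, (∏ l ∈ Finset.univ.erase i, φ l (p l)) •
        (fderiv ℝ (φ i) (p i)).comp (ContinuousLinearMap.proj i)) p :=
  HasFDerivAt.finsetProd fun i _ => (φ i).differentiableAt.hasFDerivAt.comp p
    (ContinuousLinearMap.proj (R := ℝ) (φ := fun _ : Fin k => Momentum n) i).hasFDerivAt

theorem differentiable_schwartzTensor {n k : ℕ} {f : (Fin k → Momentum n) → ℂ}
    (hf : f ∈ schwartzTensor n k) : Differentiable ℝ f := by
  induction hf using Submodule.span_induction with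
  | mem f hf =>
    obtain ⟨φ, rfl⟩ := hf
    exact fun p => (hasFDerivAt_tensor φ p).differentiableAt
  | zero => exact differentiable_const 0
  | add f g _ _ hf hg => exact hf.add hg
  | smul c f _ hf => exact hf.const_smul c

theorem memLp_schwartzTensor {n k : ℕ} {f : (Fin k → Momentum n) → ℂ}
    (hf : f ∈ schwartzTensor n k) : MemLp f 2 volume := by
  induction hf using Submodule.span_induction with
  | mem f hf =>
    obtain ⟨φ, rfl⟩ := hf
    have hc : Continuous fun p : Fin k → Momentum n => ∏ i, φ i (p i) :=
      continuous_finsetProd _ fun i _ => (φ i).continuous.comp (continuous_apply i)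
    rw [memLp_two_iff_integrable_sq_norm hc.aestronglyMeasurable]
    have h : Integrable (fun p : Fin k → Momentum n => ∏ i, ‖φ i (p i)‖ ^ 2) volume :=
      Integrable.fintype_prod (f := fun i (q : Momentum n) => ‖φ i q‖ ^ 2) fun i =>
        (memLp_two_iff_integrable_sq_norm (φ i).continuous.aestronglyMeasurable).1
          ((φ i).memLp 2 volume)
    refine h.congr (Eventually.of_forall fun p => ?_)
    simp [norm_prod, Finset.prod_pow]
  | zero => exact MemLp.zero
  | add f g _ _ hf hg => exact hf.add hg
  | smul c f _ hf => exact hf.const_smul c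

theorem sectorDeriv_mem {n k : ℕ} (j : Fin n) {f : (Fin k → Momentum n) → ℂ}
    (hf : f ∈ schwartzTensor n k) : sectorDeriv j f ∈ schwartzTensor n k := by
  classical
  induction hf using Submodule.span_induction with
  | mem f hf =>
    obtain ⟨φ, rfl⟩ := hf
    have e : sectorDeriv j (fun p : Fin k → Momentum n => ∏ i, φ i (p i)) =
        -Complex.I • ∑ i, fun p : Fin k → Momentum n => ∏ l, Function.update φ i
          (LineDeriv.lineDerivOp (EuclideanSpace.single j (1 : ℝ)) (φ i)) l (p l) := by
      funext p
      rw [sectorDeriv_eq, (hasFDerivAt_tensor φ p).fderiv]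
      simp only [Pi.smul_apply, Finset.sum_apply, smul_eq_mul]
      congr 1
      rw [_root_.sum_apply]
      refine Finset.sum_congr rfl fun i _ => ?_
      rw [← Finset.mul_prod_erase Finset.univ _ (Finset.mem_univ i), Function.update_self,
        SchwartzMap.lineDerivOp_apply_eq_fderiv, mul_comm]
      simp only [_root_.smul_apply, smul_eq_mul]
      congr 1
      refine Finset.prod_congr rfl fun l hl => ?_
      rw [Function.update_of_ne (Finset.ne_of_mem_erase hl)]
    rw [e]
    exact Submodule.smul_mem _ _ (Submodule.sum_mem _ fun i _ => Submodule.subset_span ⟨_, rfl⟩)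
  | zero => rw [sectorDeriv_zero]; exact Submodule.zero_mem _
  | add f g hf' hg' hf hg =>
    rw [sectorDeriv_add j (differentiable_schwartzTensor hf') (differentiable_schwartzTensor hg')]
    exact Submodule.add_mem _ hf hg
  | smul c f hf' hf =>
    rw [sectorDeriv_smul j (differentiable_schwartzTensor hf')]
    exact Submodule.smul_mem _ _ hf

theorem schwartzTensor_eq_of_ae {n k : ℕ} {f g : (Fin k → Momentum n) → ℂ}
    (hf : f ∈ schwartzTensor n k) (hg : g ∈ schwartzTensor n k) (h : f =ᵐ[volume] g) : f = g :=
  (Continuous.ae_eq_iff_eq volume (differentiable_schwartzTensor hf).continuous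
    (differentiable_schwartzTensor hg).continuous).1 h

/-- The graph of the coordinate operator: if `Ψ ∈ 𝓢(ℝⁿ)_⊗` has `k`-particle components `f k`,
its image has the `k`-particle components `-i ∑ᵢ ∂f k/∂pᵢ^j`. -/
def coordinateGraph {n : ℕ} (j : Fin n) : Submodule ℂ (Fock n × Fock n) where
  carrier := {q | q.1 ∈ schwartzFock n ∧ ∀ k, ∃ f ∈ schwartzTensor n k,
    q.1.wave k =ᵐ[volume] f ∧ q.2.wave k =ᵐ[volume] sectorDeriv j f}
  zero_mem' := ⟨Submodule.zero_mem _, fun k => ⟨0, Submodule.zero_mem _, Fock.wave_zero k, by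
    rw [sectorDeriv_zero]; exact Fock.wave_zero k⟩⟩
  add_mem' := by
    rintro ⟨a, a'⟩ ⟨b, b'⟩ ⟨ha, ha'⟩ ⟨hb, hb'⟩
    refine ⟨Submodule.add_mem _ ha hb, fun k => ?_⟩
    obtain ⟨f, hf, hf1, hf2⟩ := ha' k
    obtain ⟨g, hg, hg1, hg2⟩ := hb' k
    refine ⟨f + g, Submodule.add_mem _ hf hg, (Fock.wave_add a b k).trans ?_,
      (Fock.wave_add a' b' k).trans ?_⟩
    · filter_upwards [hf1, hg1] with p h1 h2
      exact congrArg₂ (· + ·) h1 h2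
    · rw [sectorDeriv_add j (differentiable_schwartzTensor hf) (differentiable_schwartzTensor hg)]
      filter_upwards [hf2, hg2] with p h1 h2
      exact congrArg₂ (· + ·) h1 h2
  smul_mem' := by
    rintro c ⟨a, a'⟩ ⟨ha, ha'⟩
    refine ⟨Submodule.smul_mem _ c ha, fun k => ?_⟩
    obtain ⟨f, hf, hf1, hf2⟩ := ha' k
    refine ⟨c • f, Submodule.smul_mem _ c hf, (Fock.wave_smul c a k).trans ?_,
      (Fock.wave_smul c a' k).trans ?_⟩
    · filter_upwards [hf1] with p h1
      exact congrArg (c * ·) h1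
    · rw [sectorDeriv_smul j (differentiable_schwartzTensor hf)]
      filter_upwards [hf2] with p h1
      exact congrArg (c * ·) h1

theorem coordinateGraph_single_valued {n : ℕ} (j : Fin n) :
    ∀ q ∈ coordinateGraph j, q.1 = 0 → q.2 = 0 := by
  rintro ⟨a, a'⟩ ⟨-, ha⟩ h0
  obtain rfl : a = 0 := h0
  refine Fock.ext_wave fun k => ?_
  obtain ⟨f, hf, hf1, hf2⟩ := ha k
  have : f = 0 := schwartzTensor_eq_of_ae hf (Submodule.zero_mem _)
    (hf1.symm.trans (Fock.wave_zero k))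
  subst this
  rw [sectorDeriv_zero] at hf2
  exact hf2.trans (Fock.wave_zero k).symm

theorem exists_coordinateGraph {n : ℕ} (j : Fin n) {Ψ : Fock n} (hΨ : Ψ ∈ schwartzFock n) :
    ∃ Φ, (Ψ, Φ) ∈ coordinateGraph j := by
  obtain ⟨⟨K, hK⟩, h⟩ := id hΨ
  choose f hf hf' using h
  have hmem : ∀ k, MemLp (sectorDeriv j (f k)) 2 volume := fun k =>
    memLp_schwartzTensor (sectorDeriv_mem j (hf k))
  have hsymm : ∀ k, (hmem k).toLp _ ∈ symmetricL2 n k := by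
    intro k σ
    have hperm : ∀ p, f k (p ∘ σ) = f k p := by
      have h1 : (fun p => f k (p ∘ σ)) =ᵐ[volume] f k :=
        (ae_comp_perm σ (hf' k)).symm.trans (((Ψ k).2 σ).trans (hf' k))
      have hc := (differentiable_schwartzTensor (hf k)).continuous
      exact congrFun ((Continuous.ae_eq_iff_eq volume
        (hc.comp (continuous_pi fun i => continuous_apply (σ i))) hc).1 h1)
    refine (ae_comp_perm σ (hmem k).coeFn_toLp).trans (EventuallyEq.trans ?_
      (hmem k).coeFn_toLp.symm)
    exact Eventually.of_forall fun p =>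
      sectorDeriv_perm j (differentiable_schwartzTensor (hf k)) σ hperm p
  let φ : (k : ℕ) → symmetricL2 n k := fun k => ⟨(hmem k).toLp _, hsymm k⟩
  have hφ0 : ∀ k, K ≤ k → φ k = 0 := by
    intro k hk
    have h0 : f k = 0 := by
      refine schwartzTensor_eq_of_ae (hf k) (Submodule.zero_mem _) ((hf' k).symm.trans ?_)
      have : Ψ.wave k = (((0 : symmetricL2 n k) : NParticleL2 n k) : _ → ℂ) := by
        rw [← hK k hk]
        rfl
      rw [this]
      exact Lp.coeFn_zero ℂ 2 volume
    refine Subtype.ext (Lp.ext ((hmem k).coeFn_toLp.trans ?_))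
    rw [h0, sectorDeriv_zero]
    exact (Lp.coeFn_zero ℂ 2 volume).symm
  have hφ : Memℓp φ 2 := by
    refine memℓp_gen (summable_of_ne_finset_zero (s := Finset.range K) fun k hk => ?_)
    rw [hφ0 k (by simpa using hk)]
    simp
  exact ⟨⟨φ, hφ⟩, hΨ, fun k => ⟨f k, hf k, hf' k, (hmem k).coeFn_toLp⟩⟩

/-- The coordinate operator `X_j = -i ∫ dⁿp a*(p) ∂/∂p^j a(p)` on `𝓢(ℝⁿ)_⊗`. -/
def coordinateLowerOp {n : ℕ} (j : Fin n) : Fock n →ₗ.[ℂ] Fock n :=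
  (coordinateGraph j).toLinearPMap

theorem coordinateLowerOp_graph {n : ℕ} (j : Fin n) (Ψ Φ : Fock n) :
    (Ψ, Φ) ∈ (coordinateLowerOp j).graph ↔ Ψ ∈ schwartzFock n ∧
      ∀ k, ∃ f ∈ schwartzTensor n k,
        Ψ.wave k =ᵐ[volume] f ∧ Φ.wave k =ᵐ[volume] sectorDeriv j f := by
  rw [coordinateLowerOp, Submodule.toLinearPMap_graph_eq _ (coordinateGraph_single_valued j)]
  rfl

theorem coordinateLowerOp_domain {n : ℕ} (j : Fin n) :
    (coordinateLowerOp j).domain = schwartzFock n := by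
  ext Ψ
  rw [LinearPMap.mem_domain_iff]
  constructor
  · rintro ⟨Φ, h⟩
    exact ((coordinateLowerOp_graph j Ψ Φ).1 h).1
  · intro h
    obtain ⟨Φ, hΦ⟩ := exists_coordinateGraph j h
    exact ⟨Φ, (coordinateLowerOp_graph j Ψ Φ).2 hΦ⟩

/-- The coordinate operator with raised index, `X^j = -X_j` (metric signature `(+,-,…,-)`). -/
def coordinateOp {n : ℕ} (j : Fin n) : Fock n →ₗ.[ℂ] Fock n := -coordinateLowerOp j

/-- The deformed coordinate operator `X^j_θ`: the warped convolution, with respect to the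
translations, of the closure of `X^j`, taken on the vectors of `𝓢(ℝⁿ)_⊗`. -/
def deformedCoordinateOp {n : ℕ} (θ : Matrix (Fin (n + 1)) (Fin (n + 1)) ℝ) (j : Fin n) :
    Fock n →ₗ.[ℂ] Fock n :=
  (warpedConvolution translationOp θ (coordinateOp j).closure).domRestrict (schwartzFock n)

end

noncomputable section

/-! ### A criterion for essential self-adjointness -/

section Criterion

variable {H : Type*} [NormedAddCommGroup H] [InnerProductSpace ℂ H] [CompleteSpace H]

/-! On `k`-particle functions `X^j` is `i D`, where `D` differentiates along the common shift of all
momenta in direction `j`. Conjugation with `U(z)` brings in the phase `e^{-i z·P}`; its derivative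
turns `i D` into `i D + z⁰ V^j - z^j N`. With `z = θx` the warped integrand is therefore `U(y)`
applied to `X^jΦ + (θx)⁰ V^jΦ - (θx)^j NΦ`, with amplitudes of at most linear growth in `x`. By
Fourier inversion the regularised integral of `e^{-ixy} ℓ(x) U(y)` tends to multiplication by `ℓ(P)`
(`tendsto_oscillatorySymbol`, `tendsto_integral_cutoff_smul_translationOp`). Taking `ℓ` to be `1`,
`(θx)⁰` and `(θx)^j` gives the formula for `X^j_θ`.

One difficulty is that `|p|` is not smooth at `0`, so `U(z)⁻¹` need not preserve `𝓢(ℝⁿ)_⊗`.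
Membership in the domain of the closure is obtained instead from the identity of closure and adjoint
of `X^j`: in `exists_conjugateOp_coordinateOp` the adjoint relation is just an integration by parts
that tolerates exceptional points on lines.

Essential self-adjointness is proved for all operators `i D + W` on `𝓢(ℝⁿ)_⊗` with `W` real,
symmetric, bounded by a multiple of `∏ (1 + |pᵢ|)` in each sector, and continuous off a countable
set on each line in the shift direction. This covers both `X^j` (`W = 0`) and `X^j_θ`, whose
potential has discontinuities coming from the velocity where some `pᵢ` vanishes. Symmetry is
integration by parts. If `v` is orthogonal to the range of `i D + W + ci`, `c = ±1`, the conjugate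
of each component solves `Dψ = (c - iW)ψ` weakly. Along almost every line `ψ` has a representative
solving this ordinary differential equation, hence `|ψ(p + e)| = eᶜ |ψ(p)|`. The `L²` norm is
translation invariant, so `ψ = 0` (`ae_eq_zero_of_weak`). No smoothness of `W` and no explicit flow
is needed. -/

theorem mem_graph_adjoint_iff {A : H →ₗ.[ℂ] H} (hA : Dense (A.domain : Set H)) (v w : H) :
    (v, w) ∈ A.adjoint.graph ↔ ∀ x : A.domain, ⟪v, A x⟫_ℂ = ⟪w, (x : H)⟫_ℂ := by
  rw [LinearPMap.adjoint_graph_eq_graph_adjoint hA, Submodule.mem_adjoint_iff]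
  constructor
  · intro h x
    have h1 := sub_eq_zero.1 (h x (A x) (A.mem_graph x))
    rw [← inner_conj_symm, h1, inner_conj_symm]
  · intro h a b hab
    obtain ⟨x, rfl, rfl⟩ := (LinearPMap.mem_graph_iff A).1 hab
    rw [sub_eq_zero, ← inner_conj_symm, h x, inner_conj_symm]

/-- Project an element of the adjoint graph onto the closed graph. The remainder `(u, w)` is
orthogonal to the graph and still lies in the adjoint graph. These two relations make `u + i w`
orthogonal to the range of `A - i` and `u - i w` orthogonal to the range of `A + i`, so `u = w = 0`.
-/
theorem graph_adjoint_le_topologicalClosure {A : H →ₗ.[ℂ] H} (hA : Dense (A.domain : Set H))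
    (hp : ∀ v : H, (∀ x : A.domain, ⟪v, A x + Complex.I • (x : H)⟫_ℂ = 0) → v = 0)
    (hm : ∀ v : H, (∀ x : A.domain, ⟪v, A x - Complex.I • (x : H)⟫_ℂ = 0) → v = 0)
    (hle : A.graph.topologicalClosure ≤ A.adjoint.graph) :
    A.adjoint.graph ≤ A.graph.topologicalClosure := by
  -- The product `H × H` carries the sup norm. Orthogonal projection needs the Hilbert norm, which
  -- induces the same topology.
  set e := WithLp.linearEquiv 2 ℂ (H × H)
  set G : Submodule ℂ (WithLp 2 (H × H)) := A.graph.topologicalClosure.comap e.toLinearMap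
  have hG : IsClosed (G : Set (WithLp 2 (H × H))) :=
    A.graph.isClosed_topologicalClosure.preimage (WithLp.prod_continuous_ofLp 2 H H)
  have : CompleteSpace G := hG.completeSpace_coe
  rintro q hq
  obtain ⟨g, hg, h, hh, hgh⟩ := G.exists_add_mem_mem_orthogonal (e.symm q)
  have hq' : q = e g + e h := by rw [← map_add, ← hgh, LinearEquiv.apply_symm_apply]
  have hgG : e g ∈ A.graph.topologicalClosure := hg
  have hhK : (h.fst, h.snd) ∈ A.adjoint.graph := by
    have : e h = q - e g := by rw [hq']; abel
    change e h ∈ A.adjoint.graph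
    rw [this]
    exact Submodule.sub_mem _ hq (hle hgG)
  rw [mem_graph_adjoint_iff hA] at hhK
  have hort : ∀ x : A.domain, ⟪h.fst, (x : H)⟫_ℂ + ⟪h.snd, A x⟫_ℂ = 0 := by
    intro x
    have hx : e.symm ((x : H), A x) ∈ G := by
      change e (e.symm _) ∈ A.graph.topologicalClosure
      rw [LinearEquiv.apply_symm_apply]
      exact A.graph.le_topologicalClosure (A.mem_graph x)
    have := (Submodule.mem_orthogonal' _ _).1 hh _ hx
    rw [WithLp.prod_inner_apply] at this
    exact this
  have e1 : h.fst + Complex.I • h.snd = 0 := by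
    refine hm _ fun x => ?_
    have h1 := hhK x
    have h2 := hort x
    simp only [inner_sub_right, inner_add_left, inner_smul_left, inner_smul_right, Complex.conj_I]
    linear_combination h1 - Complex.I * h2 + ⟪h.snd, (x : H)⟫_ℂ * Complex.I_sq
  have e2 : h.fst - Complex.I • h.snd = 0 := by
    refine hp _ fun x => ?_
    have h1 := hhK x
    have h2 := hort x
    simp only [inner_add_right, inner_sub_left, inner_smul_left, inner_smul_right, Complex.conj_I]
    linear_combination h1 + Complex.I * h2 + ⟪h.snd, (x : H)⟫_ℂ * Complex.I_sq
  have h1 : h.fst = 0 := by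
    have : (2 : ℂ) • h.fst = 0 := by
      rw [two_smul]
      calc h.fst + h.fst = (h.fst + Complex.I • h.snd) + (h.fst - Complex.I • h.snd) := by abel
        _ = 0 := by rw [e1, e2, add_zero]
    simpa using this
  have h2 : h.snd = 0 := by
    rw [h1, zero_add] at e1
    simpa using e1
  have h3 : e h = 0 := Prod.ext h1 h2
  rw [hq', h3, add_zero]
  exact hgG

/-- A densely defined symmetric operator all of whose deficiency spaces vanish is essentially
self-adjoint, and its closure is its adjoint. -/
theorem isEssentiallySelfAdjoint_of_symmetric {A : H →ₗ.[ℂ] H}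
    (hA : Dense (A.domain : Set H))
    (hs : ∀ x y : A.domain, ⟪A x, (y : H)⟫_ℂ = ⟪(x : H), A y⟫_ℂ)
    (hp : ∀ v : H, (∀ x : A.domain, ⟪v, A x + Complex.I • (x : H)⟫_ℂ = 0) → v = 0)
    (hm : ∀ v : H, (∀ x : A.domain, ⟪v, A x - Complex.I • (x : H)⟫_ℂ = 0) → v = 0) :
    IsEssentiallySelfAdjoint A ∧ A.closure = A.adjoint := by
  have hle : A.graph ≤ A.adjoint.graph := by
    rintro ⟨a, b⟩ hab
    obtain ⟨x, rfl, rfl⟩ := (LinearPMap.mem_graph_iff A).1 hab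
    exact (mem_graph_adjoint_iff hA _ _).2 fun y => (hs x y).symm
  have hle' : A.graph.topologicalClosure ≤ A.adjoint.graph :=
    Submodule.topologicalClosure_minimal _ hle (LinearPMap.adjoint_isClosed hA)
  have heq : A.graph.topologicalClosure = A.adjoint.graph :=
    le_antisymm hle' (graph_adjoint_le_topologicalClosure hA hp hm hle')
  have hcl : A.IsClosable := ⟨_, heq⟩
  have hc : A.closure = A.adjoint :=
    LinearPMap.eq_of_eq_graph (hcl.graph_closure_eq_closure_graph.symm.trans heq)
  refine ⟨⟨hA, hcl, ?_⟩, hc⟩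
  have hcd : Dense (A.closure.domain : Set H) := hA.mono (LinearPMap.le_closure A).1
  rw [LinearPMap.isSelfAdjoint_def]
  -- Passing to the closure leaves the adjoint unchanged: one inclusion restricts the test vectors
  -- to the original domain, the other extends the adjoint relation to limits by continuity of the
  -- inner product.
  refine LinearPMap.eq_of_eq_graph (le_antisymm ?_ ?_)
  · rintro ⟨v, w⟩ h
    rw [mem_graph_adjoint_iff hcd] at h
    rw [hc, mem_graph_adjoint_iff hA]
    intro x
    have := h ⟨x, (LinearPMap.le_closure A).1 x.2⟩
    rwa [← (LinearPMap.le_closure A).2 (x := x) rfl] at this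
  · rintro ⟨v, w⟩ h
    rw [hc, LinearPMap.adjoint_graph_eq_graph_adjoint hA, Submodule.mem_adjoint_iff] at h
    rw [LinearPMap.adjoint_graph_eq_graph_adjoint hcd, Submodule.mem_adjoint_iff]
    intro a b hab
    rw [← hcl.graph_closure_eq_closure_graph] at hab
    have hclosed : IsClosed {q : H × H | ⟪q.2, v⟫_ℂ - ⟪q.1, w⟫_ℂ = 0} :=
      isClosed_eq (by fun_prop) continuous_const
    exact closure_minimal (s := (A.graph : Set (H × H))) (fun q hq => h q.1 q.2 hq) hclosed hab

end Criterion

/-! ### Functions along a family of parallel lines -/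

section Lines

variable {E : Type*} [NormedAddCommGroup E] [NormedSpace ℝ E] [MeasurableSpace E] [BorelSpace E]
  [SecondCountableTopology E] {μ : Measure E} [SFinite μ] [μ.IsAddRightInvariant]

/-- For a fixed parameter the map is a translation, so null sets pull back to null sets. Functions
known only almost everywhere may therefore be restricted to almost every line in direction `e`. -/
theorem quasiMeasurePreserving_add_smul (e : E) (ν : Measure ℝ) [SFinite ν] :
    Measure.QuasiMeasurePreserving (fun q : E × ℝ => q.1 + q.2 • e) (μ.prod ν) μ := by
  have hm : Measurable fun q : E × ℝ => q.1 + q.2 • e := by fun_prop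
  refine ⟨hm, Measure.AbsolutelyContinuous.mk fun s hs h0 => ?_⟩
  rw [Measure.map_apply hm hs, Measure.prod_apply_symm (hm hs)]
  refine (lintegral_congr fun y => ?_).trans lintegral_zero
  have : (fun x => (x, y)) ⁻¹' ((fun q : E × ℝ => q.1 + q.2 • e) ⁻¹' s) =
      (fun x => x + y • e) ⁻¹' s := rfl
  rw [this, measure_preimage_add_right, h0]

/-- The integral of the norm over `p` does not depend on the parameter, which is why `ν` has to be
finite. In the applications it is Lebesgue measure on a bounded interval. -/
theorem integrable_comp_add_smul {F : Type*} [NormedAddCommGroup F] {h : E → F}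
    (hh : Integrable h μ) (e : E) (ν : Measure ℝ) [IsFiniteMeasure ν] :
    Integrable (fun q : E × ℝ => h (q.1 + q.2 • e)) (μ.prod ν) := by
  have hm : AEStronglyMeasurable (fun q : E × ℝ => h (q.1 + q.2 • e)) (μ.prod ν) :=
    hh.1.comp_quasiMeasurePreserving (quasiMeasurePreserving_add_smul (μ := μ) e ν)
  rw [integrable_prod_iff' hm]
  refine ⟨Eventually.of_forall fun y => hh.comp_add_right (y • e), ?_⟩
  have : ∀ y : ℝ, ∫ x, ‖h (x + y • e)‖ ∂μ = ∫ x, ‖h x‖ ∂μ := fun y =>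
    integral_add_right_eq_self (fun x => ‖h x‖) (y • e)
  simp only [this]
  exact integrable_const _

theorem integrable_mul_comp_add_smul {ψ F : E → ℂ} (hψ : MemLp ψ 2 μ) (hF : MemLp F 2 μ) (e : E)
    (ν : Measure ℝ) [IsFiniteMeasure ν] :
    Integrable (fun q : E × ℝ => ψ q.1 * F (q.1 + q.2 • e)) (μ.prod ν) := by
  have h1 : Integrable (fun q : E × ℝ => ‖ψ q.1‖ ^ 2) (μ.prod ν) :=
    ((memLp_two_iff_integrable_sq_norm hψ.1).1 hψ).comp_fst ν
  have h2 := integrable_comp_add_smul (μ := μ)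
    ((memLp_two_iff_integrable_sq_norm hF.1).1 hF) e ν
  refine (h1.add h2).mono' (hψ.1.comp_fst.mul
    (hF.1.comp_quasiMeasurePreserving (quasiMeasurePreserving_add_smul e ν))) ?_
  refine Eventually.of_forall fun q => ?_
  simp only [norm_mul, Pi.add_apply]
  nlinarith [sq_nonneg (‖ψ q.1‖ - ‖F (q.1 + q.2 • e)‖), sq_nonneg (‖ψ q.1‖),
    sq_nonneg ‖F (q.1 + q.2 • e)‖]

/-- The integral of a directional derivative vanishes; exceptional points are allowed on every
line. -/
theorem integral_deriv_along_eq_zero {h h' : E → ℂ} (e : E) (hi : Integrable h μ)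
    (hi' : Integrable h' μ) (hc : ∀ p, Continuous fun s : ℝ => h (p + s • e))
    (hd : ∀ p, ∃ S : Set ℝ, S.Countable ∧ ∀ s ∉ S,
      HasDerivAt (fun s : ℝ => h (p + s • e)) (h' (p + s • e)) s) :
    ∫ p, h' p ∂μ = 0 := by
  have hint := integrable_comp_add_smul (μ := μ) hi' e (volume.restrict (Set.Ioc (0 : ℝ) 1))
  -- By translation invariance `h'` may be averaged over a unit segment of each line. The
  -- fundamental theorem of calculus then gives `h(p + e) - h(p)`, whose integral vanishes, so no
  -- decay at infinity is needed.
  have h1 : ∫ p, (∫ s in Set.Ioc (0 : ℝ) 1, h' (p + s • e)) ∂μ = ∫ p, h' p ∂μ := by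
    rw [integral_integral_swap hint]
    have : ∀ s : ℝ, ∫ p, h' (p + s • e) ∂μ = ∫ p, h' p ∂μ := fun s =>
      integral_add_right_eq_self h' (s • e)
    simp [this]
  have h2 : ∫ p, (∫ s in Set.Ioc (0 : ℝ) 1, h' (p + s • e)) ∂μ = ∫ p, (h (p + e) - h p) ∂μ := by
    refine integral_congr_ae ?_
    filter_upwards [hint.prod_right_ae] with p hp
    obtain ⟨S, hS, hS'⟩ := hd p
    have := integral_eq_of_hasDerivAt_off_countable (fun s : ℝ => h (p + s • e))
      (fun s => h' (p + s • e)) (a := 0) (b := 1) hS (hc p).continuousOn (fun x hx => hS' x hx.2)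
      ((intervalIntegrable_iff_integrableOn_Ioc_of_le zero_le_one).2 hp)
    rw [intervalIntegral.integral_of_le zero_le_one] at this
    simpa using this
  rw [← h1, h2, integral_sub (hi.comp_add_right e) hi, integral_add_right_eq_self h e, sub_self]

end Lines

/-- Solutions of `y' = b y`, with a coefficient that is continuous off a countable set and has
constant real part `c`, satisfy `|y(1)| = eᶜ |y(0)|`. -/
theorem norm_eq_exp_mul_norm_of_integral_eq {b g y : ℝ → ℂ} {c : ℝ} {S : Set ℝ}
    (hS : S.Countable) (hb : ∀ s ∉ S, ContinuousAt b s) (hbm : Measurable b)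
    (hbi : IntervalIntegrable b volume 0 1) (hre : ∀ s, (b s).re = c)
    (hg : IntervalIntegrable (fun s => b s * g s) volume 0 1)
    (hy : ∀ t ∈ Set.Icc (0 : ℝ) 1, y t = y 0 + ∫ s in (0 : ℝ)..t, b s * g s)
    (hgy : ∀ᵐ s, s ∈ Set.Icc (0 : ℝ) 1 → g s = y s) :
    ‖y 1‖ = Real.exp c * ‖y 0‖ := by
  have h01 : Set.uIcc (0 : ℝ) 1 = Set.Icc 0 1 := Set.uIcc_of_le zero_le_one
  have hyc : ContinuousOn y (Set.Icc 0 1) := by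
    have : ContinuousOn (fun t => y 0 + ∫ s in (0 : ℝ)..t, b s * g s) (Set.Icc 0 1) := by
      rw [← h01]
      exact continuousOn_const.add (intervalIntegral.continuousOn_primitive_interval' hg
        (by simp))
    exact this.congr hy
  -- `g` stands for a function known only almost everywhere on the line and `y` for its continuous
  -- representative. Replacing `g` by `y` makes the integrand continuous off `S`.
  have hae : ∀ᵐ s, s ∈ Set.uIoc (0 : ℝ) 1 → b s * g s = b s * y s := by
    filter_upwards [hgy] with s hs h
    rw [Set.uIoc_of_le zero_le_one] at h
    rw [hs ⟨h.1.le, h.2⟩]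
  have hby : IntervalIntegrable (fun s => b s * y s) volume 0 1 :=
    hg.congr_ae ((ae_restrict_iff' measurableSet_uIoc).2 hae)
  have hy' : ∀ t ∈ Set.Icc (0 : ℝ) 1, y t = y 0 + ∫ s in (0 : ℝ)..t, b s * y s := by
    intro t ht
    rw [hy t ht]
    congr 1
    refine intervalIntegral.integral_congr_ae ?_
    filter_upwards [hae] with s hs h
    refine hs (Set.uIoc_subset_uIoc_of_uIcc_subset_uIcc ?_ h)
    rw [h01, Set.uIcc_of_le ht.1]
    exact Set.Icc_subset_Icc_right ht.2
  -- Integrating factor: `y e^{-B}` is continuous with zero derivative off the countable set `S`,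
  -- hence takes equal values at `0` and `1`. Only `Re B(1) = c` enters the modulus.
  set B : ℝ → ℂ := fun t => ∫ s in (0 : ℝ)..t, b s
  have hBc : ContinuousOn B (Set.Icc 0 1) := by
    rw [← h01]
    exact intervalIntegral.continuousOn_primitive_interval' hbi (by simp)
  have hsub : ∀ t ∈ Set.Ioo (0 : ℝ) 1, Set.uIcc 0 t ⊆ Set.uIcc (0 : ℝ) 1 := by
    intro t ht
    rw [h01, Set.uIcc_of_le ht.1.le]
    exact Set.Icc_subset_Icc_right ht.2.le
  have hz : ∀ t ∈ Set.Ioo (0 : ℝ) 1 \ S,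
      HasDerivAt (fun t => y t * Complex.exp (-B t)) 0 t := by
    rintro t ⟨ht, htS⟩
    have hnhds : Set.Ioo (0 : ℝ) 1 ∈ 𝓝 t := isOpen_Ioo.mem_nhds ht
    have hyt : ContinuousAt y t := hyc.continuousAt (mem_of_superset hnhds Set.Ioo_subset_Icc_self)
    have hB : HasDerivAt B (b t) t := intervalIntegral.integral_hasDerivAt_right
      (hbi.mono_set (hsub t ht)) hbm.stronglyMeasurable.stronglyMeasurableAtFilter (hb t htS)
    have hmeas : StronglyMeasurableAtFilter (fun s => b s * y s) (𝓝 t) volume := by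
      refine ⟨Set.Ioc 0 1, mem_of_superset hnhds Set.Ioo_subset_Ioc_self, ?_⟩
      exact ((intervalIntegrable_iff_integrableOn_Ioc_of_le zero_le_one).1 hby).1
    have h1 : HasDerivAt y (b t * y t) t := by
      have := (intervalIntegral.integral_hasDerivAt_right
        (hby.mono_set (hsub t ht)) hmeas ((hb t htS).mul hyt)).const_add (y 0)
      refine this.congr_of_eventuallyEq ?_
      filter_upwards [hnhds] with s hs
      exact hy' s (Set.Ioo_subset_Icc_self hs)
    refine (h1.mul hB.neg.cexp).congr_deriv ?_
    simp only [Pi.neg_apply]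
    ring
  have hfin := integral_eq_of_hasDerivAt_off_countable (fun t => y t * Complex.exp (-B t))
    (fun _ => 0) (a := 0) (b := 1) hS
    (by rw [h01]; exact hyc.mul hBc.neg.cexp) (by simpa using hz) (by simp)
  have hB1 : (B 1).re = c := by
    have h2 := Complex.reCLM.intervalIntegral_comp_comm hbi
    simp only [Complex.reCLM_apply, hre] at h2
    rw [← h2]
    simp
  have h0 : B 0 = 0 := by simp [B]
  simp only [intervalIntegral.integral_zero, h0, neg_zero, Complex.exp_zero, mul_one] at hfin
  rw [← sub_eq_zero.1 hfin.symm, norm_mul, Complex.norm_exp, Complex.neg_re, hB1, mul_comm,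
    mul_assoc, ← Real.exp_add]
  simp

/-! ### Weak solutions of transport equations -/

section Transport

variable {E : Type*} [NormedAddCommGroup E] [NormedSpace ℝ E] [MeasurableSpace E] [BorelSpace E]
  [SecondCountableTopology E]

/-- A class of test functions, invariant under the translations in the direction `e`, together
with their derivatives `D f` in this direction. -/
structure IsTestClass (μ : Measure E) (e : E) (T : Set (E → ℂ)) (D : (E → ℂ) → E → ℂ) : Prop where
  memLp : ∀ f ∈ T, MemLp f 2 μ
  memLp_deriv : ∀ f ∈ T, MemLp (D f) 2 μ
  continuous_deriv : ∀ f ∈ T, Continuous (D f)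
  hasDerivAt : ∀ f ∈ T, ∀ p, ∀ s : ℝ, HasDerivAt (fun s : ℝ => f (p + s • e)) (D f (p + s • e)) s
  translate : ∀ f ∈ T, ∀ s : ℝ, (fun p => f (p + s • e)) ∈ T
  deriv_translate : ∀ f ∈ T, ∀ s : ℝ, D (fun p => f (p + s • e)) = fun p => D f (p + s • e)
  separating : ∀ u : E → ℂ, AEStronglyMeasurable u μ → (∀ f ∈ T, Integrable (fun p => f p * u p) μ) →
    (∀ f ∈ T, ∫ p, f p * u p ∂μ = 0) → u =ᵐ[μ] 0

variable {μ : Measure E} [SFinite μ] [μ.IsAddRightInvariant] {e : E} {T : Set (E → ℂ)}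
  {D : (E → ℂ) → E → ℂ} {ψ b : E → ℂ}

/-- The coefficient `b` may be unbounded and `ψ` is merely square integrable. Translating by `-s •
e` moves `b` onto the test function, where the product is dominated by a translate of the square
integrable `F`, uniformly in `s`. -/
theorem integrable_mul_transport (hψ : MemLp ψ 2 μ) (hb : Measurable b) {f F : E → ℂ}
    (hf : MemLp f 2 μ) (hF : MemLp F 2 μ)
    (hbF : ∀ s ∈ Set.Icc (0 : ℝ) 1, ∀ p, ‖b p * f (p + s • -e)‖ ≤ ‖F (p + s • -e)‖)
    {ν : Measure ℝ} [IsFiniteMeasure ν] (hν : ∀ᵐ s ∂ν, s ∈ Set.Icc (0 : ℝ) 1) :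
    Integrable (fun q : E × ℝ => f q.1 * (b (q.1 + q.2 • e) * ψ (q.1 + q.2 • e))) (μ.prod ν) := by
  have h0 : Integrable (fun q : E × ℝ => ψ q.1 * (b q.1 * f (q.1 + q.2 • -e))) (μ.prod ν) := by
    refine (integrable_mul_comp_add_smul hψ hF (-e) ν).mono (hψ.1.comp_fst.mul
      (hb.aestronglyMeasurable.comp_fst.mul (hf.1.comp_quasiMeasurePreserving
        (quasiMeasurePreserving_add_smul (-e) ν)))) ?_
    have : ∀ᵐ q : E × ℝ ∂(μ.prod ν), q.2 ∈ Set.Icc (0 : ℝ) 1 :=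
      Measure.quasiMeasurePreserving_snd.ae hν
    filter_upwards [this] with q hq
    rw [norm_mul, norm_mul (ψ q.1) (F _)]
    exact mul_le_mul_of_nonneg_left (hbF _ hq _) (norm_nonneg _)
  have hbψ : AEStronglyMeasurable (fun p => b p * ψ p) μ := hb.aestronglyMeasurable.mul hψ.1
  have hm : AEStronglyMeasurable
      (fun q : E × ℝ => f q.1 * (b (q.1 + q.2 • e) * ψ (q.1 + q.2 • e))) (μ.prod ν) :=
    hf.1.comp_fst.mul (hbψ.comp_quasiMeasurePreserving (quasiMeasurePreserving_add_smul e ν))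
  have key : ∀ s : ℝ, (fun p => f p * (b (p + s • e) * ψ (p + s • e))) =
      fun p => (fun p => ψ p * (b p * f (p + s • -e))) (p + s • e) := by
    intro s
    funext p
    simp only [smul_neg, add_neg_cancel_right]
    ring
  obtain ⟨h1, h2⟩ := (integrable_prod_iff' h0.1).1 h0
  refine (integrable_prod_iff' hm).2 ⟨?_, ?_⟩
  · filter_upwards [h1] with s hs
    change Integrable (fun p => f p * (b (p + s • e) * ψ (p + s • e))) μ
    rw [key]
    exact hs.comp_add_right (s • e)
  · refine h2.congr (Eventually.of_forall fun s => ?_)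
    have := integral_add_right_eq_self (μ := μ)
      (fun p => ‖ψ p * (b p * f (p + s • -e))‖) (s • e)
    simp only at this ⊢
    rw [← this]
    refine integral_congr_ae (Eventually.of_forall fun p => ?_)
    exact congrArg norm (congrFun (key s) p).symm

theorem integral_mul_transport (s : ℝ) (f : E → ℂ) :
    ∫ p, f p * (b (p + s • e) * ψ (p + s • e)) ∂μ = ∫ p, ψ p * (b p * f (p + s • -e)) ∂μ := by
  rw [← integral_add_right_eq_self (fun p => ψ p * (b p * f (p + s • -e))) (s • e)]
  refine integral_congr_ae (Eventually.of_forall fun p => ?_)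
  simp only [smul_neg, add_neg_cancel_right]
  ring

/-- The integrated form of the weak equation `Dψ = b ψ`. -/
theorem ae_eq_add_integral_of_weak (hT : IsTestClass μ e T D) (hψ : MemLp ψ 2 μ)
    (hb : Measurable b)
    (hbF : ∀ f ∈ T, ∃ F : E → ℂ, MemLp F 2 μ ∧
      ∀ s ∈ Set.Icc (0 : ℝ) 1, ∀ p, ‖b p * f (p + s • -e)‖ ≤ ‖F (p + s • -e)‖)
    (hweak : ∀ f ∈ T, ∫ p, ψ p * D f p ∂μ = -∫ p, ψ p * (b p * f p) ∂μ)
    {t : ℝ} (ht : t ∈ Set.Icc (0 : ℝ) 1) :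
    ∀ᵐ p ∂μ, ψ (p + t • e) = ψ p + ∫ s in (0 : ℝ)..t, b (p + s • e) * ψ (p + s • e) := by
  set ν : Measure ℝ := volume.restrict (Set.Ioc 0 t)
  have hν : ∀ᵐ s ∂ν, s ∈ Set.Icc (0 : ℝ) 1 := by
    refine (ae_restrict_iff' measurableSet_Ioc).2 (Eventually.of_forall fun s hs => ?_)
    exact ⟨hs.1.le, hs.2.trans ht.2⟩
  have hmeas : AEStronglyMeasurable
      (fun p => ∫ s, b (p + s • e) * ψ (p + s • e) ∂ν) μ := by
    have hbψ : AEStronglyMeasurable (fun p => b p * ψ p) μ := hb.aestronglyMeasurable.mul hψ.1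
    exact (hbψ.comp_quasiMeasurePreserving
      (quasiMeasurePreserving_add_smul (μ := μ) e ν)).integral_prod_right'
  have hψt : MemLp (fun p => ψ (p + t • e)) 2 μ :=
    hψ.comp_measurePreserving (measurePreserving_add_right μ (t • e))
  have i1 : ∀ f ∈ T, Integrable (fun p => f p * ψ (p + t • e)) μ := fun f hf =>
    (hT.memLp f hf).integrable_mul hψt
  have i2 : ∀ f ∈ T, Integrable (fun p => f p * ψ p) μ := fun f hf =>
    (hT.memLp f hf).integrable_mul hψ
  have i3 : ∀ f ∈ T, Integrable (fun q : E × ℝ =>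
      f q.1 * (b (q.1 + q.2 • e) * ψ (q.1 + q.2 • e))) (μ.prod ν) := by
    intro f hf
    obtain ⟨F, hF, hF'⟩ := hbF f hf
    exact integrable_mul_transport hψ hb (hT.memLp f hf) hF hF' hν
  have i4 : ∀ f ∈ T, Integrable
      (fun p => f p * ∫ s, b (p + s • e) * ψ (p + s • e) ∂ν) μ := by
    intro f hf
    refine (i3 f hf).integral_prod_left.congr (Eventually.of_forall fun p => ?_)
    exact integral_const_mul (f p) fun s => b (p + s • e) * ψ (p + s • e)
  -- The difference of the two sides is tested against every `f` in the class. The integrability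
  -- facts above allow the three terms to be treated separately.
  have hu := hT.separating
    (fun p => ψ (p + t • e) - ψ p - ∫ s, b (p + s • e) * ψ (p + s • e) ∂ν)
    ((hψt.1.sub hψ.1).sub hmeas)
    (fun f hf => by
      refine (((i1 f hf).sub (i2 f hf)).sub (i4 f hf)).congr (Eventually.of_forall fun p => ?_)
      simp only [Pi.sub_apply]
      ring) ?_
  · filter_upwards [hu] with p hp
    rw [intervalIntegral.integral_of_le ht.1]
    simp only [Pi.zero_apply] at hp
    linear_combination hp
  intro f hf
  have e1 : ∫ p, f p * (ψ (p + t • e) - ψ p - ∫ s, b (p + s • e) * ψ (p + s • e) ∂ν) ∂μ =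
      ∫ p, f p * ψ (p + t • e) ∂μ - ∫ p, f p * ψ p ∂μ -
        ∫ p, f p * (∫ s, b (p + s • e) * ψ (p + s • e) ∂ν) ∂μ := by
    have i12 : Integrable (fun p => f p * ψ (p + t • e) - f p * ψ p) μ := (i1 f hf).sub (i2 f hf)
    rw [← integral_sub (i1 f hf) (i2 f hf), ← integral_sub i12 (i4 f hf)]
    refine integral_congr_ae (Eventually.of_forall fun p => ?_)
    simp only
    ring
  -- After Fubini and a translation, the weak equation is applied to the test function translated by
  -- `-s • e`. This is where invariance of the class under translations is used.
  have e2 : ∫ p, f p * (∫ s, b (p + s • e) * ψ (p + s • e) ∂ν) ∂μ =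
      ∫ s, -∫ p, ψ p * D f (p + s • -e) ∂μ ∂ν := by
    have : ∀ p, f p * (∫ s, b (p + s • e) * ψ (p + s • e) ∂ν) =
        ∫ s, f p * (b (p + s • e) * ψ (p + s • e)) ∂ν := fun p => (integral_const_mul _ _).symm
    simp only [this]
    rw [integral_integral_swap (i3 f hf)]
    refine integral_congr_ae (Eventually.of_forall fun s => ?_)
    simp only
    rw [integral_mul_transport]
    have hs := hweak _ (hT.translate f hf (-s))
    rw [hT.deriv_translate f hf] at hs
    simp only [smul_neg, ← neg_smul] at hs ⊢
    rw [hs, neg_neg]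
  have i5 := integrable_mul_comp_add_smul hψ (hT.memLp_deriv f hf) (-e) ν
  have e3 : ∫ p, f p * ψ (p + t • e) ∂μ = ∫ p, f (p + t • -e) * ψ p ∂μ := by
    rw [← integral_add_right_eq_self (fun p => f (p + t • -e) * ψ p) (t • e)]
    refine integral_congr_ae (Eventually.of_forall fun p => ?_)
    simp only [smul_neg, add_neg_cancel_right]
  have hft : MemLp (fun p => f (p + t • -e)) 2 μ :=
    (hT.memLp f hf).comp_measurePreserving (measurePreserving_add_right μ (t • -e))
  have i6 : Integrable (fun p => f (p + t • -e) * ψ p) μ := hft.integrable_mul hψ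
  have i7 : Integrable (fun p => f (p + t • -e) * ψ p - f p * ψ p) μ := i6.sub (i2 f hf)
  rw [e1, e2, e3, ← integral_sub i6 (i2 f hf), integral_neg,
    ← integral_integral_swap i5, sub_neg_eq_add, ← integral_add i7 i5.integral_prod_left]
  refine (integral_congr_ae (Eventually.of_forall fun p => ?_)).trans (integral_zero E ℂ)
  -- All derivatives now sit on the test function: what multiplies `ψ p` is `f(p - t e) - f(p)` plus
  -- the integral of `D f(p - s e)` over `s` in `(0, t]`, which is zero by the fundamental theorem
  -- of calculus.
  have hderiv : ∀ s : ℝ, HasDerivAt (fun s : ℝ => f (p + s • -e)) (-D f (p + s • -e)) s := by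
    intro s
    have h1 := (hT.hasDerivAt f hf p (-s)).scomp s (hasDerivAt_neg s)
    simp only [neg_smul, ← smul_neg, one_smul] at h1
    refine (h1.congr_deriv rfl).congr_of_eventuallyEq (Eventually.of_forall fun r => ?_)
    simp
  have hint : IntervalIntegrable (fun s : ℝ => -D f (p + s • -e)) volume 0 t := by
    have := hT.continuous_deriv f hf
    exact (by fun_prop : Continuous fun s : ℝ => -D f (p + s • -e)).intervalIntegrable _ _
  have := intervalIntegral.integral_eq_sub_of_hasDerivAt (fun s _ => hderiv s) hint
  rw [intervalIntegral.integral_of_le ht.1, integral_neg] at this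
  simp only [integral_const_mul, zero_smul, add_zero] at this ⊢
  have h2 : ∫ s, D f (p + s • -e) ∂ν = -(f (p + t • -e) - f p) := by rw [← this, neg_neg]
  rw [h2]
  ring

/-- Fubini for `|ψ|²` gives square integrability on almost every unit segment, and there `L²` is
contained in `L¹`. -/
theorem ae_intervalIntegrable_along (hψ : MemLp ψ 2 μ) :
    ∀ᵐ p ∂μ, IntervalIntegrable (fun s : ℝ => ψ (p + s • e)) volume 0 1 := by
  have h1 := integrable_comp_add_smul (μ := μ)
    ((memLp_two_iff_integrable_sq_norm hψ.1).1 hψ) e (volume.restrict (Set.Ioc (0 : ℝ) 1))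
  have h2 := (hψ.1.comp_quasiMeasurePreserving (quasiMeasurePreserving_add_smul (μ := μ) e
    (volume.restrict (Set.Ioc (0 : ℝ) 1)))).prodMk_left
  filter_upwards [h1.prod_right_ae, h2] with p hp hp2
  rw [intervalIntegrable_iff_integrableOn_Ioc_of_le zero_le_one]
  exact ((memLp_two_iff_integrable_sq_norm hp2).2 hp).integrable one_le_two

/-- A square integrable weak solution of `Dψ = b ψ` vanishes if `b` has a nonzero constant real
part. -/
theorem ae_eq_zero_of_weak_of_measurable {c : ℝ} (hc : c ≠ 0) (hT : IsTestClass μ e T D)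
    (hψ : MemLp ψ 2 μ) (hψm : Measurable ψ) (hb : Measurable b) (hre : ∀ p, (b p).re = c)
    (hbl : ∀ p, ∃ C, ∀ s ∈ Set.Icc (0 : ℝ) 1, ‖b (p + s • e)‖ ≤ C)
    (hbc : ∀ p, ∃ S : Set ℝ, S.Countable ∧ ∀ s ∉ S, ContinuousAt (fun s : ℝ => b (p + s • e)) s)
    (hbF : ∀ f ∈ T, ∃ F : E → ℂ, MemLp F 2 μ ∧
      ∀ s ∈ Set.Icc (0 : ℝ) 1, ∀ p, ‖b p * f (p + s • -e)‖ ≤ ‖F (p + s • -e)‖)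
    (hweak : ∀ f ∈ T, ∫ p, ψ p * D f p ∂μ = -∫ p, ψ p * (b p * f p) ∂μ) :
    ψ =ᵐ[μ] 0 := by
  have hA : ∀ t ∈ Set.Icc (0 : ℝ) 1, ∀ᵐ p ∂μ, ψ (p + t • e) =
      ψ p + ∫ s in (0 : ℝ)..t, b (p + s • e) * ψ (p + s • e) := fun t ht =>
    ae_eq_add_integral_of_weak hT hψ hb hbF hweak ht
  -- The exceptional null set of `hA` depends on `t`. Exchanging the quantifiers requires joint
  -- measurability in `(p, t)`, hence a genuinely measurable `ψ`.
  have hswap : ∀ᵐ p ∂μ, ∀ᵐ t : ℝ, t ∈ Set.Icc (0 : ℝ) 1 → ψ (p + t • e) =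
      ψ p + ∫ s in (0 : ℝ)..t, b (p + s • e) * ψ (p + s • e) := by
    refine (Measure.ae_ae_comm (μ := μ) (ν := (volume : Measure ℝ)) (p := fun p t =>
      t ∈ Set.Icc (0 : ℝ) 1 → ψ (p + t • e) =
      ψ p + ∫ s in (0 : ℝ)..t, b (p + s • e) * ψ (p + s • e)) ?_).2
        (Eventually.of_forall fun t => ?_)
    · have hm : Measurable fun q : E × ℝ =>
          ∫ s in (0 : ℝ)..q.2, b (q.1 + s • e) * ψ (q.1 + s • e) := by
        -- Rescaling to the fixed interval `(0, 1]` moves the variable endpoint into the integrand,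
        -- so measurability of parameter integrals applies.
        have : ∀ q : E × ℝ, ∫ s in (0 : ℝ)..q.2, b (q.1 + s • e) * ψ (q.1 + s • e) =
            q.2 • ∫ r in Set.Ioc (0 : ℝ) 1,
              b (q.1 + (q.2 * r) • e) * ψ (q.1 + (q.2 * r) • e) := by
          intro q
          rw [← intervalIntegral.integral_of_le zero_le_one,
            intervalIntegral.smul_integral_comp_mul_left
              (fun s => b (q.1 + s • e) * ψ (q.1 + s • e))]
          simp
        simp only [this]
        refine measurable_snd.smul ?_
        refine (StronglyMeasurable.integral_prod_right
          (f := fun (q : E × ℝ) (r : ℝ) => b (q.1 + (q.2 * r) • e) * ψ (q.1 + (q.2 * r) • e))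
          (Measurable.stronglyMeasurable ?_)).measurable
        have h3 : Measurable fun x : (E × ℝ) × ℝ => x.1.1 + (x.1.2 * x.2) • e := by fun_prop
        exact (hb.comp h3).mul (hψm.comp h3)
      have h4 : Measurable fun x : E × ℝ => x.1 + x.2 • e := by fun_prop
      exact (measurableSet_Icc.preimage measurable_snd).imp
        (measurableSet_eq_fun (hψm.comp h4) ((hψm.comp measurable_fst).add hm))
    · by_cases ht : t ∈ Set.Icc (0 : ℝ) 1
      · filter_upwards [hA t ht] with p hp _ using hp
      · exact Eventually.of_forall fun p h => absurd h ht
  have hnorm : ∀ᵐ p ∂μ, ‖ψ (p + e)‖ = Real.exp c * ‖ψ p‖ := by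
    filter_upwards [hswap, hA 1 (by simp), ae_intervalIntegrable_along (e := e) hψ]
      with p h1 h2 h3
    obtain ⟨S, hS, hS'⟩ := hbc p
    obtain ⟨C, hC⟩ := hbl p
    have hbm : Measurable fun s : ℝ => b (p + s • e) := hb.comp (by fun_prop)
    have hbd : ∀ᵐ s ∂(volume.restrict (Set.Ioc (0 : ℝ) 1)), ‖b (p + s • e)‖ ≤ C :=
      (ae_restrict_iff' measurableSet_Ioc).2 (Eventually.of_forall fun s hs => hC s ⟨hs.1.le, hs.2⟩)
    have hbi : IntervalIntegrable (fun s : ℝ => b (p + s • e)) volume 0 1 :=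
      (intervalIntegrable_iff_integrableOn_Ioc_of_le zero_le_one).2
        (Integrable.of_bound hbm.aestronglyMeasurable C hbd)
    have hg : IntervalIntegrable (fun s : ℝ => b (p + s • e) * ψ (p + s • e)) volume 0 1 := by
      rw [intervalIntegrable_iff_integrableOn_Ioc_of_le zero_le_one] at h3 ⊢
      exact h3.bdd_mul hbm.aestronglyMeasurable hbd
    -- The right-hand side of the integrated equation is the continuous representative on the line.
    -- It equals `ψ p` at `0` exactly, and `ψ (p + e)` at `1` by `hA` for `t = 1`.
    have := norm_eq_exp_mul_norm_of_integral_eq (b := fun s : ℝ => b (p + s • e))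
      (g := fun s : ℝ => ψ (p + s • e))
      (y := fun t => ψ p + ∫ s in (0 : ℝ)..t, b (p + s • e) * ψ (p + s • e))
      hS hS' hbm hbi (fun s => hre _) hg (fun t _ => by simp) h1
    simp only [intervalIntegral.integral_same, add_zero] at this
    rw [← this, ← h2, one_smul]
  have hi : Integrable (fun p => ‖ψ p‖ ^ 2) μ := (memLp_two_iff_integrable_sq_norm hψ.1).1 hψ
  have h1 : ∫ p, ‖ψ p‖ ^ 2 ∂μ = Real.exp c ^ 2 * ∫ p, ‖ψ p‖ ^ 2 ∂μ := by
    rw [← integral_const_mul, ← integral_add_right_eq_self (fun p => ‖ψ p‖ ^ 2) e]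
    refine integral_congr_ae ?_
    filter_upwards [hnorm] with p hp
    rw [hp, mul_pow]
  have h2 : ∫ p, ‖ψ p‖ ^ 2 ∂μ = 0 := by
    by_contra h
    -- If the norm were nonzero, invariance under the shift by `e` would force `e^{2c} = 1`,
    -- contradicting `c ≠ 0`.
    have h3 : Real.exp c ^ 2 = 1 := (mul_right_cancel₀ h (by rw [one_mul]; exact h1)).symm
    rw [← Real.exp_nat_mul, Real.exp_eq_one_iff] at h3
    exact hc (by simpa using h3)
  rw [integral_eq_zero_iff_of_nonneg (fun p => by positivity) hi] at h2
  filter_upwards [h2] with p hp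
  simpa using hp

theorem ae_eq_zero_of_weak {c : ℝ} (hc : c ≠ 0) (hT : IsTestClass μ e T D)
    (hψ : MemLp ψ 2 μ) (hb : Measurable b) (hre : ∀ p, (b p).re = c)
    (hbl : ∀ p, ∃ C, ∀ s ∈ Set.Icc (0 : ℝ) 1, ‖b (p + s • e)‖ ≤ C)
    (hbc : ∀ p, ∃ S : Set ℝ, S.Countable ∧ ∀ s ∉ S, ContinuousAt (fun s : ℝ => b (p + s • e)) s)
    (hbF : ∀ f ∈ T, ∃ F : E → ℂ, MemLp F 2 μ ∧
      ∀ s ∈ Set.Icc (0 : ℝ) 1, ∀ p, ‖b p * f (p + s • -e)‖ ≤ ‖F (p + s • -e)‖)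
    (hweak : ∀ f ∈ T, ∫ p, ψ p * D f p ∂μ = -∫ p, ψ p * (b p * f p) ∂μ) :
    ψ =ᵐ[μ] 0 := by
  have hae := hψ.1.ae_eq_mk
  refine hae.trans (ae_eq_zero_of_weak_of_measurable hc hT ((memLp_congr_ae hae).1 hψ)
    hψ.1.stronglyMeasurable_mk.measurable hb hre hbl hbc hbF fun f hf => ?_)
  refine Eq.trans (integral_congr_ae ?_) ((hweak f hf).trans (congrArg _ (integral_congr_ae ?_)))
  · filter_upwards [hae] with p hp
    rw [hp]
  · filter_upwards [hae] with p hp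
    rw [hp]

end Transport

/-! ### Fourier uniqueness -/

section FourierUniqueness

variable {E : Type*} [NormedAddCommGroup E] [NormedSpace ℝ E] [MeasurableSpace E] [BorelSpace E]
  [SecondCountableTopology E] [CompleteSpace E] {μ : Measure E} [SigmaFinite μ]

theorem norm_cexp_dual_mul_I (L : StrongDual ℝ E) (p : E) : ‖Complex.exp (L p * Complex.I)‖ = 1 :=
  Complex.norm_exp_ofReal_mul_I _

/-- The positive and negative parts of `r` are densities of two finite measures with equal
characteristic functions. The measures coincide, so both parts agree almost everywhere; as one of
them is zero at each point, so is `r`. -/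
theorem ae_eq_zero_of_integral_cexp_real {r : E → ℝ} (hr : Integrable r μ)
    (h : ∀ L : StrongDual ℝ E, ∫ p, Complex.exp (L p * Complex.I) * (r p : ℂ) ∂μ = 0) :
    r =ᵐ[μ] 0 := by
  have hfin : ∀ {r : E → ℝ}, Integrable r μ →
      IsFiniteMeasure (μ.withDensity fun x => ENNReal.ofReal (r x)) := fun hr =>
    isFiniteMeasure_withDensity_ofReal hr.2
  have h1 := hfin hr
  have h2 := hfin hr.neg
  have hint : ∀ {s : E → ℝ}, Integrable s μ → ∀ L : StrongDual ℝ E,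
      Integrable (fun p => Complex.exp (L p * Complex.I) * (s p : ℂ)) μ := fun hs L =>
    hs.ofReal.bdd_mul (c := 1) (by fun_prop)
      (Eventually.of_forall fun p => (norm_cexp_dual_mul_I L p).le)
  have hval : ∀ {s : E → ℝ}, Integrable s μ → ∀ L : StrongDual ℝ E,
      charFunDual (μ.withDensity fun x => ENNReal.ofReal (s x)) L =
        ∫ p, Complex.exp (L p * Complex.I) * ((max (s p) 0 : ℝ) : ℂ) ∂μ := by
    intro s hs L
    rw [charFunDual_apply, integral_withDensity_eq_integral_toReal_smul₀
      hs.1.aemeasurable.ennreal_ofReal (Eventually.of_forall fun _ => ENNReal.ofReal_lt_top)]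
    refine integral_congr_ae (Eventually.of_forall fun p => ?_)
    simp only [ENNReal.toReal_ofReal', Complex.real_smul]
    ring
  have heq : μ.withDensity (fun x => ENNReal.ofReal (r x)) =
      μ.withDensity (fun x => ENNReal.ofReal (-r x)) := by
    refine Measure.ext_of_charFunDual (funext fun L => ?_)
    have e1 := hval hr L
    have e2 := hval hr.neg L
    simp only [Pi.neg_apply] at e2
    rw [e1, e2, ← sub_eq_zero, ← integral_sub (hint hr.pos_part L) (hint hr.neg_part L), ← h L]
    refine integral_congr_ae (Eventually.of_forall fun p => ?_)
    simp only
    rw [← mul_sub, ← Complex.ofReal_sub, max_zero_sub_max_neg_zero_eq_self]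
  have heq' := (withDensity_eq_iff_of_sigmaFinite hr.1.aemeasurable.ennreal_ofReal
    hr.1.aemeasurable.neg.ennreal_ofReal).1 heq
  filter_upwards [heq'] with p hp
  rw [Pi.neg_apply] at hp
  rcases le_total (r p) 0 with h0 | h0
  · rw [ENNReal.ofReal_of_nonpos h0] at hp
    have := ENNReal.ofReal_eq_zero.1 hp.symm
    exact le_antisymm h0 (by simpa using this)
  · rw [ENNReal.ofReal_of_nonpos (neg_nonpos.2 h0)] at hp
    exact le_antisymm (ENNReal.ofReal_eq_zero.1 hp) h0

/-- Conjugation and `L ↦ -L` show that the conjugate of `v` has vanishing transform too. Hence so do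
the real and imaginary parts, to which the real case applies. -/
theorem ae_eq_zero_of_integral_cexp {v : E → ℂ} (hv : Integrable v μ)
    (h : ∀ L : StrongDual ℝ E, ∫ p, Complex.exp (L p * Complex.I) * v p ∂μ = 0) :
    v =ᵐ[μ] 0 := by
  have hint : ∀ {s : E → ℂ}, Integrable s μ → ∀ L : StrongDual ℝ E,
      Integrable (fun p => Complex.exp (L p * Complex.I) * s p) μ := fun hs L =>
    hs.bdd_mul (c := 1) (by fun_prop) (Eventually.of_forall fun p => (norm_cexp_dual_mul_I L p).le)
  have hvc : Integrable (fun p => (starRingEnd ℂ) (v p)) μ :=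
    (Complex.conjLIE.integrable_comp_iff (φ := v)).2 hv
  have hc : ∀ L : StrongDual ℝ E,
      ∫ p, Complex.exp (L p * Complex.I) * (starRingEnd ℂ) (v p) ∂μ = 0 := by
    intro L
    rw [← map_zero (starRingEnd ℂ), ← h (-L), ← integral_conj]
    refine integral_congr_ae (Eventually.of_forall fun p => ?_)
    simp [← Complex.exp_conj]
  have hre := ae_eq_zero_of_integral_cexp_real hv.re fun L => by
    have : ∫ p, Complex.exp (L p * Complex.I) * v p +
        Complex.exp (L p * Complex.I) * (starRingEnd ℂ) (v p) ∂μ = 0 := by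
      rw [integral_add (hint hv L) (hint hvc L), h, hc, add_zero]
    rw [← mul_zero (1 / 2 : ℂ), ← this, ← integral_const_mul]
    refine integral_congr_ae (Eventually.of_forall fun p => ?_)
    simp only [RCLike.re_to_complex]
    rw [← mul_add, Complex.add_conj]
    push_cast
    ring
  have him := ae_eq_zero_of_integral_cexp_real hv.im fun L => by
    have : ∫ p, Complex.exp (L p * Complex.I) * v p -
        Complex.exp (L p * Complex.I) * (starRingEnd ℂ) (v p) ∂μ = 0 := by
      rw [integral_sub (hint hv L) (hint hvc L), h, hc, sub_zero]
    rw [← mul_zero (1 / (2 * Complex.I) : ℂ), ← this, ← integral_const_mul]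
    refine integral_congr_ae (Eventually.of_forall fun p => ?_)
    simp only [RCLike.im_to_complex]
    rw [← mul_sub, Complex.sub_conj]
    push_cast
    field_simp
  filter_upwards [hre, him] with p h1 h2
  exact Complex.ext h1 h2

end FourierUniqueness

/-! ### Algebraic tensor products of Schwartz spaces -/

section Tensor

variable {n k : ℕ}

theorem comp_add_const_mem_schwartzTensor {f : (Fin k → Momentum n) → ℂ}
    (hf : f ∈ schwartzTensor n k) (v : Fin k → Momentum n) :
    (fun p => f (p + v)) ∈ schwartzTensor n k := by
  induction hf using Submodule.span_induction with
  | mem f hf =>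
    obtain ⟨φ, rfl⟩ := hf
    refine Submodule.subset_span ⟨fun i => SchwartzMap.compSubConstCLM ℂ (-v i) (φ i), ?_⟩
    funext p
    simp
  | zero => exact Submodule.zero_mem _
  | add f g _ _ hf hg => exact Submodule.add_mem _ hf hg
  | smul c f _ hf => exact Submodule.smul_mem _ c hf

theorem comp_perm_mem_schwartzTensor {f : (Fin k → Momentum n) → ℂ}
    (hf : f ∈ schwartzTensor n k) (σ : Equiv.Perm (Fin k)) :
    (fun p => f (p ∘ σ)) ∈ schwartzTensor n k := by
  induction hf using Submodule.span_induction with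
  | mem f hf =>
    obtain ⟨φ, rfl⟩ := hf
    refine Submodule.subset_span ⟨fun i => φ (σ.symm i), ?_⟩
    funext p
    rw [← Equiv.prod_comp σ]
    simp
  | zero => exact Submodule.zero_mem _
  | add f g _ _ hf hg => exact Submodule.add_mem _ hf hg
  | smul c f _ hf => exact Submodule.smul_mem _ c hf

/-- The weight `∏ᵢ (1 + |pᵢ|)`. -/
def momentumWeight (p : Fin k → Momentum n) : ℝ := ∏ i, (1 + ‖p i‖)

theorem continuous_momentumWeight : Continuous (momentumWeight : (Fin k → Momentum n) → ℝ) := by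
  unfold momentumWeight
  fun_prop

theorem one_le_momentumWeight (p : Fin k → Momentum n) : 1 ≤ momentumWeight p := by
  rw [← Finset.prod_const_one (s := (Finset.univ : Finset (Fin k)))]
  exact Finset.prod_le_prod (fun _ _ => zero_le_one) fun i _ => by simp

theorem momentumWeight_nonneg (p : Fin k → Momentum n) : 0 ≤ momentumWeight p :=
  zero_le_one.trans (one_le_momentumWeight p)

theorem norm_le_momentumWeight (p : Fin k → Momentum n) (i : Fin k) :
    ‖p i‖ ≤ momentumWeight p := by
  have h : 1 ≤ ∏ l ∈ Finset.univ.erase i, (1 + ‖p l‖) := by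
    rw [← Finset.prod_const_one (s := Finset.univ.erase i)]
    exact Finset.prod_le_prod (fun _ _ => zero_le_one) fun i _ => by simp
  rw [momentumWeight, ← Finset.mul_prod_erase Finset.univ _ (Finset.mem_univ i)]
  nlinarith [norm_nonneg (p i)]

theorem sum_norm_le_momentumWeight (p : Fin k → Momentum n) :
    ∑ i, ‖p i‖ ≤ k * momentumWeight p := by
  refine (Finset.sum_le_card_nsmul _ _ _ fun i _ => norm_le_momentumWeight p i).trans ?_
  simp

/-- Each factor satisfies `1 + |pᵢ + vᵢ| ≤ 2 (1 + |pᵢ|)`. This makes the growth bounds on potentials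
uniform along a unit segment. -/
theorem momentumWeight_add_le (p v : Fin k → Momentum n) (hv : ∀ i, ‖v i‖ ≤ 1) :
    momentumWeight (p + v) ≤ 2 ^ k * momentumWeight p := by
  have : (2 : ℝ) ^ k * momentumWeight p = ∏ i : Fin k, (2 * (1 + ‖p i‖)) := by
    rw [Finset.prod_mul_distrib, Finset.prod_const, Finset.card_univ, Fintype.card_fin]
    rfl
  rw [this]
  refine Finset.prod_le_prod (fun i _ => by positivity) fun i _ => ?_
  have h1 := norm_add_le (p i) (v i)
  have h2 := norm_nonneg (p i)
  have h3 := hv i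
  simp only [Pi.add_apply]
  linarith

/-- The weight is a product, so on an elementary tensor it is absorbed factor by factor by the decay
of the Schwartz functions. -/
theorem memLp_momentumWeight_mul {f : (Fin k → Momentum n) → ℂ} (hf : f ∈ schwartzTensor n k) :
    MemLp (fun p => (momentumWeight p : ℂ) * f p) 2 volume := by
  induction hf using Submodule.span_induction with
  | mem f hf =>
    obtain ⟨φ, rfl⟩ := hf
    have hc : Continuous fun p : Fin k → Momentum n => (momentumWeight p : ℂ) * ∏ i, φ i (p i) :=
      (Complex.continuous_ofReal.comp continuous_momentumWeight).mul
        (continuous_finsetProd _ fun i _ => (φ i).continuous.comp (continuous_apply i))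
    rw [memLp_two_iff_integrable_sq_norm hc.aestronglyMeasurable]
    have h1 : ∀ i, Integrable (fun q : Momentum n => ((1 + ‖q‖) * ‖φ i q‖) ^ 2) volume := by
      intro i
      have h2 : ∀ N : ℕ, Integrable (fun q : Momentum n => ‖q‖ ^ N * ‖φ i q‖) volume := fun N =>
        (φ i).integrable_pow_mul volume N
      obtain ⟨C, hC0, hC⟩ := (φ i).decay 0 0
      obtain ⟨C1, hC10, hC1⟩ := (φ i).decay 1 0
      simp only [pow_zero, one_mul, norm_iteratedFDeriv_zero, pow_one] at hC hC1
      -- One of the two factors `(1 + |q|) |φ i q|` of the square is bounded by `C + C1`; the other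
      -- is integrable.
      refine (((h2 0).add (h2 1)).const_mul (C + C1)).mono' (by
        have := (φ i).continuous
        fun_prop) (Eventually.of_forall fun q => ?_)
      have h3 := hC q
      have h4 := hC1 q
      have h5 : 0 ≤ (1 + ‖q‖) * ‖φ i q‖ := by positivity
      simp only [Pi.add_apply, pow_zero, one_mul, pow_one]
      rw [Real.norm_of_nonneg (by positivity)]
      nlinarith
    have h : Integrable (fun p : Fin k → Momentum n => ∏ i, ((1 + ‖p i‖) * ‖φ i (p i)‖) ^ 2)
        volume :=
      Integrable.fintype_prod (f := fun i (q : Momentum n) => ((1 + ‖q‖) * ‖φ i q‖) ^ 2) h1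
    refine h.congr (Eventually.of_forall fun p => ?_)
    simp only
    rw [norm_mul, Complex.norm_real, Real.norm_of_nonneg (momentumWeight_nonneg p), norm_prod,
      momentumWeight, ← Finset.prod_mul_distrib, Finset.prod_pow]
  | zero => simp
  | add f g _ _ hf hg =>
    refine (hf.add hg).ae_eq (Eventually.of_forall fun p => ?_)
    simp [mul_add]
  | smul c f _ hf =>
    refine (hf.const_smul c).ae_eq (Eventually.of_forall fun p => ?_)
    simp [mul_left_comm]

end Tensor

/-! ### Separation by plane waves, and deficiency spaces in a single sector -/

section TestClass

variable {n k : ℕ}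

/-- A Schwartz function with compact support that is a given plane wave on a given ball. -/
def planeWaveBump (R : ℕ) (L : StrongDual ℝ (Momentum n)) : 𝓢(Momentum n, ℂ) :=
  let b : ContDiffBump (0 : Momentum n) := ⟨R + 1, R + 2, by positivity, by linarith⟩
  have h1 : HasCompactSupport fun x => ((b x : ℝ) : ℂ) * Complex.exp (L x * Complex.I) :=
    (b.hasCompactSupport.comp_left (g := fun t : ℝ => (t : ℂ)) Complex.ofReal_zero).mul_right
  have h2 : ContDiff ℝ (⊤ : ℕ∞) fun x => ((b x : ℝ) : ℂ) * Complex.exp (L x * Complex.I) :=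
    (Complex.ofRealCLM.contDiff.comp b.contDiff).mul
      (((Complex.ofRealCLM.contDiff.comp L.contDiff).mul contDiff_const).cexp)
  h1.toSchwartzMap h2

theorem planeWaveBump_apply (R : ℕ) (L : StrongDual ℝ (Momentum n)) (q : Momentum n) :
    planeWaveBump R L q = planeWaveBump R 0 q * Complex.exp (L q * Complex.I) := by
  let b : ContDiffBump (0 : Momentum n) := ⟨R + 1, R + 2, by positivity, by linarith⟩
  change ((b q : ℝ) : ℂ) * Complex.exp (_ * Complex.I) =
    ((b q : ℝ) : ℂ) * Complex.exp (_ * Complex.I) * Complex.exp (_ * Complex.I)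
  simp

theorem planeWaveBump_zero_eq_one (R : ℕ) {q : Momentum n} (hq : ‖q‖ ≤ R) :
    planeWaveBump R (0 : StrongDual ℝ (Momentum n)) q = 1 := by
  let b : ContDiffBump (0 : Momentum n) := ⟨R + 1, R + 2, by positivity, by linarith⟩
  have : b q = 1 := b.one_of_mem_closedBall (by
    simp only [mem_closedBall_zero_iff]
    change ‖q‖ ≤ R + 1
    linarith)
  change ((b q : ℝ) : ℂ) * Complex.exp (_ * Complex.I) = 1
  rw [this]
  simp

/-- A continuous functional on the product space is a sum of functionals in the single momenta, so
every plane wave is an elementary tensor. With compactly supported cutoffs these become admissible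
test functions; Fourier uniqueness annihilates the cut-off `u`, and the cutoffs exhaust the space.
-/
theorem ae_eq_zero_of_integral_schwartzTensor {u : (Fin k → Momentum n) → ℂ}
    (hi : ∀ f ∈ schwartzTensor n k, Integrable (fun p => f p * u p) volume)
    (h : ∀ f ∈ schwartzTensor n k, ∫ p, f p * u p = 0) : u =ᵐ[volume] 0 := by
  have hR : ∀ R : ℕ, ∀ᵐ p : Fin k → Momentum n,
      (∏ i, planeWaveBump R (0 : StrongDual ℝ (Momentum n)) (p i)) * u p = 0 := by
    intro R
    refine ae_eq_zero_of_integral_cexp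
      (hi _ (Submodule.subset_span ⟨fun _ => planeWaveBump R 0, rfl⟩)) fun L => ?_
    have h1 := h _ (Submodule.subset_span ⟨fun i => planeWaveBump R
      (L.comp (ContinuousLinearMap.single ℝ (fun _ : Fin k => Momentum n) i)), rfl⟩)
    rw [← h1]
    refine integral_congr_ae (Eventually.of_forall fun p => ?_)
    simp only
    have h2 : L p = ∑ i, L.comp (ContinuousLinearMap.single ℝ (fun _ : Fin k => Momentum n) i)
        (p i) := by
      simp only [ContinuousLinearMap.comp_apply]
      rw [← map_sum]
      congr 1
      exact (Finset.univ_sum_single p).symm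
    have h3 : ∀ i, planeWaveBump R
        (L.comp (ContinuousLinearMap.single ℝ (fun _ : Fin k => Momentum n) i)) (p i) =
        planeWaveBump R 0 (p i) * Complex.exp (L.comp (ContinuousLinearMap.single ℝ
          (fun _ : Fin k => Momentum n) i) (p i) * Complex.I) := fun i => planeWaveBump_apply R _ _
    rw [Finset.prod_congr rfl fun i _ => h3 i, Finset.prod_mul_distrib, ← Complex.exp_sum,
      ← Finset.sum_mul, ← Complex.ofReal_sum, ← h2]
    ring
  filter_upwards [ae_all_iff.2 hR] with p hp
  obtain ⟨R, hR⟩ := exists_nat_ge (∑ i, ‖p i‖)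
  have h1 : ∀ i, ‖p i‖ ≤ R := fun i =>
    (Finset.single_le_sum (fun i _ => norm_nonneg (p i)) (Finset.mem_univ i)).trans hR
  have h2 := hp R
  rwa [Finset.prod_eq_one fun i _ => planeWaveBump_zero_eq_one R (h1 i), one_mul] at h2

/-- The common translation of all momenta in the direction `j`. -/
def commonShift (k : ℕ) (j : Fin n) : Fin k → Momentum n := fun _ => EuclideanSpace.single j 1

theorem fderiv_commonShift_eq (j : Fin n) (f : (Fin k → Momentum n) → ℂ)
    (p : Fin k → Momentum n) :
    fderiv ℝ f p (commonShift k j) = Complex.I * sectorDeriv j f p := by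
  rw [sectorDeriv_eq, ← mul_assoc, mul_neg, Complex.I_mul_I, neg_neg, one_mul]
  rfl

theorem fderiv_commonShift_mem (j : Fin n) {f : (Fin k → Momentum n) → ℂ}
    (hf : f ∈ schwartzTensor n k) :
    (fun p => fderiv ℝ f p (commonShift k j)) ∈ schwartzTensor n k := by
  have : (fun p => fderiv ℝ f p (commonShift k j)) = Complex.I • sectorDeriv j f :=
    funext fun p => fderiv_commonShift_eq j f p
  rw [this]
  exact Submodule.smul_mem _ _ (sectorDeriv_mem j hf)

theorem hasDerivAt_along {f : (Fin k → Momentum n) → ℂ} (hf : Differentiable ℝ f)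
    (p e : Fin k → Momentum n) (s : ℝ) :
    HasDerivAt (fun s : ℝ => f (p + s • e)) (fderiv ℝ f (p + s • e) e) s := by
  have h1 : HasDerivAt (fun s : ℝ => p + s • e) e s := by
    simpa using ((hasDerivAt_id s).smul_const e).const_add p
  exact (hf (p + s • e)).hasFDerivAt.comp_hasDerivAt s h1

theorem isTestClass_schwartzTensor (j : Fin n) :
    IsTestClass volume (commonShift k j) (schwartzTensor n k : Set ((Fin k → Momentum n) → ℂ))
      (fun f p => fderiv ℝ f p (commonShift k j)) where
  memLp f hf := memLp_schwartzTensor hf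
  memLp_deriv f hf := memLp_schwartzTensor (fderiv_commonShift_mem j hf)
  continuous_deriv f hf :=
    (differentiable_schwartzTensor (fderiv_commonShift_mem j hf)).continuous
  hasDerivAt f hf p s := hasDerivAt_along (differentiable_schwartzTensor hf) p _ s
  translate f hf s := comp_add_const_mem_schwartzTensor hf _
  deriv_translate f hf s := by
    funext p
    rw [fderiv_comp_add_right]
  separating u _ hi h := ae_eq_zero_of_integral_schwartzTensor hi h

/-- The potentials allowed in the one-parameter transport operators `i D + W`. -/
structure IsTransportPotential (j : Fin n) (W : (Fin k → Momentum n) → ℝ) : Prop where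
  measurable : Measurable W
  bound : ∃ C, ∀ p, |W p| ≤ C * momentumWeight p
  continuousAt : ∀ p, ∃ S : Set ℝ, S.Countable ∧
    ∀ s ∉ S, ContinuousAt (fun s : ℝ => W (p + s • commonShift k j)) s

theorem norm_smul_commonShift_le (j : Fin n) {s : ℝ} (hs : s ∈ Set.Icc (0 : ℝ) 1) (i : Fin k) :
    ‖(s • commonShift k j) i‖ ≤ 1 := by
  simp [commonShift, norm_smul, abs_of_nonneg hs.1, hs.2]

theorem memLp_mul_of_le_momentumWeight {W : (Fin k → Momentum n) → ℝ} (hm : Measurable W)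
    (hW : ∃ C, ∀ p, |W p| ≤ C * momentumWeight p) {f : (Fin k → Momentum n) → ℂ}
    (hf : f ∈ schwartzTensor n k) : MemLp (fun p => (W p : ℂ) * f p) 2 volume := by
  obtain ⟨C, hC⟩ := hW
  refine ((memLp_momentumWeight_mul hf).const_mul (C : ℂ)).mono
    ((Complex.measurable_ofReal.comp hm).aestronglyMeasurable.mul
      (differentiable_schwartzTensor hf).continuous.aestronglyMeasurable)
    (Eventually.of_forall fun p => ?_)
  have hC0 : 0 ≤ C := by
    have := (abs_nonneg _).trans (hC p)
    exact nonneg_of_mul_nonneg_left this (zero_lt_one.trans_le (one_le_momentumWeight p))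
  rw [norm_mul, norm_mul, norm_mul, ← mul_assoc, Complex.norm_real, Complex.norm_real,
    Complex.norm_real, Real.norm_of_nonneg hC0, Real.norm_of_nonneg (momentumWeight_nonneg p)]
  exact mul_le_mul_of_nonneg_right (hC p) (norm_nonneg _)

/-- The deficiency spaces of `i D + W` on `𝓢(ℝⁿ)^{⊗k}` vanish. -/
theorem IsTransportPotential.ae_eq_zero {j : Fin n} {W : (Fin k → Momentum n) → ℝ}
    (hW : IsTransportPotential j W) {ψ : (Fin k → Momentum n) → ℂ} (hψ : MemLp ψ 2 volume)
    {c : ℝ} (hc : c ≠ 0)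
    (h : ∀ f ∈ schwartzTensor n k,
      ∫ p, ψ p * (-sectorDeriv j f p + W p * f p + c * Complex.I * f p) = 0) :
    ψ =ᵐ[volume] 0 := by
  obtain ⟨C, hC⟩ := hW.bound
  have hC0 : 0 ≤ C := by
    have := (abs_nonneg _).trans (hC 0)
    exact nonneg_of_mul_nonneg_left this (zero_lt_one.trans_le (one_le_momentumWeight 0))
  -- Since `-sectorDeriv` is `i D`, multiplying the hypothesis by `-i` gives `∫ ψ (D f + (c - iW) f)
  -- = 0`, the weak form of `Dψ = bψ`. As `W` is real, `b` has constant real part `c`.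
  set b : (Fin k → Momentum n) → ℂ := fun p => c - Complex.I * W p with hbdef
  have hbn : ∀ p, ‖b p‖ ≤ (|c| + C) * momentumWeight p := by
    intro p
    refine (norm_sub_le _ _).trans ?_
    rw [norm_mul, Complex.norm_I, one_mul, Complex.norm_real, Complex.norm_real, add_mul]
    refine add_le_add ?_ (hC p)
    exact le_mul_of_one_le_right (abs_nonneg c) (one_le_momentumWeight p)
  have hC' : 0 ≤ |c| + C := by positivity
  refine ae_eq_zero_of_weak (b := b) hc (isTestClass_schwartzTensor j) hψ
    (measurable_const.sub (measurable_const.mul (Complex.measurable_ofReal.comp hW.measurable)))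
    (fun p => by simp [b]) (fun p => ?_) (fun p => ?_) (fun f hf => ?_) (fun f hf => ?_)
  · refine ⟨(|c| + C) * (2 ^ k * momentumWeight p), fun s hs => (hbn _).trans ?_⟩
    exact mul_le_mul_of_nonneg_left
      (momentumWeight_add_le p _ (norm_smul_commonShift_le j hs)) hC'
  · obtain ⟨S, hS, hS'⟩ := hW.continuousAt p
    refine ⟨S, hS, fun s hs => ?_⟩
    exact continuousAt_const.sub (continuousAt_const.mul
      (Complex.continuous_ofReal.continuousAt.comp (hS' s hs)))
  · refine ⟨fun p => (((|c| + C) * 2 ^ k : ℝ) : ℂ) * (momentumWeight p * f p),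
      (memLp_momentumWeight_mul hf).const_mul _, fun s hs p => ?_⟩
    have h1 : momentumWeight p ≤ 2 ^ k * momentumWeight (p + s • -commonShift k j) := by
      have := momentumWeight_add_le (p + s • -commonShift k j) (s • commonShift k j)
        (norm_smul_commonShift_le j hs)
      simpa [add_assoc] using this
    rw [norm_mul, norm_mul, norm_mul, Complex.norm_real, Complex.norm_real,
      Real.norm_of_nonneg (momentumWeight_nonneg _), Real.norm_of_nonneg (by positivity),
      ← mul_assoc]
    refine mul_le_mul_of_nonneg_right ((hbn p).trans ?_) (norm_nonneg _)
    rw [mul_assoc]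
    exact mul_le_mul_of_nonneg_left h1 hC'
  · have h1 := h f hf
    have i1 : Integrable (fun p => ψ p * fderiv ℝ f p (commonShift k j)) volume :=
      hψ.integrable_mul (memLp_schwartzTensor (fderiv_commonShift_mem j hf))
    have i2 : Integrable (fun p => ψ p * (b p * f p)) volume := by
      have h2 : Integrable (fun p => ψ p * f p) volume :=
        hψ.integrable_mul (memLp_schwartzTensor hf)
      have h3 : Integrable (fun p => ψ p * ((W p : ℂ) * f p)) volume :=
        hψ.integrable_mul (memLp_mul_of_le_momentumWeight hW.measurable hW.bound hf)
      refine ((h2.const_mul (c : ℂ)).sub (h3.const_mul Complex.I)).congr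
        (Eventually.of_forall fun p => ?_)
      simp only [Pi.sub_apply, b]
      ring
    rw [← add_eq_zero_iff_eq_neg, ← integral_add i1 i2, ← mul_zero (-Complex.I), ← h1,
      ← integral_const_mul]
    refine integral_congr_ae (Eventually.of_forall fun p => ?_)
    simp only [fderiv_commonShift_eq, b]
    linear_combination ((c : ℂ) * ψ p * f p) * Complex.I_sq

/-- Real functions `Θ` that have the derivative `Θ'` in the direction of the common shifts, up to
countably many exceptional points on every line. -/
structure IsPhaseFunction (j : Fin n) (Θ Θ' : (Fin k → Momentum n) → ℝ) : Prop where
  continuous : Continuous Θ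
  measurable : Measurable Θ'
  bound : ∃ C, ∀ p, |Θ' p| ≤ C * momentumWeight p
  hasDerivAt : ∀ p, ∃ S : Set ℝ, S.Countable ∧ ∀ s ∉ S,
    HasDerivAt (fun s : ℝ => Θ (p + s • commonShift k j)) (Θ' (p + s • commonShift k j)) s

/-- With the trivial phase, the integration by parts below is the symmetry of `i D` itself. -/
theorem isPhaseFunction_zero (j : Fin n) :
    IsPhaseFunction (k := k) j (fun _ => 0) (fun _ => 0) :=
  ⟨continuous_const, measurable_const, ⟨0, fun p => by simp⟩,
    fun p => ⟨∅, Set.countable_empty, fun s _ => hasDerivAt_const _ _⟩⟩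

theorem norm_cexp_I_mul (t : ℝ) : ‖Complex.exp (Complex.I * t)‖ = 1 := by
  rw [mul_comm, Complex.norm_exp_ofReal_mul_I]

/-- Integration by parts for `i D` in the presence of a phase factor. -/
theorem IsPhaseFunction.integral_conj_mul {j : Fin n} {Θ Θ' : (Fin k → Momentum n) → ℝ}
    (hΘ : IsPhaseFunction j Θ Θ') {f g : (Fin k → Momentum n) → ℂ}
    (hf : f ∈ schwartzTensor n k) (hg : g ∈ schwartzTensor n k) :
    ∫ p, (starRingEnd ℂ) (Complex.exp (Complex.I * Θ p) * f p) * -sectorDeriv j g p =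
      ∫ p, (starRingEnd ℂ) (Complex.exp (Complex.I * Θ p) *
        (-sectorDeriv j f p - Θ' p * f p)) * g p := by
  set e := commonShift k j
  have hdf := differentiable_schwartzTensor hf
  have hdg := differentiable_schwartzTensor hg
  have hmem : ∀ {a : (Fin k → Momentum n) → ℂ}, MemLp a 2 volume →
      MemLp (fun p => (starRingEnd ℂ) (Complex.exp (Complex.I * Θ p) * a p)) 2 volume := by
    intro a ha
    have hc := hΘ.continuous
    refine ha.of_le (Complex.continuous_conj.comp_aestronglyMeasurable
      ((by fun_prop : Continuous fun p => Complex.exp (Complex.I * Θ p)).aestronglyMeasurable.mul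
        ha.1)) (Eventually.of_forall fun p => ?_)
    simp
  have hDf := memLp_schwartzTensor (sectorDeriv_mem j hf)
  have hDg := memLp_schwartzTensor (sectorDeriv_mem j hg)
  have hWf := memLp_mul_of_le_momentumWeight hΘ.measurable hΘ.bound hf
  have i1 : Integrable (fun p => (starRingEnd ℂ) (Complex.exp (Complex.I * Θ p) * f p) *
      -sectorDeriv j g p) volume := (hmem (memLp_schwartzTensor hf)).integrable_mul hDg.neg
  have i2 : Integrable (fun p => (starRingEnd ℂ) (Complex.exp (Complex.I * Θ p) *
        (-sectorDeriv j f p - Θ' p * f p)) * g p) volume :=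
    (hmem (hDf.neg.sub hWf)).integrable_mul (memLp_schwartzTensor hg)
  have i3 : Integrable (fun p => (starRingEnd ℂ) (Complex.exp (Complex.I * Θ p) * f p) * g p)
      volume := (hmem (memLp_schwartzTensor hf)).integrable_mul (memLp_schwartzTensor hg)
  -- The chosen `h'` is the derivative of `h` by the product rule, rewritten with `D = -i (i D)` so
  -- that both sides of the claim appear in it. It may fail at the exceptional points of `Θ`.
  have key := integral_deriv_along_eq_zero (μ := volume) (h := fun p =>
      (starRingEnd ℂ) (Complex.exp (Complex.I * Θ p) * f p) * g p)
    (h' := fun p => -Complex.I * ((starRingEnd ℂ) (Complex.exp (Complex.I * Θ p) * f p) *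
      -sectorDeriv j g p - (starRingEnd ℂ) (Complex.exp (Complex.I * Θ p) *
        (-sectorDeriv j f p - Θ' p * f p)) * g p)) e i3 ((i1.sub i2).const_mul _) ?_ ?_
  · rw [integral_const_mul, integral_sub i1 i2] at key
    simpa [sub_eq_zero] using key
  · intro p
    have h1 := hΘ.continuous
    have h2 := hdf.continuous
    have h3 := hdg.continuous
    have h4 := Complex.continuous_conj
    fun_prop
  · intro p
    obtain ⟨S, hS, hS'⟩ := hΘ.hasDerivAt p
    refine ⟨S, hS, fun s hs => ?_⟩
    have d1 := ((((hS' s hs).ofReal_comp).const_mul Complex.I).cexp.mul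
      (hasDerivAt_along hdf p e s)).star.mul (hasDerivAt_along hdg p e s)
    refine d1.congr_deriv ?_
    simp only [e, fderiv_commonShift_eq, Complex.star_def, map_mul, map_sub, map_neg, map_add,
      Complex.conj_I, Complex.conj_ofReal, Pi.mul_apply]
    ring_nf

end TestClass

/-! ### Vectors of Fock space -/

section FockVectors

variable {n : ℕ}

theorem Fock.memLp_wave (Ψ : Fock n) (k : ℕ) : MemLp (Ψ.wave k) 2 volume :=
  Lp.memLp ((Ψ k : symmetricL2 n k) : NParticleL2 n k)

theorem Fock.wave_perm (Ψ : Fock n) (k : ℕ) (σ : Equiv.Perm (Fin k)) :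
    (fun p => Ψ.wave k (p ∘ σ)) =ᵐ[volume] Ψ.wave k :=
  (Ψ k).2 σ

theorem Fock.inner_eq_tsum (Ψ Φ : Fock n) :
    ⟪Ψ, Φ⟫_ℂ = ∑' k, ∫ p, (starRingEnd ℂ) (Ψ.wave k p) * Φ.wave k p := by
  rw [lp.inner_eq_tsum]
  refine tsum_congr fun k => ?_
  change ⟪((Ψ k : symmetricL2 n k) : NParticleL2 n k), ((Φ k : symmetricL2 n k) : NParticleL2 n k)⟫_ℂ
    = _
  rw [L2.inner_def]
  refine integral_congr_ae (Eventually.of_forall fun p => ?_)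
  simp only [RCLike.inner_apply]
  exact mul_comm _ _

theorem Fock.inner_eq_of_wave_eq_zero {Ψ Φ : Fock n} {k : ℕ}
    (h : ∀ l, l ≠ k → Φ.wave l =ᵐ[volume] 0) :
    ⟪Ψ, Φ⟫_ℂ = ∫ p, (starRingEnd ℂ) (Ψ.wave k p) * Φ.wave k p := by
  rw [Fock.inner_eq_tsum, tsum_eq_single k]
  intro l hl
  refine (integral_congr_ae ?_).trans (integral_zero _ _)
  filter_upwards [h l hl] with p hp
  rw [hp, Pi.zero_apply, mul_zero]

theorem Fock.wave_eq_zero_of_apply_eq_zero {Ψ : Fock n} {k : ℕ} (h : Ψ k = 0) :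
    Ψ.wave k =ᵐ[volume] 0 := by
  have : Ψ.wave k = (((0 : symmetricL2 n k) : NParticleL2 n k) : _ → ℂ) := by
    rw [← h]
    rfl
  rw [this]
  exact Lp.coeFn_zero ℂ 2 volume

/-- Symmetric square integrable functions, only finitely many of which do not vanish, are the
components of a vector of Fock space. -/
theorem exists_fock_wave (g : (k : ℕ) → (Fin k → Momentum n) → ℂ)
    (hg : ∀ k, MemLp (g k) 2 volume)
    (hs : ∀ k, ∀ σ : Equiv.Perm (Fin k), (fun p => g k (p ∘ σ)) =ᵐ[volume] g k)
    (K : ℕ) (hK : ∀ k, K ≤ k → g k =ᵐ[volume] 0) :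
    ∃ Ψ : Fock n, (∀ k, Ψ.wave k =ᵐ[volume] g k) ∧ ∀ k, K ≤ k → Ψ k = 0 := by
  have hsymm : ∀ k, (hg k).toLp _ ∈ symmetricL2 n k := fun k σ =>
    (ae_comp_perm σ (hg k).coeFn_toLp).trans ((hs k σ).trans (hg k).coeFn_toLp.symm)
  let φ : (k : ℕ) → symmetricL2 n k := fun k => ⟨(hg k).toLp _, hsymm k⟩
  have hφ0 : ∀ k, K ≤ k → φ k = 0 := fun k hk =>
    Subtype.ext (Lp.ext ((hg k).coeFn_toLp.trans ((hK k hk).trans (Lp.coeFn_zero ℂ 2 volume).symm)))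
  have hφ : Memℓp φ 2 := by
    refine memℓp_gen (summable_of_ne_finset_zero (s := Finset.range K) fun k hk => ?_)
    rw [hφ0 k (by simpa using hk)]
    simp
  exact ⟨⟨φ, hφ⟩, fun k => (hg k).coeFn_toLp, hφ0⟩

/-- Sum over all permutations of the variables. -/
def symmetrize {k : ℕ} (f : (Fin k → Momentum n) → ℂ) (p : Fin k → Momentum n) : ℂ :=
  ∑ σ : Equiv.Perm (Fin k), f (p ∘ σ)

theorem symmetrize_comp_perm {k : ℕ} (f : (Fin k → Momentum n) → ℂ) (τ : Equiv.Perm (Fin k))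
    (p : Fin k → Momentum n) : symmetrize f (p ∘ τ) = symmetrize f p := by
  unfold symmetrize
  rw [← Equiv.sum_comp (Equiv.mulLeft τ) fun σ : Equiv.Perm (Fin k) => f (p ∘ σ)]
  rfl

theorem symmetrize_mem_schwartzTensor {k : ℕ} {f : (Fin k → Momentum n) → ℂ}
    (hf : f ∈ schwartzTensor n k) : symmetrize f ∈ schwartzTensor n k := by
  have : symmetrize f = ∑ σ : Equiv.Perm (Fin k), fun p => f (p ∘ σ) := by
    funext p
    simp [symmetrize]
  rw [this]
  exact Submodule.sum_mem _ fun σ _ => comp_perm_mem_schwartzTensor hf σ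

theorem sectorDeriv_comp_perm {k : ℕ} (j : Fin n) {f : (Fin k → Momentum n) → ℂ}
    (hf : Differentiable ℝ f) (σ : Equiv.Perm (Fin k)) (p : Fin k → Momentum n) :
    sectorDeriv j (fun p => f (p ∘ σ)) p = sectorDeriv j f (p ∘ σ) := by
  let L : (Fin k → Momentum n) →L[ℝ] (Fin k → Momentum n) :=
    ContinuousLinearMap.pi fun i => ContinuousLinearMap.proj (σ i)
  have h1 : HasFDerivAt (f ∘ L) ((fderiv ℝ f (L p)).comp L) p :=
    (hf (L p)).hasFDerivAt.comp p L.hasFDerivAt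
  have e : (fun p : Fin k → Momentum n => f (p ∘ σ)) = f ∘ L := rfl
  rw [sectorDeriv_eq, sectorDeriv_eq, e, h1.fderiv]
  rfl

theorem sectorDeriv_symmetrize {k : ℕ} (j : Fin n) {f : (Fin k → Momentum n) → ℂ}
    (hf : f ∈ schwartzTensor n k) : sectorDeriv j (symmetrize f) = symmetrize (sectorDeriv j f) := by
  funext p
  have h : ∀ σ : Equiv.Perm (Fin k), Differentiable ℝ fun p : Fin k → Momentum n => f (p ∘ σ) :=
    fun σ => differentiable_schwartzTensor (comp_perm_mem_schwartzTensor hf σ)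
  have e : symmetrize f = fun p => ∑ σ : Equiv.Perm (Fin k), f (p ∘ σ) := rfl
  rw [sectorDeriv_eq, e, fderiv_fun_sum fun σ _ => (h σ) p]
  simp only [symmetrize, ← sectorDeriv_comp_perm j (differentiable_schwartzTensor hf),
    sectorDeriv_eq, Finset.mul_sum, _root_.sum_apply]

theorem measurableEmbedding_perm {k : ℕ} (σ : Equiv.Perm (Fin k)) :
    MeasurableEmbedding fun p : Fin k → Momentum n => p ∘ σ := by
  have hm : ∀ τ : Equiv.Perm (Fin k), Measurable fun p : Fin k → Momentum n => p ∘ τ := fun τ =>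
    (measurePreserving_perm τ).measurable
  exact (MeasurableEquiv.mk ⟨fun p : Fin k → Momentum n => p ∘ σ, fun p => p ∘ σ.symm,
    fun p => by funext i; simp, fun p => by funext i; simp⟩ (hm σ) (hm σ.symm)).measurableEmbedding

/-- Permutation invariance of the wave function makes all `k!` terms equal. As `k!` is nonzero,
orthogonality to symmetrised functions is orthogonality to arbitrary ones, so sector arguments can
use non-symmetric test functions. -/
theorem integral_conj_wave_mul_symmetrize (Ψ : Fock n) (k : ℕ) {G : (Fin k → Momentum n) → ℂ}
    (hG : MemLp G 2 volume) :
    ∫ p, (starRingEnd ℂ) (Ψ.wave k p) * symmetrize G p =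
      Fintype.card (Equiv.Perm (Fin k)) * ∫ p, (starRingEnd ℂ) (Ψ.wave k p) * G p := by
  have hΨ : MemLp (fun p => (starRingEnd ℂ) (Ψ.wave k p)) 2 volume := (Ψ.memLp_wave k).star
  have hint : ∀ σ : Equiv.Perm (Fin k),
      Integrable (fun p => (starRingEnd ℂ) (Ψ.wave k p) * G (p ∘ σ)) volume := fun σ =>
    hΨ.integrable_mul (hG.comp_measurePreserving (measurePreserving_perm σ))
  simp only [symmetrize, Finset.mul_sum]
  rw [integral_finsetSum _ fun σ _ => hint σ]
  rw [Finset.sum_congr rfl (g := fun _ => ∫ p, (starRingEnd ℂ) (Ψ.wave k p) * G p), Finset.sum_const,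
    Finset.card_univ, nsmul_eq_mul]
  intro σ _
  rw [← (measurePreserving_perm (n := n) σ).integral_comp (measurableEmbedding_perm σ)
    fun p => (starRingEnd ℂ) (Ψ.wave k p) * G p]
  refine integral_congr_ae ?_
  filter_upwards [Ψ.wave_perm k σ] with p hp
  rw [hp]

theorem exists_schwartzFock_symmetrize {k : ℕ} {f : (Fin k → Momentum n) → ℂ}
    (hf : f ∈ schwartzTensor n k) : ∃ Φ ∈ schwartzFock n, Φ.wave k =ᵐ[volume] symmetrize f ∧
      ∀ l, l ≠ k → Φ.wave l =ᵐ[volume] 0 := by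
  classical
  let g : (l : ℕ) → (Fin l → Momentum n) → ℂ := fun l =>
    if h : l = k then fun p => symmetrize f (h ▸ p) else 0
  have hgk : g k = symmetrize f := by simp [g]
  have hgl : ∀ l, l ≠ k → g l = 0 := fun l hl => by simp [g, hl]
  have hmem : ∀ l, g l ∈ schwartzTensor n l := by
    intro l
    by_cases h : l = k
    · subst h
      rw [hgk]
      exact symmetrize_mem_schwartzTensor hf
    · rw [hgl l h]
      exact Submodule.zero_mem _
  obtain ⟨Φ, hΦ, hΦ'⟩ := exists_fock_wave g (fun l => memLp_schwartzTensor (hmem l)) (fun l σ => by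
    by_cases h : l = k
    · subst h
      rw [hgk]
      exact Eventually.of_forall (symmetrize_comp_perm f σ)
    · rw [hgl l h]
      rfl) (k + 1) (fun l hl => by rw [hgl l (by omega)])
  refine ⟨Φ, ⟨⟨k + 1, hΦ'⟩, fun l => ⟨g l, hmem l, hΦ l⟩⟩, hgk ▸ hΦ k, fun l hl => hgl l hl ▸ hΦ l⟩

/-- A vector orthogonal to all symmetrised tensors placed in one sector is orthogonal there to all
of `𝓢(ℝⁿ)^{⊗k}`, which separates functions. -/
theorem dense_schwartzFock : Dense (schwartzFock n : Set (Fock n)) := by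
  rw [Submodule.dense_iff_topologicalClosure_eq_top, Submodule.topologicalClosure_eq_top_iff,
    Submodule.eq_bot_iff]
  intro Ψ hΨ
  refine Fock.ext_wave fun k => EventuallyEq.trans ?_ (Fock.wave_zero k).symm
  have hΨk : MemLp (fun p => (starRingEnd ℂ) (Ψ.wave k p)) 2 volume := (Ψ.memLp_wave k).star
  have h0 := ae_eq_zero_of_integral_schwartzTensor (u := fun p => (starRingEnd ℂ) (Ψ.wave k p))
    (fun f hf => (memLp_schwartzTensor hf).integrable_mul hΨk) fun f hf => by
      obtain ⟨Φ, hΦ, hΦk, hΦl⟩ := exists_schwartzFock_symmetrize hf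
      have h1 := (Submodule.mem_orthogonal' _ _).1 hΨ Φ hΦ
      rw [Fock.inner_eq_of_wave_eq_zero hΦl] at h1
      have h2 : ∫ p, (starRingEnd ℂ) (Ψ.wave k p) * symmetrize f p = 0 := by
        rw [← h1]
        refine integral_congr_ae ?_
        filter_upwards [hΦk] with p hp
        rw [hp]
      rw [integral_conj_wave_mul_symmetrize Ψ k (memLp_schwartzTensor hf)] at h2
      simp only [mul_comm (f _)]
      refine (mul_eq_zero.1 h2).resolve_left (by simp)
  filter_upwards [h0] with p hp
  simpa using hp

end FockVectors

/-! ### Essential self-adjointness of `i D + W` on Fock space -/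

section TransportOperators

variable {n : ℕ}

/-- Continuous functions that agree almost everywhere agree everywhere, so the smooth representative
is unique and exactly symmetric. -/
theorem schwartzFock_representative {Ψ : Fock n} (hΨ : Ψ ∈ schwartzFock n) (k : ℕ) :
    ∃ f ∈ schwartzTensor n k, Ψ.wave k =ᵐ[volume] f ∧
      ∀ (σ : Equiv.Perm (Fin k)) p, f (p ∘ σ) = f p := by
  obtain ⟨f, hf, hf'⟩ := hΨ.2 k
  refine ⟨f, hf, hf', fun σ => ?_⟩
  exact congrFun (schwartzTensor_eq_of_ae (comp_perm_mem_schwartzTensor hf σ) hf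
    ((ae_comp_perm σ hf').symm.trans ((Ψ.wave_perm k σ).trans hf')))

/-- `A` acts as `i D + W` on `𝓢(ℝⁿ)_⊗`. -/
structure IsTransportOperator (j : Fin n) (W : (k : ℕ) → (Fin k → Momentum n) → ℝ)
    (A : Fock n →ₗ.[ℂ] Fock n) : Prop where
  potential : ∀ k, IsTransportPotential j (W k)
  perm : ∀ k (σ : Equiv.Perm (Fin k)) p, W k (p ∘ σ) = W k p
  domain_eq : A.domain = schwartzFock n
  wave_apply : ∀ (x : A.domain) (k : ℕ), ∀ f ∈ schwartzTensor n k,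
    (x : Fock n).wave k =ᵐ[volume] f →
      (A x).wave k =ᵐ[volume] fun p => -sectorDeriv j f p + W k p * f p

variable {j : Fin n} {W : (k : ℕ) → (Fin k → Momentum n) → ℝ} {A : Fock n →ₗ.[ℂ] Fock n}

/-- Integration by parts without phase handles `i D`; multiplication by the real function `W` is
symmetric. -/
theorem IsTransportOperator.inner_apply (hA : IsTransportOperator j W A) (x y : A.domain) :
    ⟪A x, (y : Fock n)⟫_ℂ = ⟪(x : Fock n), A y⟫_ℂ := by
  rw [Fock.inner_eq_tsum, Fock.inner_eq_tsum]
  refine tsum_congr fun k => ?_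
  obtain ⟨f, hf, hxf, -⟩ := schwartzFock_representative (hA.domain_eq.le x.2) k
  obtain ⟨g, hg, hyg, -⟩ := schwartzFock_representative (hA.domain_eq.le y.2) k
  have hAx := hA.wave_apply x k f hf hxf
  have hAy := hA.wave_apply y k g hg hyg
  have h0 := (isPhaseFunction_zero j).integral_conj_mul hf hg
  simp only [Complex.ofReal_zero, mul_zero, Complex.exp_zero, one_mul, zero_mul, sub_zero] at h0
  have hWf := memLp_mul_of_le_momentumWeight (hA.potential k).measurable (hA.potential k).bound hf
  have hWg := memLp_mul_of_le_momentumWeight (hA.potential k).measurable (hA.potential k).bound hg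
  have hf2 := memLp_schwartzTensor hf
  have hg2 := memLp_schwartzTensor hg
  have hDf := (memLp_schwartzTensor (sectorDeriv_mem j hf)).neg
  have hDg := (memLp_schwartzTensor (sectorDeriv_mem j hg)).neg
  have i1 : Integrable (fun p => (starRingEnd ℂ) (-sectorDeriv j f p) * g p) volume :=
    hDf.star.integrable_mul hg2
  have i2 : Integrable (fun p => (starRingEnd ℂ) (W k p * f p) * g p) volume :=
    hWf.star.integrable_mul hg2
  have i3 : Integrable (fun p => (starRingEnd ℂ) (f p) * -sectorDeriv j g p) volume :=
    hf2.star.integrable_mul hDg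
  have i4 : Integrable (fun p => (starRingEnd ℂ) (f p) * (W k p * g p)) volume :=
    hf2.star.integrable_mul hWg
  calc ∫ p, (starRingEnd ℂ) ((A x).wave k p) * (y : Fock n).wave k p
      = ∫ p, ((starRingEnd ℂ) (-sectorDeriv j f p) * g p +
          (starRingEnd ℂ) (W k p * f p) * g p) := by
        refine integral_congr_ae ?_
        filter_upwards [hAx, hyg] with p h1 h2
        rw [h1, h2, map_add, add_mul]
    _ = ∫ p, ((starRingEnd ℂ) (f p) * -sectorDeriv j g p +
          (starRingEnd ℂ) (f p) * (W k p * g p)) := by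
        rw [integral_add i1 i2, integral_add i3 i4, h0]
        congr 1
        refine integral_congr_ae (Eventually.of_forall fun p => ?_)
        simp only [map_mul, Complex.conj_ofReal]
        ring
    _ = ∫ p, (starRingEnd ℂ) ((x : Fock n).wave k p) * (A y).wave k p := by
        refine integral_congr_ae ?_
        filter_upwards [hAy, hxf] with p h1 h2
        rw [h1, h2, mul_add]

/-- Testing with a symmetrised tensor in sector `k` isolates the component of `v` there. Both `D`
and the symmetric potential commute with symmetrisation, so the conjugate component annihilates `(i
D + W + ci) f` for every `f` in `𝓢(ℝⁿ)^{⊗k}`. -/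
theorem IsTransportOperator.eq_zero_of_orthogonal (hA : IsTransportOperator j W A) {c : ℝ}
    (hc : c ≠ 0) (v : Fock n)
    (hv : ∀ x : A.domain, ⟪v, A x + ((c : ℂ) * Complex.I) • (x : Fock n)⟫_ℂ = 0) : v = 0 := by
  refine Fock.ext_wave fun k => EventuallyEq.trans ?_ (Fock.wave_zero k).symm
  have hvk : MemLp (fun p => (starRingEnd ℂ) (v.wave k p)) 2 volume := (v.memLp_wave k).star
  have h0 := (hA.potential k).ae_eq_zero hvk hc fun f hf => by
    obtain ⟨Φ, hΦ, hΦk, hΦl⟩ := exists_schwartzFock_symmetrize hf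
    set x : A.domain := ⟨Φ, hA.domain_eq ▸ hΦ⟩
    have hAx := hA.wave_apply x k _ (symmetrize_mem_schwartzTensor hf) hΦk
    have hsum : ∀ l, (A x + ((c : ℂ) * Complex.I) • (x : Fock n)).wave l =ᵐ[volume]
        fun p => (A x).wave l p + (c : ℂ) * Complex.I * Φ.wave l p := by
      intro l
      filter_upwards [Fock.wave_add (A x) (((c : ℂ) * Complex.I) • (x : Fock n)) l,
        Fock.wave_smul ((c : ℂ) * Complex.I) (x : Fock n) l] with p h1 h2
      rw [h1, h2]
    have h1 := hv x
    rw [Fock.inner_eq_of_wave_eq_zero (k := k)] at h1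
    · have h2 : ∫ p, (starRingEnd ℂ) (v.wave k p) * symmetrize (fun p =>
          -sectorDeriv j f p + W k p * f p + c * Complex.I * f p) p = 0 := by
        rw [← h1]
        refine integral_congr_ae ?_
        filter_upwards [hsum k, hAx, hΦk] with p e1 e2 e3
        rw [e1, e2, e3, sectorDeriv_symmetrize j hf]
        simp only [symmetrize, hA.perm, Finset.sum_add_distrib, Finset.mul_sum,
          Finset.sum_neg_distrib]
      have hG : MemLp (fun p => -sectorDeriv j f p + W k p * f p + c * Complex.I * f p) 2
          volume :=
        ((memLp_schwartzTensor (sectorDeriv_mem j hf)).neg.add (memLp_mul_of_le_momentumWeight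
          (hA.potential k).measurable (hA.potential k).bound hf)).add
            ((memLp_schwartzTensor hf).const_mul _)
      rw [integral_conj_wave_mul_symmetrize v k hG] at h2
      exact (mul_eq_zero.1 h2).resolve_left (by simp)
    · intro l hl
      have h3 := hA.wave_apply x l 0 (Submodule.zero_mem _) (hΦl l hl)
      filter_upwards [hsum l, h3, hΦl l hl] with p e1 e2 e3
      rw [e1, e2, e3, sectorDeriv_zero]
      simp
  filter_upwards [h0] with p hp
  simpa using hp

theorem IsTransportOperator.isEssentiallySelfAdjoint (hA : IsTransportOperator j W A) :
    IsEssentiallySelfAdjoint A ∧ A.closure = A.adjoint := by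
  refine isEssentiallySelfAdjoint_of_symmetric (hA.domain_eq ▸ dense_schwartzFock) hA.inner_apply
    (fun v hv => hA.eq_zero_of_orthogonal one_ne_zero v fun x => ?_)
    (fun v hv => hA.eq_zero_of_orthogonal (neg_ne_zero.2 one_ne_zero) v fun x => ?_)
  · simpa using hv x
  · simpa [sub_eq_add_neg] using hv x

theorem isTransportOperator_coordinateOp (j : Fin n) :
    IsTransportOperator j (fun _ _ => 0) (coordinateOp j) where
  potential k := ⟨measurable_const, ⟨0, fun p => by simp⟩,
    fun p => ⟨∅, Set.countable_empty, fun s _ => continuousAt_const⟩⟩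
  perm _ _ _ := rfl
  domain_eq := coordinateLowerOp_domain j
  wave_apply x k f hf hxf := by
    have hx : ((x : Fock n), coordinateLowerOp j x) ∈ (coordinateLowerOp j).graph :=
      (coordinateLowerOp j).mem_graph x
    obtain ⟨-, h⟩ := (coordinateLowerOp_graph j _ _).1 hx
    obtain ⟨g, hg, hg1, hg2⟩ := h k
    obtain rfl : g = f := schwartzTensor_eq_of_ae hg hf (hg1.symm.trans hxf)
    have h1 : coordinateOp j x = (-1 : ℂ) • coordinateLowerOp j x := by
      rw [neg_one_smul]
      rfl
    rw [h1]
    filter_upwards [Fock.wave_smul (-1 : ℂ) (coordinateLowerOp j x) k, hg2] with p e1 e2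
    rw [e1, e2]
    simp

end TransportOperators

/-! ### Velocities and phases -/

section Velocity

variable {n k : ℕ}

/-- The values `∑ᵢ pᵢ^μ` of the momentum on `k`-particle functions. -/
def totalMomentum (p : Fin k → Momentum n) : Spacetime n := ∑ i, fourMomentum (p i)

/-- The values `∑ᵢ pᵢ^j / |pᵢ|` of the velocity on `k`-particle functions. -/
def totalVelocity (j : Fin n) (p : Fin k → Momentum n) : ℝ := ∑ i, p i j / ‖p i‖

theorem continuous_fourMomentum : Continuous (fourMomentum : Momentum n → Spacetime n) := by
  refine (PiLp.continuous_toLp 2 _).comp (continuous_pi fun μ => ?_)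
  refine Fin.cases ?_ (fun m => ?_) μ
  · exact continuous_norm
  · exact (EuclideanSpace.proj (𝕜 := ℝ) m).continuous

theorem continuous_totalMomentum :
    Continuous (totalMomentum : (Fin k → Momentum n) → Spacetime n) :=
  continuous_finsetSum _ fun i _ => continuous_fourMomentum.comp (continuous_apply i)

theorem totalMomentum_perm (σ : Equiv.Perm (Fin k)) (p : Fin k → Momentum n) :
    totalMomentum (p ∘ σ) = totalMomentum p :=
  Equiv.sum_comp σ fun i => fourMomentum (p i)

theorem norm_fourMomentum_le (p : Momentum n) : ‖fourMomentum p‖ ≤ 2 * ‖p‖ := by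
  have h : ‖fourMomentum p‖ ^ 2 = 2 * ‖p‖ ^ 2 := by
    rw [EuclideanSpace.norm_sq_eq, Fin.sum_univ_succ, EuclideanSpace.norm_sq_eq]
    simp only [fourMomentum, Fin.cons_zero, Fin.cons_succ, norm_norm]
    rw [EuclideanSpace.norm_sq_eq]
    ring
  refine le_of_sq_le_sq ?_ (by positivity)
  rw [h]
  nlinarith [sq_nonneg ‖p‖]

theorem norm_totalMomentum_le (p : Fin k → Momentum n) :
    ‖totalMomentum p‖ ≤ 2 * k * momentumWeight p := by
  calc ‖totalMomentum p‖ ≤ ∑ i, ‖fourMomentum (p i)‖ := norm_sum_le _ _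
    _ ≤ ∑ i, 2 * ‖p i‖ := Finset.sum_le_sum fun i _ => norm_fourMomentum_le _
    _ ≤ 2 * k * momentumWeight p := by
      rw [← Finset.mul_sum, mul_assoc]
      exact mul_le_mul_of_nonneg_left (sum_norm_le_momentumWeight p) zero_le_two

theorem measurable_totalVelocity (j : Fin n) :
    Measurable (totalVelocity j : (Fin k → Momentum n) → ℝ) := by
  unfold totalVelocity
  refine Finset.measurable_sum _ fun i _ => ?_
  have h1 : Measurable fun p : Fin k → Momentum n => p i j :=
    ((EuclideanSpace.proj (𝕜 := ℝ) j).continuous.comp (continuous_apply i)).measurable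
  exact h1.div (by fun_prop)

theorem abs_totalVelocity_le (j : Fin n) (p : Fin k → Momentum n) : |totalVelocity j p| ≤ k := by
  refine (Finset.abs_sum_le_sum_abs _ _).trans ?_
  refine (Finset.sum_le_card_nsmul _ _ 1 fun i _ => ?_).trans (by simp)
  rw [abs_div, abs_norm]
  exact div_le_one_of_le₀ (PiLp.norm_apply_le (p i) j) (norm_nonneg _)

theorem totalVelocity_perm (j : Fin n) (σ : Equiv.Perm (Fin k)) (p : Fin k → Momentum n) :
    totalVelocity j (p ∘ σ) = totalVelocity j p :=
  Equiv.sum_comp σ fun i => p i j / ‖p i‖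

/-- On a line in the direction of the common shift, the momenta vanish at finitely many points. -/
theorem countable_vanishing (j : Fin n) (p : Fin k → Momentum n) :
    {s : ℝ | ∃ i, (p + s • commonShift k j) i = 0}.Countable := by
  refine Set.Countable.mono (s₂ := Set.range fun i => -(p i j)) ?_ (Set.countable_range _)
  rintro s ⟨i, hi⟩
  refine ⟨i, ?_⟩
  have := congrArg (fun q : Momentum n => q j) hi
  simp [commonShift] at this
  linarith

theorem continuousAt_totalVelocity (j m : Fin n) (p : Fin k → Momentum n) {s : ℝ}
    (hs : s ∉ {s : ℝ | ∃ i, (p + s • commonShift k j) i = 0}) :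
    ContinuousAt (fun s : ℝ => totalVelocity m (p + s • commonShift k j)) s := by
  have hc : Continuous fun s : ℝ => p + s • commonShift k j := by fun_prop
  refine tendsto_finsetSum _ fun i _ => ?_
  have h1 : Continuous fun s : ℝ => (p + s • commonShift k j) i := (continuous_apply i).comp hc
  refine ((EuclideanSpace.proj (𝕜 := ℝ) m).continuous.comp h1).continuousAt.div
    h1.norm.continuousAt ?_
  simp only [Set.mem_ofPred_eq, not_exists] at hs
  exact norm_ne_zero_iff.2 (hs i)

theorem continuous_deform (θ : Matrix (Fin (n + 1)) (Fin (n + 1)) ℝ) :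
    Continuous (deform θ : Spacetime n → Spacetime n) := by
  unfold deform
  refine (PiLp.continuous_toLp 2 _).comp (continuous_pi fun μ => ?_)
  fun_prop

theorem deform_sum (θ : Matrix (Fin (n + 1)) (Fin (n + 1)) ℝ) (p : Fin k → Momentum n)
    (μ : Fin (n + 1)) :
    deform θ (totalMomentum p) μ = ∑ i, deform θ (fourMomentum (p i)) μ := by
  simp only [deform, totalMomentum]
  rw [Finset.sum_comm]
  refine Finset.sum_congr rfl fun ν _ => ?_
  rw [← Finset.mul_sum, ← Finset.mul_sum]
  simp

/-- The values of the potential `(θP)⁰ V^j - (θP)^j N`. -/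
def deformPotential (θ : Matrix (Fin (n + 1)) (Fin (n + 1)) ℝ) (j : Fin n) (k : ℕ)
    (p : Fin k → Momentum n) : ℝ :=
  deform θ (totalMomentum p) 0 * totalVelocity j p - deform θ (totalMomentum p) j.succ * k

theorem exists_abs_deform_le (θ : Matrix (Fin (n + 1)) (Fin (n + 1)) ℝ) :
    ∃ C, 0 ≤ C ∧ ∀ (x : Spacetime n) μ, |deform θ x μ| ≤ C * ‖x‖ := by
  refine ⟨∑ μ, ∑ ν, |θ μ ν|, by positivity, fun x μ => ?_⟩
  have hsign : ∀ ν : Fin (n + 1), |minkowskiSign ν| = 1 := fun ν =>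
    Fin.cases (by simp [minkowskiSign]) (fun m => by simp [minkowskiSign]) ν
  calc |deform θ x μ| ≤ ∑ ν, |θ μ ν * (minkowskiSign ν * x ν)| := by
        change |∑ ν, θ μ ν * (minkowskiSign ν * x ν)| ≤ _
        exact Finset.abs_sum_le_sum_abs _ _
    _ ≤ ∑ ν, |θ μ ν| * ‖x‖ := Finset.sum_le_sum fun ν _ => by
      rw [abs_mul, abs_mul, hsign, one_mul]
      exact mul_le_mul_of_nonneg_left (PiLp.norm_apply_le x ν) (abs_nonneg _)
    _ = (∑ ν, |θ μ ν|) * ‖x‖ := (Finset.sum_mul _ _ _).symm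
    _ ≤ (∑ μ, ∑ ν, |θ μ ν|) * ‖x‖ := by
      refine mul_le_mul_of_nonneg_right ?_ (norm_nonneg x)
      exact Finset.single_le_sum (f := fun μ => ∑ ν, |θ μ ν|) (fun μ _ => by positivity)
        (Finset.mem_univ μ)

/-- In the `k`-particle sector velocity and number are bounded by `k`, so the potential grows only
linearly in the momenta. On a line its discontinuities come from the velocity, at parameters where
some momentum vanishes. -/
theorem isTransportPotential_deformPotential (θ : Matrix (Fin (n + 1)) (Fin (n + 1)) ℝ)
    (j : Fin n) (k : ℕ) : IsTransportPotential j (deformPotential θ j k) := by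
  have hd : ∀ μ, Continuous fun p : Fin k → Momentum n => deform θ (totalMomentum p) μ := fun μ =>
    (EuclideanSpace.proj (𝕜 := ℝ) μ).continuous.comp
      ((continuous_deform θ).comp continuous_totalMomentum)
  refine ⟨?_, ?_, fun p => ⟨_, countable_vanishing j p, fun s hs => ?_⟩⟩
  · exact ((hd 0).measurable.mul (measurable_totalVelocity j)).sub
      ((hd j.succ).measurable.mul_const _)
  · obtain ⟨C, hC0, hC⟩ := exists_abs_deform_le θ
    refine ⟨2 * (C * (2 * k) * k), fun p => ?_⟩
    have h1 : ∀ μ, |deform θ (totalMomentum p) μ| ≤ C * (2 * k) * momentumWeight p := fun μ =>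
      (hC _ _).trans (by
        rw [mul_assoc]
        exact mul_le_mul_of_nonneg_left (norm_totalMomentum_le p) hC0)
    have h2 := abs_totalVelocity_le j p
    have h3 := momentumWeight_nonneg p
    calc |deformPotential θ j k p|
        ≤ |deform θ (totalMomentum p) 0 * totalVelocity j p| +
          |deform θ (totalMomentum p) j.succ * k| := abs_sub _ _
      _ ≤ C * (2 * k) * momentumWeight p * k + C * (2 * k) * momentumWeight p * k := by
        rw [abs_mul, abs_mul, Nat.abs_cast]
        gcongr
        · exact h1 0
        · exact h1 j.succ
      _ = _ := by ring
  · have hc : Continuous fun s : ℝ => p + s • commonShift k j := by fun_prop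
    exact (((hd 0).comp hc).continuousAt.mul (continuousAt_totalVelocity j j p hs)).sub
      (((hd j.succ).comp hc).continuousAt.mul continuousAt_const)

theorem deformPotential_perm (θ : Matrix (Fin (n + 1)) (Fin (n + 1)) ℝ) (j : Fin n) (k : ℕ)
    (σ : Equiv.Perm (Fin k)) (p : Fin k → Momentum n) :
    deformPotential θ j k (p ∘ σ) = deformPotential θ j k p := by
  simp only [deformPotential, totalMomentum_perm, totalVelocity_perm]

theorem minkowski_fourMomentum (z : Spacetime n) (q : Momentum n) :
    minkowski z (fourMomentum q) = z 0 * ‖q‖ - ∑ m, z m.succ * q m := by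
  rw [minkowski, Fin.sum_univ_succ]
  simp [minkowskiSign, fourMomentum, sub_eq_add_neg]

/-- This is the phase of `U(z)⁻¹`. Its directional derivative is minus the potential `z⁰ V^j - z^j
N` that conjugation adds to `X^j`. -/
theorem isPhaseFunction_translation (z : Spacetime n) (j : Fin n) (k : ℕ) :
    IsPhaseFunction (k := k) j (fun p => -∑ i, minkowski z (fourMomentum (p i)))
      (fun p => -(z 0 * totalVelocity j p - z j.succ * k)) := by
  refine ⟨?_, ?_, ?_, fun p => ⟨_, countable_vanishing j p, fun s hs => ?_⟩⟩
  · simp only [minkowski_fourMomentum]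
    fun_prop
  · exact (((measurable_totalVelocity j).const_mul _).sub_const _).neg
  · refine ⟨|z 0| * k + |z j.succ| * k, fun p => ?_⟩
    rw [abs_neg]
    refine (abs_sub _ _).trans ?_
    rw [abs_mul, abs_mul, Nat.abs_cast]
    have h2 := abs_totalVelocity_le j p
    refine le_trans ?_ (le_mul_of_one_le_right (by positivity) (one_le_momentumWeight p))
    gcongr
  · simp only [Set.mem_ofPred_eq, not_exists] at hs
    have h1 : ∀ i, HasDerivAt (fun s : ℝ => minkowski z (fourMomentum ((p + s • commonShift k j) i)))
        (z 0 * ((p + s • commonShift k j) i j / ‖(p + s • commonShift k j) i‖) - z j.succ) s := by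
      intro i
      simp only [minkowski_fourMomentum]
      set q : ℝ → Momentum n := fun s => (p + s • commonShift k j) i
      have hq : HasDerivAt q (EuclideanSpace.single j 1) s := by
        have h2 : HasDerivAt (fun s : ℝ => p i + s • (EuclideanSpace.single j 1 : Momentum n))
            (EuclideanSpace.single j 1) s := by
          simpa using ((hasDerivAt_id s).smul_const (EuclideanSpace.single j 1 : Momentum n)).const_add
            (p i)
        exact h2
      have hqm : ∀ m, HasDerivAt (fun s => q s m) ((EuclideanSpace.single j 1 : Momentum n) m) s :=
        fun m => (EuclideanSpace.proj (𝕜 := ℝ) m).hasFDerivAt.comp_hasDerivAt s hq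
      -- The norm is differentiated as the square root of its square, which requires `q s ≠ 0`; this
      -- is the source of the exceptional parameters.
      have hn : HasDerivAt (fun s => ‖q s‖) (q s j / ‖q s‖) s := by
        have h3 := hq.norm_sq.sqrt (pow_ne_zero 2 (norm_ne_zero_iff.2 (hs i)))
        simp only [Real.sqrt_sq (norm_nonneg _)] at h3
        refine h3.congr_deriv ?_
        rw [EuclideanSpace.inner_single_right]
        simp
        field_simp
      refine ((hn.const_mul (z 0)).sub (HasDerivAt.fun_sum fun m _ =>
        (hqm m).const_mul (z m.succ))).congr_deriv ?_
      simp [q]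
    refine (HasDerivAt.fun_sum fun i _ => h1 i).neg.congr_deriv ?_
    simp [totalVelocity, Finset.mul_sum, mul_comm]

end Velocity

/-! ### Partial Fourier transforms of cutoffs -/

section PartialFourier

open scoped FourierTransform

variable {V : Type*} [NormedAddCommGroup V] [InnerProductSpace ℝ V] [FiniteDimensional ℝ V]
  [MeasurableSpace V] [BorelSpace V]

/-- The Fourier transform of a Schwartz function in its second variable. -/
def partialFourier (χ : 𝓢(V × V, ℂ)) (u s : V) : ℂ := 𝓕 (fun y => χ (u, y)) s

theorem contDiff_slice (χ : 𝓢(V × V, ℂ)) (u : V) : ContDiff ℝ (⊤ : ℕ∞) fun y => χ (u, y) :=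
  χ.smooth'.comp (contDiff_prodMk_right u)

/-- Derivatives of a slice are derivatives of `χ` restricted along the inclusion `y ↦ (0, y)` of
norm at most one. The seminorms of `χ` therefore bound them uniformly in `u`. -/
theorem exists_decay_iteratedFDeriv_slice (χ : 𝓢(V × V, ℂ)) (r m : ℕ) :
    ∃ C, 0 ≤ C ∧ ∀ u y : V, ‖iteratedFDeriv ℝ m (fun y => χ (u, y)) y‖ ≤ C * ((1 + ‖y‖) ^ r)⁻¹ := by
  refine ⟨2 ^ r * (Finset.Iic (r, m)).sup (fun m => SchwartzMap.seminorm ℝ m.1 m.2) χ,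
    by positivity, fun u y => ?_⟩
  have h1 := SchwartzMap.one_add_le_sup_seminorm_apply (𝕜 := ℝ) (m := (r, m)) le_rfl le_rfl χ (u, y)
  have h2 : ‖iteratedFDeriv ℝ m (fun y => χ (u, y)) y‖ ≤ ‖iteratedFDeriv ℝ m χ (u, y)‖ := by
    set L : V →L[ℝ] V × V := ContinuousLinearMap.inr ℝ V V
    have e : (fun y => χ (u, y)) = (fun z => χ ((u, 0) + z)) ∘ L := by
      funext y
      simp [L]
    have hc : ContDiff ℝ (⊤ : ℕ∞) fun z => χ ((u, 0) + z) :=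
      χ.smooth'.comp (contDiff_const.add contDiff_id)
    rw [e, L.iteratedFDeriv_comp_right hc y (by exact_mod_cast le_top),
      iteratedFDeriv_comp_add_left]
    refine (ContinuousMultilinearMap.norm_compContinuousLinearMap_le _ _).trans ?_
    have h3 : ((u, 0) : V × V) + L y = (u, y) := by simp [L]
    rw [h3]
    refine mul_le_of_le_one_right (norm_nonneg _) (Finset.prod_le_one (fun _ _ => norm_nonneg _)
      fun _ _ => ContinuousLinearMap.norm_inr_le_one ℝ V V)
  have h3 : (1 + ‖y‖) ^ r ≤ (1 + ‖((u, y) : V × V)‖) ^ r := by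
    gcongr
    exact norm_snd_le (u, y)
  rw [← div_eq_mul_inv, le_div_iff₀ (by positivity), mul_comm]
  exact (mul_le_mul h3 h2 (norm_nonneg _) (by positivity)).trans h1

theorem integrable_inv_one_add_norm_pow {r : ℕ} (hr : Module.finrank ℝ V < r) :
    Integrable (fun y : V => ((1 + ‖y‖) ^ r)⁻¹) volume := by
  have := integrable_one_add_norm (E := V) (μ := volume) (r := r) (by exact_mod_cast hr)
  refine this.congr (Eventually.of_forall fun y => ?_)
  simp only
  rw [Real.rpow_neg (by positivity), Real.rpow_natCast]

/-- Powers of `s` become derivatives in `y`, whose `L¹` norms are bounded uniformly in `u`. This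
uniformity is essential, because `u` depends on both `ε` and `s` in the oscillatory integrals. -/
theorem exists_decay_partialFourier (χ : 𝓢(V × V, ℂ)) (N : ℕ) :
    ∃ C, 0 ≤ C ∧ ∀ u s : V, (1 + ‖s‖) ^ N * ‖partialFourier χ u s‖ ≤ C := by
  have hmain : ∀ M : ℕ, ∃ C, 0 ≤ C ∧ ∀ u s : V, ‖s‖ ^ M * ‖partialFourier χ u s‖ ≤ C := by
    intro M
    choose C hC0 hC using exists_decay_iteratedFDeriv_slice χ (Module.finrank ℝ V + 1)
    have hI := integrable_inv_one_add_norm_pow (V := V) (Nat.lt_succ_self (Module.finrank ℝ V))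
    have hint : ∀ u m, Integrable (fun y => ‖iteratedFDeriv ℝ m (fun y => χ (u, y)) y‖) volume := by
      intro u m
      refine (hI.const_mul (C m)).mono' ?_ (Eventually.of_forall fun y => by
        rw [norm_norm]
        exact hC m u y)
      exact ((contDiff_slice χ u).continuous_iteratedFDeriv
        (by exact_mod_cast le_top)).norm.aestronglyMeasurable
    refine ⟨2 ^ M * ∑ p ∈ Finset.range 1 ×ˢ Finset.range (M + 1),
      C p.2 * ∫ y : V, ((1 + ‖y‖) ^ (Module.finrank ℝ V + 1))⁻¹, ?_, fun u s => ?_⟩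
    · refine mul_nonneg (by positivity) (Finset.sum_nonneg fun p _ => mul_nonneg (hC0 _) ?_)
      exact integral_nonneg fun y => by positivity
    · have h1 := Real.pow_mul_norm_iteratedFDeriv_fourier_le (K := 0) (N := ⊤)
        (f := fun y => χ (u, y)) (contDiff_slice χ u) (fun k m hk _ => by
          obtain rfl : k = 0 := by simpa using hk
          simpa using hint u m) (k := 0) (n := M) le_rfl le_top s
      simp only [norm_iteratedFDeriv_zero, pow_zero, one_mul, CharP.cast_eq_zero, mul_zero,
        zero_add] at h1
      refine h1.trans (mul_le_mul_of_nonneg_left (Finset.sum_le_sum fun p hp => ?_)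
        (by positivity))
      have hp0 : p.1 = 0 := by simpa using (Finset.mem_product.1 hp).1
      rw [← integral_const_mul]
      simp only [hp0, pow_zero, one_mul]
      exact integral_mono (hint u p.2) (hI.const_mul _) fun y => hC p.2 u y
  obtain ⟨C0, h00, h0⟩ := hmain 0
  obtain ⟨C1, h10, h1⟩ := hmain N
  refine ⟨2 ^ N * (C0 + C1), by positivity, fun u s => ?_⟩
  have h2 : (1 + ‖s‖) ^ N ≤ 2 ^ N * (1 + ‖s‖ ^ N) := by
    rcases le_total 1 ‖s‖ with h | h
    · calc (1 + ‖s‖) ^ N ≤ (2 * ‖s‖) ^ N := by gcongr; linarith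
        _ = 2 ^ N * ‖s‖ ^ N := mul_pow _ _ _
        _ ≤ _ := by gcongr; linarith
    · calc (1 + ‖s‖) ^ N ≤ 2 ^ N := by gcongr; linarith
        _ ≤ _ := le_mul_of_one_le_right (by positivity) (by simp)
  calc (1 + ‖s‖) ^ N * ‖partialFourier χ u s‖
      ≤ 2 ^ N * (1 + ‖s‖ ^ N) * ‖partialFourier χ u s‖ := by gcongr
    _ = 2 ^ N * (‖s‖ ^ 0 * ‖partialFourier χ u s‖ + ‖s‖ ^ N * ‖partialFourier χ u s‖) := by ring
    _ ≤ _ := by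
      gcongr
      · exact h0 u s
      · exact h1 u s

theorem continuous_partialFourier (χ : 𝓢(V × V, ℂ)) :
    Continuous fun q : V × V => partialFourier χ q.1 q.2 := by
  obtain ⟨C, -, hC⟩ := exists_decay_iteratedFDeriv_slice χ (Module.finrank ℝ V + 1) 0
  have hI := integrable_inv_one_add_norm_pow (V := V) (Nat.lt_succ_self (Module.finrank ℝ V))
  simp only [partialFourier, Real.fourier_eq']
  have hχ := χ.continuous
  refine continuous_of_dominated (fun q => ?_) (fun q => Eventually.of_forall fun y => ?_)
    (hI.const_mul C) (Eventually.of_forall fun y => by fun_prop)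
  · exact (by fun_prop : Continuous _).aestronglyMeasurable
  · have := hC q.1 y
    rw [norm_iteratedFDeriv_zero] at this
    rw [norm_smul, Complex.norm_exp_ofReal_mul_I, one_mul]
    exact this

/-- Fourier inversion for the slice, evaluated at the origin. -/
theorem integral_partialFourier (χ : 𝓢(V × V, ℂ)) (u : V) :
    ∫ s, partialFourier χ u s = χ (u, 0) := by
  have hI := integrable_inv_one_add_norm_pow (V := V) (Nat.lt_succ_self (Module.finrank ℝ V))
  have hχ := χ.continuous
  have h1 : Integrable (fun y => χ (u, y)) volume := by
    obtain ⟨C, -, hC⟩ := exists_decay_iteratedFDeriv_slice χ (Module.finrank ℝ V + 1) 0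
    refine (hI.const_mul C).mono' (by fun_prop) (Eventually.of_forall fun y => ?_)
    simpa [norm_iteratedFDeriv_zero] using hC u y
  have h2 : Integrable (𝓕 (fun y => χ (u, y))) volume := by
    obtain ⟨C, -, hC⟩ := exists_decay_partialFourier χ (Module.finrank ℝ V + 1)
    refine (hI.const_mul C).mono' ?_ (Eventually.of_forall fun s => ?_)
    · exact ((continuous_partialFourier χ).comp (by fun_prop : Continuous fun s : V => (u, s))).aestronglyMeasurable
    · rw [← div_eq_mul_inv, le_div_iff₀ (by positivity), mul_comm]
      exact hC u s
  have h3 := congrFun ((by fun_prop : Continuous fun y => χ (u, y)).fourierInv_fourier_eq h1 h2) 0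
  rw [Real.fourierInv_eq'] at h3
  simpa [partialFourier] using h3

end PartialFourier

/-! ### Regularised oscillatory integrals -/

section Oscillatory

variable {V : Type*} [NormedAddCommGroup V] [InnerProductSpace ℝ V] [FiniteDimensional ℝ V]
  [MeasurableSpace V] [BorelSpace V]

theorem integrable_cutoff_mul (χ : 𝓢(V × V, ℂ)) {ε : ℝ} (hε : 0 < ε) :
    Integrable (fun z : V × V => (1 + ‖z‖) * ‖χ (ε • z)‖) volume := by
  have : (volume : Measure (V × V)).IsAddHaarMeasure :=
    inferInstanceAs ((volume : Measure V).prod (volume : Measure V)).IsAddHaarMeasure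
  have h1 : Integrable (fun z : V × V => (1 + ‖z‖) * ‖χ z‖) volume := by
    refine ((χ.integrable_pow_mul volume 0).add (χ.integrable_pow_mul volume 1)).congr
      (Eventually.of_forall fun z => ?_)
    simp only [Pi.add_apply]
    ring
  -- The constant comes from `1 + ‖z‖ ≤ (1 + ε⁻¹) (1 + ε ‖z‖)`.
  have h2 := (h1.comp_smul hε.ne').const_mul (1 + ε⁻¹)
  have hχ := χ.continuous
  refine h2.mono' (by fun_prop) (Eventually.of_forall fun z => ?_)
  rw [Real.norm_of_nonneg (by positivity), ← mul_assoc]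
  refine mul_le_mul_of_nonneg_right ?_ (norm_nonneg _)
  rw [norm_smul, Real.norm_of_nonneg hε.le]
  have h3 : ε⁻¹ * (ε * ‖z‖) = ‖z‖ := by field_simp
  have h4 : 0 ≤ ε * ‖z‖ := by positivity
  have h5 : 0 ≤ ε⁻¹ := by positivity
  nlinarith

theorem integrable_cutoff_mul_of_le (χ : 𝓢(V × V, ℂ)) {ε : ℝ} (hε : 0 < ε) {ℓ : V → ℝ}
    (hℓ : Continuous ℓ) (hℓb : ∃ C, ∀ x, |ℓ x| ≤ C * (1 + ‖x‖)) :
    Integrable (fun z : V × V => χ (ε • z) * ℓ z.1) volume := by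
  obtain ⟨C, hC⟩ := hℓb
  have hχ := χ.continuous
  refine ((integrable_cutoff_mul χ hε).const_mul C).mono' (by fun_prop)
    (Eventually.of_forall fun z => ?_)
  rw [norm_mul, Complex.norm_real, Real.norm_eq_abs, mul_comm, ← mul_assoc]
  refine mul_le_mul_of_nonneg_right ((hC z.1).trans ?_) (norm_nonneg _)
  have hC0 : 0 ≤ C := by simpa using (abs_nonneg _).trans (hC 0)
  gcongr
  exact norm_fst_le z

/-- The symbol of the regularised oscillatory integral with the amplitude `ℓ`, with respect to
the bilinear form `⟪G x, y⟫`. -/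
def oscillatorySymbol (G : V ≃ₗᵢ[ℝ] V) (χ : 𝓢(V × V, ℂ)) (ℓ : V → ℝ) (ε : ℝ) (q : V) : ℂ :=
  ((((2 * Real.pi) ^ Module.finrank ℝ V)⁻¹ : ℝ) : ℂ) *
    ∫ z : V × V, χ (ε • z) * Complex.exp (-(Complex.I * (⟪G z.1, z.2⟫_ℝ : ℂ))) * ℓ z.1 *
      Complex.exp (Complex.I * (⟪G q, z.2⟫_ℝ : ℂ))

/-- Substituting `t = ε y` leaves a Fourier transform in `t` with phase `-ε⁻¹ ⟪G (x - q), t⟫`. The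
factor `2π` in the frequency is the normalisation of the Fourier transform. -/
theorem integral_slice_eq (G : V ≃ₗᵢ[ℝ] V) (χ : 𝓢(V × V, ℂ)) {ε : ℝ} (hε : 0 < ε) (q x : V) :
    ∫ y : V, χ (ε • (x, y)) * Complex.exp (-(Complex.I * (⟪G x, y⟫_ℝ : ℂ))) *
      Complex.exp (Complex.I * (⟪G q, y⟫_ℝ : ℂ)) =
    ((ε ^ Module.finrank ℝ V)⁻¹ : ℝ) * partialFourier χ (ε • x)
      ((2 * Real.pi * ε)⁻¹ • G (x - q)) := by
  have h := Measure.integral_comp_smul (volume : Measure V) (fun t : V => χ (ε • x, t) *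
    Complex.exp (-(Complex.I * ((ε⁻¹ * ⟪G (x - q), t⟫_ℝ : ℝ) : ℂ)))) ε
  rw [abs_of_nonneg (by positivity), Complex.real_smul] at h
  have hπ := Real.pi_pos.ne'
  have e1 : partialFourier χ (ε • x) ((2 * Real.pi * ε)⁻¹ • G (x - q)) = ∫ t : V, χ (ε • x, t) *
      Complex.exp (-(Complex.I * ((ε⁻¹ * ⟪G (x - q), t⟫_ℝ : ℝ) : ℂ))) := by
    rw [partialFourier, Real.fourier_eq']
    refine integral_congr_ae (Eventually.of_forall fun t => ?_)
    simp only [smul_eq_mul]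
    rw [mul_comm, inner_smul_right, real_inner_comm]
    congr 2
    have : -2 * Real.pi * ((2 * Real.pi * ε)⁻¹ * ⟪G (x - q), t⟫_ℝ) =
        -(ε⁻¹ * ⟪G (x - q), t⟫_ℝ) := by field_simp
    rw [this]
    push_cast
    ring
  rw [e1, ← h]
  refine integral_congr_ae (Eventually.of_forall fun y => ?_)
  simp only [Prod.smul_mk]
  rw [mul_assoc, ← Complex.exp_add, inner_smul_right, map_sub, inner_sub_left]
  congr 2
  have : ε⁻¹ * (ε * (⟪G x, y⟫_ℝ - ⟪G q, y⟫_ℝ)) = ⟪G x, y⟫_ℝ - ⟪G q, y⟫_ℝ := by field_simp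
  rw [this]
  push_cast
  ring

/-- The transform from the `y`-integral concentrates near `x = q` at scale `ε`. Writing `x = q + 2πε
G⁻¹ s` removes every negative power of `ε`, and the limit can be taken under the integral. -/
theorem oscillatorySymbol_eq (G : V ≃ₗᵢ[ℝ] V) (χ : 𝓢(V × V, ℂ)) {ℓ : V → ℝ}
    (hℓ : Continuous ℓ) (hℓb : ∃ C, ∀ x, |ℓ x| ≤ C * (1 + ‖x‖)) {ε : ℝ} (hε : 0 < ε) (q : V) :
    oscillatorySymbol G χ ℓ ε q = ∫ s : V, partialFourier χ
      (ε • (q + (2 * Real.pi * ε) • G.symm s)) s * ℓ (q + (2 * Real.pi * ε) • G.symm s) := by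
  have hint : Integrable (fun z : V × V => χ (ε • z) *
      Complex.exp (-(Complex.I * (⟪G z.1, z.2⟫_ℝ : ℂ))) * ℓ z.1 *
      Complex.exp (Complex.I * (⟪G q, z.2⟫_ℝ : ℂ))) (volume.prod volume) := by
    have h1 := integrable_cutoff_mul_of_le χ hε hℓ hℓb
    have hχ := χ.continuous
    refine h1.mono (by fun_prop) (Eventually.of_forall fun z => ?_)
    rw [← mul_neg, ← Complex.ofReal_neg]
    simp only [norm_mul, norm_cexp_I_mul, mul_one]
    exact le_rfl
  set d := Module.finrank ℝ V
  set H : V → ℂ := fun x => ((ε ^ d)⁻¹ : ℝ) * (partialFourier χ (ε • x)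
      ((2 * Real.pi * ε)⁻¹ • G (x - q)) * ℓ x) with hH
  have e1 : ∫ z : V × V, χ (ε • z) * Complex.exp (-(Complex.I * (⟪G z.1, z.2⟫_ℝ : ℂ))) * ℓ z.1 *
      Complex.exp (Complex.I * (⟪G q, z.2⟫_ℝ : ℂ)) = ∫ x, H x := by
    rw [Measure.volume_eq_prod, integral_prod _ hint]
    refine integral_congr_ae (Eventually.of_forall fun x => ?_)
    simp only [hH]
    rw [← mul_assoc, ← integral_slice_eq G χ hε q x, ← integral_mul_const]
    refine integral_congr_ae (Eventually.of_forall fun y => ?_)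
    simp only
    ring
  have e2 : ∫ x, H x = ((2 * Real.pi * ε) ^ d : ℝ) *
      ∫ s : V, H (q + (2 * Real.pi * ε) • G.symm s) := by
    have h1 : ∫ s : V, H (q + (2 * Real.pi * ε) • G.symm s) =
        ∫ s : V, H (q + (2 * Real.pi * ε) • s) :=
      G.symm.measurePreserving.integral_comp G.symm.toHomeomorph.measurableEmbedding
        (fun s => H (q + (2 * Real.pi * ε) • s))
    rw [h1, Measure.integral_comp_smul (volume : Measure V) (fun x => H (q + x)),
      integral_add_left_eq_self H q, Complex.real_smul, ← mul_assoc, ← Complex.ofReal_mul,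
      abs_of_nonneg (by positivity), mul_inv_cancel₀ (by positivity), Complex.ofReal_one, one_mul]
  rw [oscillatorySymbol, e1, e2, ← mul_assoc, ← Complex.ofReal_mul, ← integral_const_mul]
  refine integral_congr_ae (Eventually.of_forall fun s => ?_)
  have hc : 2 * Real.pi * ε ≠ 0 := by positivity
  simp only [hH, add_sub_cancel_left, map_smul, LinearIsometryEquiv.apply_symm_apply, smul_smul,
    inv_mul_cancel₀ hc, one_smul]
  rw [← mul_assoc, ← Complex.ofReal_mul]
  -- The normalisation of the warped convolution, the Jacobian of `x ↦ s` and the factor from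
  -- `integral_slice_eq` cancel exactly.
  have : ((2 * Real.pi) ^ d)⁻¹ * (2 * Real.pi * ε) ^ d * (ε ^ d)⁻¹ = 1 := by
    rw [mul_pow _ ε]
    field_simp
  rw [this, Complex.ofReal_one, one_mul]

theorem exists_bound_oscillatory (G : V ≃ₗᵢ[ℝ] V) (χ : 𝓢(V × V, ℂ)) {ℓ : V → ℝ}
    (hℓb : ∃ C, ∀ x, |ℓ x| ≤ C * (1 + ‖x‖)) :
    ∃ C, 0 ≤ C ∧ ∀ ε ∈ Set.Ioc (0 : ℝ) 1, ∀ q s : V, ‖partialFourier χ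
      (ε • (q + (2 * Real.pi * ε) • G.symm s)) s * ℓ (q + (2 * Real.pi * ε) • G.symm s)‖ ≤
        C * (1 + ‖q‖) * ((1 + ‖s‖) ^ (Module.finrank ℝ V + 1))⁻¹ := by
  -- One power of `1 + ‖s‖` pays for the linear growth of `ℓ`; the remaining `d + 1` make the bound
  -- integrable in dimension `d`.
  obtain ⟨C, hC0, hC⟩ := exists_decay_partialFourier χ (Module.finrank ℝ V + 2)
  obtain ⟨L, hL⟩ := hℓb
  have hL0 : 0 ≤ L := by simpa using (abs_nonneg _).trans (hL 0)
  have hπ := Real.pi_pos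
  refine ⟨C * L * (1 + 2 * Real.pi), by positivity, fun ε hε q s => ?_⟩
  set x := q + (2 * Real.pi * ε) • G.symm s
  have h1 : 1 + ‖x‖ ≤ (1 + 2 * Real.pi) * (1 + ‖q‖) * (1 + ‖s‖) := by
    have h2 : ‖x‖ ≤ ‖q‖ + 2 * Real.pi * ‖s‖ := by
      refine (norm_add_le _ _).trans ?_
      rw [norm_smul, LinearIsometryEquiv.norm_map, Real.norm_of_nonneg
        (mul_nonneg (by positivity) hε.1.le)]
      have := mul_le_mul_of_nonneg_left hε.2 (by positivity : 0 ≤ 2 * Real.pi * ‖s‖)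
      linarith
    have h3 := norm_nonneg q
    have h4 := norm_nonneg s
    nlinarith [mul_nonneg h3 h4, mul_nonneg hπ.le h3, mul_nonneg hπ.le (mul_nonneg h3 h4)]
  have h5 : ‖partialFourier χ (ε • x) s‖ ≤ C * ((1 + ‖s‖) ^ (Module.finrank ℝ V + 2))⁻¹ := by
    rw [← div_eq_mul_inv, le_div_iff₀ (by positivity), mul_comm]
    exact hC _ _
  rw [norm_mul, Complex.norm_real, Real.norm_eq_abs]
  calc ‖partialFourier χ (ε • x) s‖ * |ℓ x|
      ≤ C * ((1 + ‖s‖) ^ (Module.finrank ℝ V + 2))⁻¹ *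
        (L * ((1 + 2 * Real.pi) * (1 + ‖q‖) * (1 + ‖s‖))) := by
        gcongr
        exact (hL x).trans (mul_le_mul_of_nonneg_left h1 hL0)
    _ = _ := by
        field_simp
        ring

theorem exists_norm_oscillatorySymbol_le (G : V ≃ₗᵢ[ℝ] V) (χ : 𝓢(V × V, ℂ)) {ℓ : V → ℝ}
    (hℓ : Continuous ℓ) (hℓb : ∃ C, ∀ x, |ℓ x| ≤ C * (1 + ‖x‖)) :
    ∃ C, 0 ≤ C ∧ ∀ ε ∈ Set.Ioc (0 : ℝ) 1, ∀ q, ‖oscillatorySymbol G χ ℓ ε q‖ ≤ C * (1 + ‖q‖) := by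
  obtain ⟨C, hC0, hC⟩ := exists_bound_oscillatory G χ hℓb
  have hI := integrable_inv_one_add_norm_pow (V := V) (Nat.lt_succ_self (Module.finrank ℝ V))
  refine ⟨C * ∫ y : V, ((1 + ‖y‖) ^ (Module.finrank ℝ V + 1))⁻¹,
    mul_nonneg hC0 (integral_nonneg fun y => by positivity), fun ε hε q => ?_⟩
  rw [oscillatorySymbol_eq G χ hℓ hℓb hε.1]
  refine (norm_integral_le_of_norm_le (hI.const_mul (C * (1 + ‖q‖)))
    (Eventually.of_forall (hC ε hε q))).trans_eq ?_
  rw [integral_const_mul, mul_right_comm]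

/-- At `ε = 0` the integrand is `partialFourier χ 0 s * ℓ q`, with integral `χ(0, 0) ℓ(q)`. Only the
value of the cutoff at the origin survives, so the limit does not depend on `χ`. -/
theorem tendsto_oscillatorySymbol (G : V ≃ₗᵢ[ℝ] V) (χ : 𝓢(V × V, ℂ)) (hχ : χ 0 = 1) {ℓ : V → ℝ}
    (hℓ : Continuous ℓ) (hℓb : ∃ C, ∀ x, |ℓ x| ≤ C * (1 + ‖x‖)) (q : V) :
    Tendsto (fun ε => oscillatorySymbol G χ ℓ ε q) (𝓝[>] 0) (𝓝 (ℓ q : ℂ)) := by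
  obtain ⟨C, hC0, hC⟩ := exists_bound_oscillatory G χ hℓb
  have hI := integrable_inv_one_add_norm_pow (V := V) (Nat.lt_succ_self (Module.finrank ℝ V))
  have hK := continuous_partialFourier χ
  have hcont : Continuous fun w : ℝ × V => partialFourier χ
      (w.1 • (q + (2 * Real.pi * w.1) • G.symm w.2)) w.2 *
        (ℓ (q + (2 * Real.pi * w.1) • G.symm w.2) : ℂ) := by
    have h1 : Continuous fun w : ℝ × V => q + (2 * Real.pi * w.1) • G.symm w.2 :=
      continuous_const.add ((continuous_const.mul continuous_fst).smul
        (G.symm.continuous.comp continuous_snd))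
    exact (hK.comp ((continuous_fst.smul h1).prodMk continuous_snd)).mul
      (Complex.continuous_ofReal.comp (hℓ.comp h1))
  have h01 : ∀ᶠ ε : ℝ in 𝓝[>] 0, ε ∈ Set.Ioc (0 : ℝ) 1 := Ioc_mem_nhdsGT zero_lt_one
  have hlim : ∫ s : V, partialFourier χ ((0 : ℝ) • (q + (2 * Real.pi * 0) • G.symm s)) s *
      (ℓ (q + (2 * Real.pi * 0) • G.symm s) : ℂ) = ℓ q := by
    simp only [zero_smul, mul_zero, add_zero]
    rw [integral_mul_const, integral_partialFourier]
    change χ 0 * _ = _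
    rw [hχ, one_mul]
  rw [← hlim]
  refine Tendsto.congr' (f₁ := fun ε : ℝ => ∫ s : V, partialFourier χ
      (ε • (q + (2 * Real.pi * ε) • G.symm s)) s * ℓ (q + (2 * Real.pi * ε) • G.symm s)) ?_ ?_
  · filter_upwards [self_mem_nhdsWithin] with ε hε
    exact (oscillatorySymbol_eq G χ hℓ hℓb hε q).symm
  · refine tendsto_integral_filter_of_dominated_convergence
      (fun s => C * (1 + ‖q‖) * ((1 + ‖s‖) ^ (Module.finrank ℝ V + 1))⁻¹) ?_ ?_
      (hI.const_mul _) (Eventually.of_forall fun s => ?_)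
    · exact Eventually.of_forall fun ε =>
        (hcont.comp (by fun_prop : Continuous fun s : V => (ε, s))).aestronglyMeasurable
    · filter_upwards [h01] with ε hε
      exact Eventually.of_forall (hC ε hε q)
    · have := (hcont.comp (by fun_prop : Continuous fun ε : ℝ => (ε, s))).tendsto 0
      exact this.mono_left nhdsWithin_le_nhds

end Oscillatory

/-! ### Oscillatory integrals on Fock space -/

section FockOscillatory

variable {n : ℕ}

theorem Fock.inner_eq_sum (Ψ : Fock n) {Φ : Fock n} {K : ℕ} (hK : ∀ k, K ≤ k → Φ k = 0) :
    ⟪Ψ, Φ⟫_ℂ = ∑ k ∈ Finset.range K, ∫ p, (starRingEnd ℂ) (Ψ.wave k p) * Φ.wave k p := by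
  rw [Fock.inner_eq_tsum]
  refine tsum_eq_sum fun k hk => ?_
  refine (integral_congr_ae ?_).trans (integral_zero _ _)
  filter_upwards [Fock.wave_eq_zero_of_apply_eq_zero (hK k (by simpa using hk))] with p hp
  rw [hp, Pi.zero_apply, mul_zero]

theorem Fock.norm_sq_eq_sum {Φ : Fock n} {K : ℕ} (hK : ∀ k, K ≤ k → Φ k = 0) :
    ‖Φ‖ ^ 2 = ∑ k ∈ Finset.range K, ∫ p, ‖Φ.wave k p‖ ^ 2 := by
  rw [← inner_self_eq_norm_sq (𝕜 := ℂ), Fock.inner_eq_sum Φ hK, map_sum]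
  refine Finset.sum_congr rfl fun k _ => ?_
  have : ∀ p, (starRingEnd ℂ) (Φ.wave k p) * Φ.wave k p = ((‖Φ.wave k p‖ ^ 2 : ℝ) : ℂ) := by
    intro p
    rw [mul_comm, Complex.mul_conj, Complex.normSq_eq_norm_sq]
  simp only [this]
  rw [integral_complex_ofReal]
  simp

/-- Dominated convergence in Fock space. -/
theorem Fock.tendsto_of_dominated {ι : Type*} {l : Filter ι} [l.IsCountablyGenerated]
    {Φ : ι → Fock n} {Ψ : Fock n} {K : ℕ} (hΦ : ∀ᶠ i in l, ∀ k, K ≤ k → Φ i k = 0)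
    (hΨ : ∀ k, K ≤ k → Ψ k = 0) (f : ι → (k : ℕ) → (Fin k → Momentum n) → ℂ)
    (hf : ∀ᶠ i in l, ∀ k, (Φ i).wave k =ᵐ[volume] f i k)
    (g : (k : ℕ) → (Fin k → Momentum n) → ℝ) (hg : ∀ k, MemLp (g k) 2 volume)
    (hfg : ∀ k, ∀ᶠ i in l, ∀ᵐ p, ‖f i k p‖ ≤ g k p) (hΨg : ∀ k, ∀ᵐ p, ‖Ψ.wave k p‖ ≤ g k p)
    (hlim : ∀ k, ∀ᵐ p, Tendsto (fun i => f i k p) l (𝓝 (Ψ.wave k p))) :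
    Tendsto Φ l (𝓝 Ψ) := by
  rw [tendsto_iff_norm_sub_tendsto_zero]
  have hsq : Tendsto (fun i => ‖Φ i - Ψ‖ ^ 2) l (𝓝 0) := by
    have h1 : Tendsto (fun i => ∑ k ∈ Finset.range K, ∫ p, ‖f i k p - Ψ.wave k p‖ ^ 2) l
        (𝓝 (∑ k ∈ Finset.range K, ∫ p : Fin k → Momentum n, (0 : ℝ))) := by
      refine tendsto_finsetSum _ fun k _ => ?_
      have hgi : Integrable (fun p => (2 * g k p) ^ 2) volume := by
        have h2 := ((memLp_two_iff_integrable_sq_norm (hg k).1).1 (hg k)).const_mul 4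
        refine h2.congr (Eventually.of_forall fun p => ?_)
        simp only [Real.norm_eq_abs, sq_abs]
        ring
      refine tendsto_integral_filter_of_dominated_convergence (fun p => (2 * g k p) ^ 2) ?_ ?_ hgi ?_
      · filter_upwards [hf] with i hi
        have h3 : AEStronglyMeasurable (fun p => f i k p) volume :=
          ((Φ i).memLp_wave k).1.congr (hi k)
        exact (h3.sub (Ψ.memLp_wave k).1).norm.pow 2
      · filter_upwards [hfg k] with i hi
        filter_upwards [hi, hΨg k] with p h4 h5
        rw [norm_pow, norm_norm]
        refine pow_le_pow_left₀ (norm_nonneg _) ((norm_sub_le _ _).trans ?_) 2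
        linarith
      · filter_upwards [hlim k] with p hp
        have := ((hp.sub_const (Ψ.wave k p)).norm).pow 2
        simpa using this
    simp only [integral_zero, Finset.sum_const_zero] at h1
    refine h1.congr' ?_
    filter_upwards [hΦ, hf] with i hi hi'
    rw [Fock.norm_sq_eq_sum (K := K) (Φ := Φ i - Ψ) fun k hk => by
      rw [lp.coeFn_sub, Pi.sub_apply, hi k hk, hΨ k hk, sub_zero]]
    refine Finset.sum_congr rfl fun k _ => integral_congr_ae ?_
    have hsub : (Φ i - Ψ).wave k =ᵐ[volume] fun p => (Φ i).wave k p - Ψ.wave k p :=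
      Lp.coeFn_sub ((Φ i k : symmetricL2 n k) : NParticleL2 n k) (Ψ k : symmetricL2 n k)
    filter_upwards [hsub, hi' k] with p h6 h7
    rw [h6, h7]
  have := (Real.continuous_sqrt.tendsto 0).comp hsq
  simpa [Function.comp_def, Real.sqrt_sq (norm_nonneg _)] using this

/-- The reflection of the spatial coordinates. -/
def spatialReflection (n : ℕ) : Spacetime n ≃ₗᵢ[ℝ] Spacetime n :=
  LinearIsometryEquiv.piLpCongrRight 2 fun μ : Fin (n + 1) =>
    if μ = 0 then LinearIsometryEquiv.refl ℝ ℝ else LinearIsometryEquiv.neg ℝ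

/-- This reduces the Minkowski phase to a Euclidean one twisted by an isometry, so the preceding
Fourier analysis applies with no extra Jacobian. -/
theorem minkowski_eq_inner (x y : Spacetime n) :
    minkowski x y = ⟪spatialReflection n x, y⟫_ℝ := by
  rw [PiLp.inner_apply, minkowski]
  refine Finset.sum_congr rfl fun μ _ => ?_
  refine Fin.cases ?_ (fun m => ?_) μ
  · simp [spatialReflection, minkowskiSign, mul_comm]
  · simp [spatialReflection, minkowskiSign, mul_comm, Fin.succ_ne_zero]

theorem minkowski_comm (x y : Spacetime n) : minkowski x y = minkowski y x :=
  Finset.sum_congr rfl fun μ _ => by ring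

theorem continuous_minkowski : Continuous fun q : Spacetime n × Spacetime n => minkowski q.1 q.2 := by
  simp only [minkowski_eq_inner]
  exact ((spatialReflection n).continuous.comp continuous_fst).inner continuous_snd

theorem sum_minkowski {k : ℕ} (y : Spacetime n) (p : Fin k → Momentum n) :
    ∑ i, minkowski y (fourMomentum (p i)) = minkowski y (totalMomentum p) := by
  simp only [minkowski_eq_inner, totalMomentum, inner_sum]

theorem wave_translationOp (y : Spacetime n) (Ψ : Fock n) (k : ℕ) :
    (translationOp y Ψ).wave k =ᵐ[volume]
      fun p => Complex.exp (Complex.I * minkowski y (totalMomentum p)) * Ψ.wave k p := by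
  refine (wave_phaseMap (measurable_translation y) Ψ k).trans (Eventually.of_forall fun p => ?_)
  simp only [phase, sum_minkowski]

theorem translationOp_apply_eq_zero (y : Spacetime n) {Ψ : Fock n} {k : ℕ} (h : Ψ k = 0) :
    translationOp y Ψ k = 0 := by
  refine Subtype.ext (Lp.ext ?_)
  filter_upwards [wave_translationOp y Ψ k, Fock.wave_eq_zero_of_apply_eq_zero h,
    Lp.coeFn_zero ℂ 2 (volume : Measure (Fin k → Momentum n))] with p h1 h2 h3
  refine h1.trans ?_
  rw [h2, Pi.zero_apply, mul_zero]
  exact h3.symm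

/-- Pointwise convergence of the phases and dominated convergence give strong continuity, which
provides the measurability needed for the Bochner integrals. -/
theorem continuous_translationOp_apply {Ψ : Fock n} {K : ℕ} (hK : ∀ k, K ≤ k → Ψ k = 0) :
    Continuous fun y : Spacetime n => translationOp y Ψ := by
  rw [continuous_iff_continuousAt]
  intro y
  refine Fock.tendsto_of_dominated (K := K)
    (Eventually.of_forall fun i k hk => translationOp_apply_eq_zero i (hK k hk))
    (fun k hk => translationOp_apply_eq_zero y (hK k hk))
    (fun i k p => Complex.exp (Complex.I * minkowski i (totalMomentum p)) * Ψ.wave k p)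
    (Eventually.of_forall fun i k => wave_translationOp i Ψ k)
    (fun k p => ‖Ψ.wave k p‖) (fun k => (Ψ.memLp_wave k).norm)
    (fun k => Eventually.of_forall fun i => Eventually.of_forall fun p => ?_)
    (fun k => ?_) fun k => ?_
  · rw [norm_mul, norm_cexp_I_mul, one_mul]
  · filter_upwards [wave_translationOp y Ψ k] with p hp
    rw [hp, norm_mul, norm_cexp_I_mul, one_mul]
  · filter_upwards [wave_translationOp y Ψ k] with p hp
    rw [hp]
    have hc : Continuous fun i : Spacetime n => minkowski i (totalMomentum p) :=
      continuous_minkowski.comp (continuous_id.prodMk continuous_const)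
    exact (by fun_prop : Continuous fun i : Spacetime n =>
      Complex.exp (Complex.I * minkowski i (totalMomentum p)) * Ψ.wave k p).tendsto y

theorem integrable_cutoff_smul_translationOp (χ : 𝓢(Spacetime n × Spacetime n, ℂ))
    {ℓ : Spacetime n → ℝ} (hℓ : Continuous ℓ) (hℓb : ∃ C, ∀ x, |ℓ x| ≤ C * (1 + ‖x‖))
    {Ξ : Fock n} {K : ℕ} (hK : ∀ k, K ≤ k → Ξ k = 0) {ε : ℝ} (hε : 0 < ε) :
    Integrable (fun z : Spacetime n × Spacetime n =>
      (χ (ε • z) * Complex.exp (-(Complex.I * (minkowski z.1 z.2 : ℂ))) * ℓ z.1) •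
        translationOp z.2 Ξ) volume := by
  have hχ := χ.continuous
  have hM : Continuous fun z : Spacetime n × Spacetime n => minkowski z.1 z.2 := continuous_minkowski
  have hT : Continuous fun z : Spacetime n × Spacetime n => translationOp z.2 Ξ :=
    (continuous_translationOp_apply hK).comp continuous_snd
  refine ((integrable_cutoff_mul_of_le χ hε hℓ hℓb).norm.mul_const ‖Ξ‖).mono'
    (Continuous.aestronglyMeasurable (by fun_prop)) (Eventually.of_forall fun z => ?_)
  rw [norm_smul, LinearIsometryEquiv.norm_map, ← mul_neg, ← Complex.ofReal_neg]
  simp only [norm_mul, norm_cexp_I_mul, mul_one]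
  exact le_rfl

theorem continuous_oscillatorySymbol_integrand (χ : 𝓢(Spacetime n × Spacetime n, ℂ))
    {ℓ : Spacetime n → ℝ} (hℓ : Continuous ℓ) (ε : ℝ) :
    Continuous fun w : Spacetime n × (Spacetime n × Spacetime n) =>
      χ (ε • w.2) * Complex.exp (-(Complex.I * (⟪spatialReflection n w.2.1, w.2.2⟫_ℝ : ℂ))) *
        ℓ w.2.1 * Complex.exp (Complex.I * (⟪spatialReflection n w.1, w.2.2⟫_ℝ : ℂ)) := by
  have hχ := χ.continuous
  have hG := (spatialReflection n).continuous
  fun_prop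

theorem measurable_oscillatorySymbol (χ : 𝓢(Spacetime n × Spacetime n, ℂ))
    {ℓ : Spacetime n → ℝ} (hℓ : Continuous ℓ) (ε : ℝ) :
    Measurable (oscillatorySymbol (spatialReflection n) χ ℓ ε) := by
  unfold oscillatorySymbol
  exact ((StronglyMeasurable.integral_prod_right'
    (continuous_oscillatorySymbol_integrand χ hℓ ε).stronglyMeasurable).measurable).const_mul _

/-- The regularised oscillatory integrals act as multiplication by their symbol. -/
theorem integral_cutoff_smul_translationOp_eq (χ : 𝓢(Spacetime n × Spacetime n, ℂ))
    {ℓ : Spacetime n → ℝ} (hℓ : Continuous ℓ) (hℓb : ∃ C, ∀ x, |ℓ x| ≤ C * (1 + ‖x‖))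
    {Ξ Ξ' : Fock n} {K : ℕ} (hK : ∀ k, K ≤ k → Ξ k = 0) (hK' : ∀ k, K ≤ k → Ξ' k = 0)
    {ε : ℝ} (hε : 0 < ε)
    (hΞ' : ∀ k, Ξ'.wave k =ᵐ[volume] fun p =>
      oscillatorySymbol (spatialReflection n) χ ℓ ε (totalMomentum p) * Ξ.wave k p) :
    (((2 * Real.pi) ^ (n + 1))⁻¹ : ℝ) • ∫ z : Spacetime n × Spacetime n,
      (χ (ε • z) * Complex.exp (-(Complex.I * (minkowski z.1 z.2 : ℂ))) * ℓ z.1) •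
        translationOp z.2 Ξ = Ξ' := by
  have hint := integrable_cutoff_smul_translationOp χ hℓ hℓb hK hε
  set a : Spacetime n × Spacetime n → ℂ := fun z =>
    χ (ε • z) * Complex.exp (-(Complex.I * (minkowski z.1 z.2 : ℂ))) * ℓ z.1 with ha
  have hai : Integrable a volume := by
    have hχ := χ.continuous
    have hM : Continuous fun z : Spacetime n × Spacetime n => minkowski z.1 z.2 :=
      continuous_minkowski
    refine (integrable_cutoff_mul_of_le χ hε hℓ hℓb).mono
      (Continuous.aestronglyMeasurable (by fun_prop)) (Eventually.of_forall fun z => ?_)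
    simp only [ha]
    rw [← mul_neg, ← Complex.ofReal_neg]
    simp only [norm_mul, norm_cexp_I_mul, mul_one]
    exact le_rfl
  -- The vector-valued integral is identified by pairing with an arbitrary `v`: Fubini in `(z, p)`
  -- then produces the scalar symbol at the total momentum.
  refine ext_inner_left ℂ fun v => ?_
  rw [RCLike.real_smul_eq_coe_smul (K := ℂ), inner_smul_right, ← integral_inner hint v]
  have hv : ∀ z : Spacetime n × Spacetime n, ⟪v, a z • translationOp z.2 Ξ⟫_ℂ =
      ∑ k ∈ Finset.range K, ∫ p, a z * ((starRingEnd ℂ) (v.wave k p) * Ξ.wave k p) *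
        Complex.exp (Complex.I * minkowski z.2 (totalMomentum p)) := by
    intro z
    rw [Fock.inner_eq_sum v (K := K) fun k hk => by
      rw [lp.coeFn_smul, Pi.smul_apply, translationOp_apply_eq_zero _ (hK k hk), smul_zero]]
    refine Finset.sum_congr rfl fun k _ => integral_congr_ae ?_
    filter_upwards [Fock.wave_smul (a z) (translationOp z.2 Ξ) k, wave_translationOp z.2 Ξ k]
      with p h1 h2
    rw [h1, h2]
    ring
  have hprod : ∀ k, Integrable (fun w : (Spacetime n × Spacetime n) × (Fin k → Momentum n) =>
      a w.1 * ((starRingEnd ℂ) (v.wave k w.2) * Ξ.wave k w.2) *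
        Complex.exp (Complex.I * minkowski w.1.2 (totalMomentum w.2))) (volume.prod volume) := by
    intro k
    have h1 : Integrable (fun p => (starRingEnd ℂ) (v.wave k p) * Ξ.wave k p) volume :=
      (v.memLp_wave k).star.integrable_mul (Ξ.memLp_wave k)
    have hM : Continuous fun w : (Spacetime n × Spacetime n) × (Fin k → Momentum n) =>
        minkowski w.1.2 (totalMomentum w.2) :=
      continuous_minkowski.comp ((continuous_snd.comp continuous_fst).prodMk
        (continuous_totalMomentum.comp continuous_snd))
    exact (hai.mul_prod h1).mul_bdd (c := 1) (Continuous.aestronglyMeasurable (by fun_prop))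
      (Eventually.of_forall fun w => (norm_cexp_I_mul _).le)
  rw [integral_congr_ae (Eventually.of_forall hv)]
  rw [integral_finsetSum _ fun k _ => (hprod k).integral_prod_left, Fock.inner_eq_sum v hK',
    Finset.mul_sum]
  refine Finset.sum_congr rfl fun k _ => ?_
  rw [integral_integral_swap (hprod k), ← integral_const_mul]
  refine integral_congr_ae ?_
  filter_upwards [hΞ' k] with p hp
  rw [hp, oscillatorySymbol, finrank_euclideanSpace_fin]
  have e : ∫ z : Spacetime n × Spacetime n, a z * ((starRingEnd ℂ) (v.wave k p) * Ξ.wave k p) *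
        Complex.exp (Complex.I * minkowski z.2 (totalMomentum p)) =
      ((starRingEnd ℂ) (v.wave k p) * Ξ.wave k p) * ∫ z : Spacetime n × Spacetime n,
        χ (ε • z) * Complex.exp (-(Complex.I * (⟪spatialReflection n z.1, z.2⟫_ℝ : ℂ))) * ℓ z.1 *
          Complex.exp (Complex.I * (⟪spatialReflection n (totalMomentum p), z.2⟫_ℝ : ℂ)) := by
    rw [← integral_const_mul]
    refine integral_congr_ae (Eventually.of_forall fun z => ?_)
    simp only [ha]
    rw [minkowski_comm z.2, minkowski_eq_inner, minkowski_eq_inner]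
    ring
  rw [e]
  simp only [RCLike.ofReal_eq_complex_ofReal]
  ring

/-- Removing the cutoff, the oscillatory integral with the amplitude `ℓ` becomes `ℓ(P)`. -/
theorem tendsto_integral_cutoff_smul_translationOp (χ : 𝓢(Spacetime n × Spacetime n, ℂ))
    (hχ : χ 0 = 1) {ℓ : Spacetime n → ℝ} (hℓ : Continuous ℓ)
    (hℓb : ∃ C, ∀ x, |ℓ x| ≤ C * (1 + ‖x‖)) {Ξ Ξ' : Fock n} {K : ℕ}
    (hK : ∀ k, K ≤ k → Ξ k = 0)
    (hw : ∀ k, MemLp (fun p => (momentumWeight p : ℂ) * Ξ.wave k p) 2 volume)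
    (hΞ' : ∀ k, Ξ'.wave k =ᵐ[volume] fun p => (ℓ (totalMomentum p) : ℂ) * Ξ.wave k p) :
    Tendsto (fun ε : ℝ => (((2 * Real.pi) ^ (n + 1))⁻¹ : ℝ) • ∫ z : Spacetime n × Spacetime n,
      (χ (ε • z) * Complex.exp (-(Complex.I * (minkowski z.1 z.2 : ℂ))) * ℓ z.1) •
        translationOp z.2 Ξ) (𝓝[>] 0) (𝓝 Ξ') := by
  have hzero : ∀ {Θ : Fock n} {m : (k : ℕ) → (Fin k → Momentum n) → ℂ},
      (∀ k, Θ.wave k =ᵐ[volume] fun p => m k p * Ξ.wave k p) → ∀ k, K ≤ k → Θ k = 0 := by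
    intro Θ m h k hk
    refine Subtype.ext (Lp.ext ?_)
    filter_upwards [h k, Fock.wave_eq_zero_of_apply_eq_zero (hK k hk),
      Lp.coeFn_zero ℂ 2 (volume : Measure (Fin k → Momentum n))] with p h1 h2 h3
    refine h1.trans ?_
    rw [h2, Pi.zero_apply, mul_zero]
    exact h3.symm
  have hP : ∀ {k} (p : Fin k → Momentum n), 1 + ‖totalMomentum p‖ ≤
      (1 + 2 * k) * momentumWeight p := fun p => by
    have h1 := norm_totalMomentum_le p
    have h2 := one_le_momentumWeight p
    linarith
  obtain ⟨C, hC0, hC⟩ := exists_norm_oscillatorySymbol_le (spatialReflection n) χ hℓ hℓb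
  obtain ⟨L, hL⟩ := hℓb
  have hL0 : 0 ≤ L := by simpa using (abs_nonneg _).trans (hL 0)
  set g : (k : ℕ) → (Fin k → Momentum n) → ℝ := fun k p =>
    (C + L) * (1 + 2 * k) * ‖(momentumWeight p : ℂ) * Ξ.wave k p‖
  have hgw : ∀ k (p : Fin k → Momentum n), ∀ c : ℂ, ‖c‖ ≤ (C + L) * (1 + ‖totalMomentum p‖) →
      ‖c * Ξ.wave k p‖ ≤ g k p := by
    intro k p c hc
    simp only [g]
    rw [norm_mul, norm_mul, Complex.norm_real, Real.norm_of_nonneg (momentumWeight_nonneg p),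
      ← mul_assoc]
    refine mul_le_mul_of_nonneg_right (hc.trans ?_) (norm_nonneg _)
    rw [mul_assoc]
    exact mul_le_mul_of_nonneg_left (hP p) (by positivity)
  have hgm : ∀ k, MemLp (g k) 2 volume := fun k => (hw k).norm.const_mul _
  have hsym : ∀ ε ∈ Set.Ioc (0 : ℝ) 1, ∀ {k} (p : Fin k → Momentum n),
      ‖oscillatorySymbol (spatialReflection n) χ ℓ ε (totalMomentum p) * Ξ.wave k p‖ ≤ g k p := by
    intro ε hε k p
    refine hgw k p _ ((hC ε hε _).trans ?_)
    gcongr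
    linarith
  have h01 : ∀ᶠ ε : ℝ in 𝓝[>] 0, ε ∈ Set.Ioc (0 : ℝ) 1 := Ioc_mem_nhdsGT zero_lt_one
  have hex : ∀ ε : ℝ, ∃ Θ : Fock n, ε ∈ Set.Ioc (0 : ℝ) 1 → ∀ k, Θ.wave k =ᵐ[volume] fun p =>
      oscillatorySymbol (spatialReflection n) χ ℓ ε (totalMomentum p) * Ξ.wave k p := by
    intro ε
    by_cases hε : ε ∈ Set.Ioc (0 : ℝ) 1
    · obtain ⟨Θ, hΘ, -⟩ := exists_fock_wave (fun k p =>
        oscillatorySymbol (spatialReflection n) χ ℓ ε (totalMomentum p) * Ξ.wave k p)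
        (fun k => (hgm k).mono' (((measurable_oscillatorySymbol χ hℓ ε).comp
            continuous_totalMomentum.measurable).aestronglyMeasurable.mul (Ξ.memLp_wave k).1)
          (Eventually.of_forall fun p => hsym ε hε p))
        (fun k σ => by
          filter_upwards [Ξ.wave_perm k σ] with p hp
          rw [totalMomentum_perm, hp])
        K (fun k hk => by
          filter_upwards [Fock.wave_eq_zero_of_apply_eq_zero (hK k hk)] with p hp
          rw [hp, Pi.zero_apply, mul_zero])
      exact ⟨Θ, fun _ => hΘ⟩
    · exact ⟨0, fun h => absurd h hε⟩
  choose Θ hΘ using hex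
  refine Tendsto.congr' (f₁ := Θ) ?_ ?_
  · filter_upwards [h01] with ε hε
    exact (integral_cutoff_smul_translationOp_eq χ hℓ ⟨L, hL⟩ hK (hzero (hΘ ε hε)) hε.1
      (hΘ ε hε)).symm
  · refine Fock.tendsto_of_dominated (K := K) ?_ (hzero hΞ') (fun ε k p =>
      oscillatorySymbol (spatialReflection n) χ ℓ ε (totalMomentum p) * Ξ.wave k p) ?_ g hgm ?_ ?_ ?_
    · filter_upwards [h01] with ε hε
      exact hzero (hΘ ε hε)
    · filter_upwards [h01] with ε hε
      exact hΘ ε hε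
    · intro k
      filter_upwards [h01] with ε hε
      exact Eventually.of_forall fun p => hsym ε hε p
    · intro k
      filter_upwards [hΞ' k] with p hp
      rw [hp]
      refine hgw k p _ ?_
      rw [Complex.norm_real, Real.norm_eq_abs]
      refine (hL _).trans ?_
      gcongr
      linarith
    · intro k
      filter_upwards [hΞ' k] with p hp
      rw [hp]
      exact (tendsto_oscillatorySymbol _ χ hχ hℓ ⟨L, hL⟩ _).mul_const _

end FockOscillatory

/-! ### The deformed coordinate operators -/

section Deformed

variable {n : ℕ}

theorem wave_translationOp_symm (z : Spacetime n) (Ψ : Fock n) (k : ℕ) :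
    ((translationOp z).symm Ψ).wave k =ᵐ[volume] fun p =>
      Complex.exp (Complex.I * ((-∑ i, minkowski z (fourMomentum (p i)) : ℝ) : ℂ)) *
        Ψ.wave k p := by
  refine (wave_phaseMap (measurable_translation z).neg Ψ k).trans (Eventually.of_forall fun p => ?_)
  simp only [phase, Pi.neg_apply, Finset.sum_neg_distrib]

/-- Vectors of `𝓢(ℝⁿ)_⊗` can be multiplied by symmetric functions of polynomial growth. -/
theorem exists_fock_mul {Φ : Fock n} (hΦ : Φ ∈ schwartzFock n)
    {m : (k : ℕ) → (Fin k → Momentum n) → ℝ} (hm : ∀ k, Measurable (m k))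
    (hb : ∀ k, ∃ C, ∀ p, |m k p| ≤ C * momentumWeight p)
    (hs : ∀ k (σ : Equiv.Perm (Fin k)) p, m k (p ∘ σ) = m k p) :
    ∃ Ξ : Fock n, (∀ k, Ξ.wave k =ᵐ[volume] fun p => (m k p : ℂ) * Φ.wave k p) ∧
      ∀ k, Φ k = 0 → Ξ k = 0 := by
  obtain ⟨K, hK⟩ := hΦ.1
  have hmem : ∀ k, MemLp (fun p => (m k p : ℂ) * Φ.wave k p) 2 volume := by
    intro k
    obtain ⟨f, hf, hf', -⟩ := schwartzFock_representative hΦ k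
    refine (memLp_congr_ae ?_).2 (memLp_mul_of_le_momentumWeight (hm k) (hb k) hf)
    filter_upwards [hf'] with p hp
    rw [hp]
  have hzero : ∀ k, Φ k = 0 → (fun p => (m k p : ℂ) * Φ.wave k p) =ᵐ[volume] 0 := by
    intro k hk
    filter_upwards [Fock.wave_eq_zero_of_apply_eq_zero hk] with p hp
    rw [hp, Pi.zero_apply, mul_zero]
  obtain ⟨Ξ, hΞ, -⟩ := exists_fock_wave (fun k p => (m k p : ℂ) * Φ.wave k p) hmem
    (fun k σ => by
      filter_upwards [Φ.wave_perm k σ] with p hp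
      rw [hp, hs]) K fun k hk => hzero k (hK k hk)
  exact ⟨Ξ, hΞ, fun k hk => Subtype.ext (Lp.ext ((hΞ k).trans ((hzero k hk).trans
    (Lp.coeFn_zero ℂ 2 volume).symm)))⟩

/-- `U(z) X^j U(z)⁻¹ = X^j + z⁰ V^j - z^j N` on `𝓢(ℝⁿ)_⊗`. -/
theorem exists_conjugateOp_coordinateOp (j : Fin n) (z : Spacetime n)
    (x : (coordinateOp j).domain) {ΞV ΞN : Fock n}
    (hV : ∀ k, ΞV.wave k =ᵐ[volume] fun p => (totalVelocity j p : ℂ) * (x : Fock n).wave k p)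
    (hN : ∀ k, ΞN.wave k =ᵐ[volume] fun p => ((k : ℝ) : ℂ) * (x : Fock n).wave k p) :
    ∃ h : (x : Fock n) ∈ (conjugateOp (translationOp z) (coordinateOp j).closure).domain,
      conjugateOp (translationOp z) (coordinateOp j).closure ⟨x, h⟩ =
        coordinateOp j x + (z 0 : ℂ) • ΞV - (z j.succ : ℂ) • ΞN := by
  have hX := isTransportOperator_coordinateOp j
  have hD : Dense ((coordinateOp j).domain : Set (Fock n)) := hX.domain_eq ▸ dense_schwartzFock
  set U := translationOp z
  set Ξ : Fock n := coordinateOp j x + (z 0 : ℂ) • ΞV - (z j.succ : ℂ) • ΞN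
  -- `U(z)⁻¹ x` is in general not smooth where a momentum vanishes, so it cannot simply be inserted
  -- into `X^j`. The closure of `X^j` equals its adjoint, and the adjoint relation is the
  -- integration by parts with the phase of `U(z)⁻¹`.
  have hgraph : (U.symm (x : Fock n), U.symm Ξ) ∈ (coordinateOp j).closure.graph := by
    rw [hX.isEssentiallySelfAdjoint.2, mem_graph_adjoint_iff hD]
    intro y
    rw [Fock.inner_eq_tsum, Fock.inner_eq_tsum]
    refine tsum_congr fun k => ?_
    obtain ⟨f, hf, hxf, -⟩ := schwartzFock_representative (hX.domain_eq.le x.2) k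
    obtain ⟨g, hg, hyg, -⟩ := schwartzFock_representative (hX.domain_eq.le y.2) k
    have hsub : Ξ.wave k =ᵐ[volume] fun p =>
        (coordinateOp j x + (z 0 : ℂ) • ΞV).wave k p - ((z j.succ : ℂ) • ΞN).wave k p :=
      Lp.coeFn_sub (((coordinateOp j x + (z 0 : ℂ) • ΞV) k : symmetricL2 n k) : NParticleL2 n k)
        (((z j.succ : ℂ) • ΞN) k : symmetricL2 n k)
    refine Eq.trans ?_ (((isPhaseFunction_translation z j k).integral_conj_mul hf hg).trans ?_)
    · refine integral_congr_ae ?_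
      filter_upwards [wave_translationOp_symm z (x : Fock n) k, hxf, hX.wave_apply y k g hg hyg]
        with p h1 h2 h3
      rw [h1, h2, h3]
      simp
    · refine integral_congr_ae ?_
      filter_upwards [wave_translationOp_symm z Ξ k, hxf, hyg, hX.wave_apply x k f hf hxf, hsub,
        Fock.wave_add (coordinateOp j x) ((z 0 : ℂ) • ΞV) k, Fock.wave_smul (z 0 : ℂ) ΞV k,
        Fock.wave_smul (z j.succ : ℂ) ΞN k, hV k, hN k] with p h1 h2 h3 h4 h5 h6 h7 h8 h9 h10
      rw [h1, h3, h5, h6, h7, h8, h9, h10, h4, h2]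
      congr 3
      push_cast
      ring
  obtain ⟨y, hy, hy'⟩ := (LinearPMap.mem_graph_iff _).1 hgraph
  simp only at hy hy'
  have h : (x : Fock n) ∈ (conjugateOp U (coordinateOp j).closure).domain := by
    change U.symm (x : Fock n) ∈ (coordinateOp j).closure.domain
    rw [← hy]
    exact y.2
  refine ⟨h, ?_⟩
  change U ((coordinateOp j).closure ⟨U.symm x, h⟩) = Ξ
  have e : (⟨U.symm (x : Fock n), h⟩ : (coordinateOp j).closure.domain) = y := Subtype.ext hy.symm
  rw [e, hy', LinearIsometryEquiv.apply_symm_apply]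

/-- The warped convolution of the closure of `X^j` on `𝓢(ℝⁿ)_⊗`. -/
theorem exists_isWarpedConvolution_coordinateOp (θ : Matrix (Fin (n + 1)) (Fin (n + 1)) ℝ)
    (j : Fin n) {Φ : Fock n} (hΦ : Φ ∈ schwartzFock n) :
    ∃ Ψ, IsWarpedConvolution translationOp θ (coordinateOp j).closure Φ Ψ ∧
      ∀ k, ∀ f ∈ schwartzTensor n k, Φ.wave k =ᵐ[volume] f →
        Ψ.wave k =ᵐ[volume] fun p => -sectorDeriv j f p + deformPotential θ j k p * f p := by
  have hX := isTransportOperator_coordinateOp j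
  obtain ⟨K, hK⟩ := hΦ.1
  set x : (coordinateOp j).domain := ⟨Φ, hX.domain_eq.ge hΦ⟩
  have hd : ∀ {k} μ, Continuous fun p : Fin k → Momentum n => deform θ (totalMomentum p) μ :=
    fun μ => (EuclideanSpace.proj (𝕜 := ℝ) μ).continuous.comp
      ((continuous_deform θ).comp continuous_totalMomentum)
  have hℓ : ∀ μ, Continuous fun x : Spacetime n => deform θ x μ := fun μ =>
    (EuclideanSpace.proj (𝕜 := ℝ) μ).continuous.comp (continuous_deform θ)
  obtain ⟨C, hC0, hC⟩ := exists_abs_deform_le θ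
  have hℓb : ∀ μ, ∃ C, ∀ x : Spacetime n, |deform θ x μ| ≤ C * (1 + ‖x‖) := fun μ =>
    ⟨C, fun x => (hC x μ).trans (mul_le_mul_of_nonneg_left (by linarith) hC0)⟩
  have hdb : ∀ {k} μ (p : Fin k → Momentum n),
      |deform θ (totalMomentum p) μ| ≤ C * (2 * k) * momentumWeight p := fun μ p =>
    (hC _ _).trans (by
      rw [mul_assoc]
      exact mul_le_mul_of_nonneg_left (norm_totalMomentum_le p) hC0)
  have hw1 : ∀ {k} (p : Fin k → Momentum n), 1 ≤ momentumWeight p := one_le_momentumWeight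
  have hw0 : ∀ {k} (p : Fin k → Momentum n), 0 ≤ momentumWeight p := momentumWeight_nonneg
  obtain ⟨ΞV, hV, hV0⟩ := exists_fock_mul hΦ (m := fun _ => totalVelocity j)
    (fun k => measurable_totalVelocity j)
    (fun k => ⟨k, fun p => (abs_totalVelocity_le j p).trans
      (le_mul_of_one_le_right (Nat.cast_nonneg k) (hw1 p))⟩) fun k σ p => totalVelocity_perm j σ p
  obtain ⟨ΞN, hN, hN0⟩ := exists_fock_mul hΦ (m := fun k _ => k) (fun k => measurable_const)
    (fun k => ⟨k, fun p => by
      rw [Nat.abs_cast]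
      exact le_mul_of_one_le_right (Nat.cast_nonneg k) (hw1 p)⟩) fun k σ p => rfl
  obtain ⟨ΞV', hV', -⟩ := exists_fock_mul hΦ
    (m := fun _ p => deform θ (totalMomentum p) 0 * totalVelocity j p)
    (fun k => (hd 0).measurable.mul (measurable_totalVelocity j))
    (fun k => ⟨C * (2 * k) * k, fun p => by
      rw [abs_mul, mul_right_comm]
      have := hw0 p
      exact mul_le_mul (hdb 0 p) (abs_totalVelocity_le j p) (abs_nonneg _) (by positivity)⟩)
    fun k σ p => by simp only [totalMomentum_perm, totalVelocity_perm]
  obtain ⟨ΞN', hN', -⟩ := exists_fock_mul hΦ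
    (m := fun k p => deform θ (totalMomentum p) j.succ * k)
    (fun k => (hd j.succ).measurable.mul_const _)
    (fun k => ⟨C * (2 * k) * k, fun p => by
      rw [abs_mul, mul_right_comm, Nat.abs_cast]
      exact mul_le_mul_of_nonneg_right (hdb j.succ p) (Nat.cast_nonneg k)⟩)
    fun k σ p => by simp only [totalMomentum_perm]
  have h00 : ∀ k, Φ k = 0 → coordinateOp j x k = 0 := by
    intro k hk
    refine Subtype.ext (Lp.ext ?_)
    refine (hX.wave_apply x k 0 (Submodule.zero_mem _)
      (Fock.wave_eq_zero_of_apply_eq_zero hk)).trans ?_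
    refine EventuallyEq.trans ?_ (Lp.coeFn_zero ℂ 2 volume).symm
    refine Eventually.of_forall fun p => ?_
    simp [sectorDeriv_zero]
  have hwX : ∀ k, MemLp (fun p => (momentumWeight p : ℂ) * (coordinateOp j x).wave k p) 2
      volume := by
    intro k
    obtain ⟨f, hf, hf', -⟩ := schwartzFock_representative hΦ k
    refine (memLp_congr_ae ?_).2 (memLp_momentumWeight_mul
      (Submodule.neg_mem _ (sectorDeriv_mem j hf)))
    filter_upwards [hX.wave_apply x k f hf hf'] with p hp
    rw [hp]
    simp
  have hwm : ∀ {Ξ : Fock n} {m : (k : ℕ) → (Fin k → Momentum n) → ℝ} (_ : ∀ k, Measurable (m k))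
      (_ : ∀ k p, |m k p| ≤ k) (_ : ∀ k, Ξ.wave k =ᵐ[volume] fun p => (m k p : ℂ) * Φ.wave k p) k,
      MemLp (fun p => (momentumWeight p : ℂ) * Ξ.wave k p) 2 volume := by
    intro Ξ m hm hb h k
    obtain ⟨f, hf, hf', -⟩ := schwartzFock_representative hΦ k
    refine (memLp_congr_ae ?_).2 (memLp_mul_of_le_momentumWeight (W := fun p =>
      momentumWeight p * m k p) (continuous_momentumWeight.measurable.mul (hm k))
      ⟨k, fun p => ?_⟩ hf)
    · filter_upwards [h k, hf'] with p h1 h2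
      rw [h1, h2]
      push_cast
      ring
    · rw [abs_mul, abs_of_nonneg (hw0 p), mul_comm]
      exact mul_le_mul_of_nonneg_right (hb k p) (hw0 p)
  have hwV := hwm (fun k => measurable_totalVelocity j) (fun k => abs_totalVelocity_le j) hV
  have hwN := hwm (fun k => measurable_const) (fun k p => (Nat.abs_cast k).le) hN
  have hone : Continuous fun _ : Spacetime n => (1 : ℝ) := continuous_const
  have honeb : ∃ C, ∀ x : Spacetime n, |(1 : ℝ)| ≤ C * (1 + ‖x‖) :=
    ⟨1, fun x => by simp⟩
  have hconj := fun z => exists_conjugateOp_coordinateOp j z x hV hN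
  have hK0 : ∀ k, K ≤ k → coordinateOp j x k = 0 := fun k hk => h00 k (hK k hk)
  have hKV : ∀ k, K ≤ k → ΞV k = 0 := fun k hk => hV0 k (hK k hk)
  have hKN : ∀ k, K ≤ k → ΞN k = 0 := fun k hk => hN0 k (hK k hk)
  -- Conjugation splits the integrand into three oscillatory integrals, with amplitudes `1`, `(θx)⁰`
  -- and `(θx)^j` acting on `X^jΦ`, `V^jΦ` and `NΦ`. Their limits are the three terms of this
  -- vector.
  refine ⟨coordinateOp j x + ΞV' - ΞN', ⟨fun z => (hconj z).1, fun χ hχ => ?_⟩, ?_⟩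
  · have e : ∀ ε z, warpedIntegrand translationOp θ (coordinateOp j).closure Φ
        (fun z => (hconj z).1) χ ε z =
        (χ (ε • z) * Complex.exp (-(Complex.I * (minkowski z.1 z.2 : ℂ))) * ((1 : ℝ) : ℂ)) •
          translationOp z.2 (coordinateOp j x) +
        (χ (ε • z) * Complex.exp (-(Complex.I * (minkowski z.1 z.2 : ℂ))) * deform θ z.1 0) •
          translationOp z.2 ΞV -
        (χ (ε • z) * Complex.exp (-(Complex.I * (minkowski z.1 z.2 : ℂ))) *
          deform θ z.1 j.succ) • translationOp z.2 ΞN := by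
      intro ε z
      rw [warpedIntegrand, (hconj _).2, map_sub, map_add, LinearIsometryEquiv.map_smul,
        LinearIsometryEquiv.map_smul, smul_sub, smul_add, smul_smul, smul_smul, Complex.ofReal_one, mul_one]
    have i0 := fun {ε : ℝ} (hε : 0 < ε) => integrable_cutoff_smul_translationOp χ hone honeb hK0 hε
    have iV := fun {ε : ℝ} (hε : 0 < ε) =>
      integrable_cutoff_smul_translationOp χ (hℓ 0) (hℓb 0) hKV hε
    have iN := fun {ε : ℝ} (hε : 0 < ε) =>
      integrable_cutoff_smul_translationOp χ (hℓ j.succ) (hℓb j.succ) hKN hε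
    have t0 := tendsto_integral_cutoff_smul_translationOp χ hχ hone honeb hK0 hwX
      (Ξ' := coordinateOp j x) fun k => Eventually.of_forall fun p => by simp
    have tV := tendsto_integral_cutoff_smul_translationOp χ hχ (hℓ 0) (hℓb 0) hKV hwV
      (Ξ' := ΞV') fun k => by
        filter_upwards [hV k, hV' k] with p h1 h2
        rw [h1, h2]
        push_cast
        ring
    have tN := tendsto_integral_cutoff_smul_translationOp χ hχ (hℓ j.succ) (hℓb j.succ) hKN hwN
      (Ξ' := ΞN') fun k => by
        filter_upwards [hN k, hN' k] with p h1 h2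
        rw [h1, h2]
        push_cast
        ring
    refine ⟨fun ε hε => (((i0 hε).add (iV hε)).sub (iN hε)).congr
      (Eventually.of_forall fun z => (e ε z).symm), ((t0.add tV).sub tN).congr' ?_⟩
    filter_upwards [self_mem_nhdsWithin] with ε hε
    refine Eq.symm ((congrArg _ ((integral_congr_ae (Eventually.of_forall (e ε))).trans
      ((integral_sub ((i0 hε).add (iV hε)) (iN hε)).trans
        (congrArg (· - _) (integral_add (i0 hε) (iV hε)))))).trans ?_)
    exact (smul_sub (((2 * Real.pi) ^ (n + 1))⁻¹ : ℝ) _ _).trans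
      (congrArg (· - _) (smul_add (((2 * Real.pi) ^ (n + 1))⁻¹ : ℝ) _ _))
  · intro k f hf hf'
    have hsub : (coordinateOp j x + ΞV' - ΞN').wave k =ᵐ[volume] fun p =>
        (coordinateOp j x + ΞV').wave k p - ΞN'.wave k p :=
      Lp.coeFn_sub (((coordinateOp j x + ΞV') k : symmetricL2 n k) : NParticleL2 n k)
        (ΞN' k : symmetricL2 n k)
    filter_upwards [hsub, Fock.wave_add (coordinateOp j x) ΞV' k, hV' k, hN' k,
      hX.wave_apply x k f hf hf', hf'] with p h1 h2 h3 h4 h5 h6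
    rw [h1, h2, h3, h4, h5, h6, deformPotential]
    push_cast
    ring

/-- Convergence of the oscillatory integral on all of `𝓢(ℝⁿ)_⊗` shows that the restriction loses no
domain. Single-valuedness of the limit identifies the action. -/
theorem isTransportOperator_deformedCoordinateOp (θ : Matrix (Fin (n + 1)) (Fin (n + 1)) ℝ)
    (j : Fin n) : IsTransportOperator j (deformPotential θ j) (deformedCoordinateOp θ j) where
  potential k := isTransportPotential_deformPotential θ j k
  perm k σ p := deformPotential_perm θ j k σ p
  domain_eq := by
    refine inf_eq_left.2 fun Φ hΦ => ?_
    obtain ⟨Ψ, hΨ, -⟩ := exists_isWarpedConvolution_coordinateOp θ j hΦ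
    exact LinearPMap.mem_domain_iff.2 ⟨Ψ, (warpedConvolution_graph _ _ _ _ _).2 hΨ⟩
  wave_apply x k f hf hxf := by
    obtain ⟨Ψ, hΨ, hΨ'⟩ := exists_isWarpedConvolution_coordinateOp θ j (Φ := x) x.2.1
    have h1 := (warpedConvolution_graph _ _ _ _ _).2 hΨ
    have h2 := (warpedConvolution translationOp θ (coordinateOp j).closure).mem_graph ⟨x, x.2.2⟩
    have h3 : deformedCoordinateOp θ j x = Ψ := LinearPMap.mem_graph_snd_inj _ h2 h1 rfl
    rw [h3]
    exact hΨ' k f hf hxf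

/-! ### Identification with the sum of operator products -/

theorem IsTransportOperator.ext {j : Fin n} {W : (k : ℕ) → (Fin k → Momentum n) → ℝ}
    {A B : Fock n →ₗ.[ℂ] Fock n} (hA : IsTransportOperator j W A)
    (hB : IsTransportOperator j W B) : A = B := by
  refine LinearPMap.ext (hA.domain_eq.trans hB.domain_eq.symm) fun x hx hx' =>
    Fock.ext_wave fun k => ?_
  obtain ⟨f, hf, hf', -⟩ := schwartzFock_representative (hA.domain_eq ▸ hx) k
  exact (hA.wave_apply ⟨x, hx⟩ k f hf hf').trans (hB.wave_apply ⟨x, hx'⟩ k f hf hf').symm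

theorem opMul_graph {H : Type*} [NormedAddCommGroup H] [InnerProductSpace ℂ H]
    (A B : H →ₗ.[ℂ] H) (Φ Ψ : H) :
    (Φ, Ψ) ∈ (opMul A B).graph ↔ ∃ Φ', (Φ, Φ') ∈ B.graph ∧ (Φ', Ψ) ∈ A.graph := by
  constructor
  · intro h
    obtain ⟨⟨_, x, hx, rfl⟩, rfl, rfl⟩ := (LinearPMap.mem_graph_iff _).1 h
    exact ⟨B x, B.mem_graph x, A.mem_graph ⟨B x, hx⟩⟩
  · rintro ⟨Φ', h1, h2⟩
    obtain ⟨x, rfl, rfl⟩ := (LinearPMap.mem_graph_iff _).1 h1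
    obtain ⟨y, hy, rfl⟩ := (LinearPMap.mem_graph_iff _).1 h2
    simp only at hy
    have hx : B x ∈ A.domain := hy ▸ y.2
    refine (LinearPMap.mem_graph_iff _).2 ⟨⟨x, x, hx, rfl⟩, rfl, ?_⟩
    change A ⟨B x, hx⟩ = A y
    congr 1
    exact Subtype.ext hy.symm

/-- On `𝓢(ℝⁿ)_⊗` the product of second quantised functions is multiplication by the product. -/
theorem opMul_secondQuantize {a b : Momentum n → ℝ} (ha : Measurable a) (hb : Measurable b)
    (hab : ∀ k, ∃ C, ∀ p : Fin k → Momentum n, |(∑ i, a (p i)) * ∑ i, b (p i)| ≤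
      C * momentumWeight p)
    (hbw : ∀ k, ∃ C, ∀ p : Fin k → Momentum n, |∑ i, b (p i)| ≤ C * momentumWeight p) :
    schwartzFock n ≤ (opMul (secondQuantize a) (secondQuantize b)).domain ∧
      ∀ (x : (opMul (secondQuantize a) (secondQuantize b)).domain) (k : ℕ),
        (opMul (secondQuantize a) (secondQuantize b) x).wave k =ᵐ[volume] fun p =>
          (((∑ i, a (p i)) * ∑ i, b (p i) : ℝ) : ℂ) * (x : Fock n).wave k p := by
  constructor
  · intro Φ hΦ
    have hm : ∀ {c : Momentum n → ℝ}, Measurable c → ∀ k,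
        Measurable fun p : Fin k → Momentum n => ∑ i, c (p i) := fun hc k =>
      Finset.measurable_sum _ fun i _ => hc.comp (measurable_pi_apply i)
    obtain ⟨Φ', h1, -⟩ := exists_fock_mul hΦ (m := fun _ p => ∑ i, b (p i)) (hm hb) hbw
      fun k σ p => Equiv.sum_comp σ fun i => b (p i)
    obtain ⟨Ψ, h2, -⟩ := exists_fock_mul hΦ (m := fun _ p => (∑ i, a (p i)) * ∑ i, b (p i))
      (fun k => (hm ha k).mul (hm hb k)) hab fun k σ p =>
        congrArg₂ (· * ·) (Equiv.sum_comp σ fun i => a (p i)) (Equiv.sum_comp σ fun i => b (p i))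
    refine LinearPMap.mem_domain_iff.2 ⟨Ψ, (opMul_graph _ _ _ _).2 ⟨Φ',
      (secondQuantize_graph _ _ _).2 h1, (secondQuantize_graph _ _ _).2 fun k => ?_⟩⟩
    filter_upwards [h1 k, h2 k] with p e1 e2
    rw [e1, e2]
    push_cast
    ring
  · intro x k
    obtain ⟨Φ', h1, h2⟩ := (opMul_graph _ _ _ _).1 (LinearPMap.mem_graph _ x)
    filter_upwards [(secondQuantize_graph _ _ _).1 h1 k, (secondQuantize_graph _ _ _).1 h2 k]
      with p e1 e2
    rw [e2, e1, Complex.ofReal_mul, mul_assoc]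

/-- The domain of `A` is already `𝓢(ℝⁿ)_⊗`, so intersecting with the larger domains of `B` and `C`
changes nothing. -/
theorem IsTransportOperator.add_sub {j : Fin n} {A B C : Fock n →ₗ.[ℂ] Fock n}
    {W b c : (k : ℕ) → (Fin k → Momentum n) → ℝ}
    (hA : IsTransportOperator j (fun _ _ => 0) A) (hW : ∀ k, IsTransportPotential j (W k))
    (hs : ∀ k (σ : Equiv.Perm (Fin k)) p, W k (p ∘ σ) = W k p)
    (dB : schwartzFock n ≤ B.domain)
    (hB : ∀ (x : B.domain) k, (B x).wave k =ᵐ[volume] fun p => (b k p : ℂ) * (x : Fock n).wave k p)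
    (dC : schwartzFock n ≤ C.domain)
    (hC : ∀ (x : C.domain) k, (C x).wave k =ᵐ[volume] fun p => (c k p : ℂ) * (x : Fock n).wave k p)
    (hbc : ∀ k p, W k p = b k p - c k p) : IsTransportOperator j W (A + B - C) where
  potential := hW
  perm := hs
  domain_eq := by
    rw [LinearPMap.sub_domain, LinearPMap.add_domain, hA.domain_eq, inf_eq_left.2 dB,
      inf_eq_left.2 dC]
  wave_apply := by
    intro x k f hf hxf
    rw [LinearPMap.sub_apply, LinearPMap.add_apply]
    set a' := A ⟨x, x.2.1.1⟩
    set b' := B ⟨x, x.2.1.2⟩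
    set c' := C ⟨x, x.2.2⟩
    have hsub : (a' + b' - c').wave k =ᵐ[volume] fun p => (a' + b').wave k p - c'.wave k p :=
      Lp.coeFn_sub (((a' + b') k : symmetricL2 n k) : NParticleL2 n k) (c' k : symmetricL2 n k)
    filter_upwards [hsub, Fock.wave_add a' b' k, hA.wave_apply ⟨x, x.2.1.1⟩ k f hf hxf,
      hB ⟨x, x.2.1.2⟩ k, hC ⟨x, x.2.2⟩ k, hxf] with p h1 h2 h3 h4 h5 h6
    rw [h1, h2, h3, h4, h5, h6, hbc]
    push_cast
    ring

/-- Once the operator products are known to be defined on `𝓢(ℝⁿ)_⊗`, this side has the same domain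
and potential as `X^j_θ`. A transport operator is determined by its potential, so equality follows
from `IsTransportOperator.ext`. -/
theorem isTransportOperator_add_sub_opMul (θ : Matrix (Fin (n + 1)) (Fin (n + 1)) ℝ)
    (j : Fin n) : IsTransportOperator j (deformPotential θ j)
      (coordinateOp j + opMul (deformedMomentumOp θ 0) (velocityOp j) -
        opMul (deformedMomentumOp θ j.succ) (numberOp n)) := by
  have hX := isTransportOperator_coordinateOp j
  obtain ⟨C, hC0, hC⟩ := exists_abs_deform_le θ
  have hd : ∀ μ, Measurable fun q : Momentum n => deform θ (fourMomentum q) μ := fun μ =>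
    ((EuclideanSpace.proj (𝕜 := ℝ) μ).continuous.comp
      ((continuous_deform θ).comp continuous_fourMomentum)).measurable
  have hdb : ∀ {k} μ (p : Fin k → Momentum n),
      |∑ i, deform θ (fourMomentum (p i)) μ| ≤ C * (2 * k) * momentumWeight p := fun μ p => by
    rw [← deform_sum, mul_assoc]
    exact (hC _ _).trans (mul_le_mul_of_nonneg_left (norm_totalMomentum_le p) hC0)
  have hbound : ∀ {b : Momentum n → ℝ} (_ : ∀ k (p : Fin k → Momentum n), |∑ i, b (p i)| ≤ k) μ,
      (∀ k, ∃ C, ∀ p : Fin k → Momentum n,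
        |(∑ i, deform θ (fourMomentum (p i)) μ) * ∑ i, b (p i)| ≤ C * momentumWeight p) ∧
      ∀ k, ∃ C, ∀ p : Fin k → Momentum n, |∑ i, b (p i)| ≤ C * momentumWeight p := by
    intro b hb μ
    refine ⟨fun k => ⟨C * (2 * k) * k, fun p => ?_⟩, fun k => ⟨k, fun p => ?_⟩⟩
    · rw [abs_mul, mul_right_comm]
      have := momentumWeight_nonneg p
      exact mul_le_mul (hdb μ p) (hb k p) (abs_nonneg _) (by positivity)
    · exact (hb k p).trans (le_mul_of_one_le_right (Nat.cast_nonneg k) (one_le_momentumWeight p))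
  have hv : Measurable fun q : Momentum n => q j / ‖q‖ :=
    ((EuclideanSpace.proj (𝕜 := ℝ) j).continuous.measurable).div measurable_norm
  have bV := hbound (b := fun q => q j / ‖q‖) (fun k p => abs_totalVelocity_le j p) 0
  have bN := hbound (b := fun _ => 1) (fun k p => by simp) j.succ
  obtain ⟨dV, wV⟩ := opMul_secondQuantize (hd 0) hv bV.1 bV.2
  obtain ⟨dN, wN⟩ := opMul_secondQuantize (hd j.succ) measurable_const bN.1 bN.2
  refine hX.add_sub (isTransportPotential_deformPotential θ j) (deformPotential_perm θ j)
    dV wV dN wN fun k p => ?_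
  rw [deformPotential, deform_sum, deform_sum, totalVelocity]
  simp

end Deformed

end

theorem mainTheorem3 {n : ℕ} (θ : Matrix (Fin (n + 1)) (Fin (n + 1)) ℝ)
    (hθ : θ.transpose = -θ) (j : Fin n) :
    Dense (schwartzFock n : Set (Fock n)) ∧
    (deformedCoordinateOp θ j).domain = schwartzFock n ∧
    deformedCoordinateOp θ j =
      coordinateOp j + opMul (deformedMomentumOp θ 0) (velocityOp j) -
        opMul (deformedMomentumOp θ j.succ) (numberOp n) ∧
    IsEssentiallySelfAdjoint (deformedCoordinateOp θ j) :=
  ⟨dense_schwartzFock, (isTransportOperator_deformedCoordinateOp θ j).domain_eq,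
    (isTransportOperator_deformedCoordinateOp θ j).ext (isTransportOperator_add_sub_opMul θ j),
    (isTransportOperator_deformedCoordinateOp θ j).isEssentiallySelfAdjoint.1⟩
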